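/- **Theorem 5.2.** Let $A=\bigoplus_{n,l}A_{n,l}$, where $A_{n,l}$ is the space of infinite formal $\mathbb{C}$-linear combinations of monomials $x_{i_1}\cdots x_{i_l}$ ($i_1,\dots,i_l\in\mathbb{Z}$) with $i_1+\dots+i_l=n$; this is a commutative algebra with $\deg x_i=(i,1)$. The ideal of $A$ generated by a family $(y_i)$ means the set of all elements of $A$ that are formal sums $\sum_i p_iy_i$ with $p_i\in A$ (possibly infinitely many terms, each monomial occurring in only finitely many of them). For $N\in\mathbb{Z}$ let $C_N$ be the ideal generated by $x_{N+1},x_{N+2},\dots$, and for a homogeneous ideal $J$ put $\dim_N(A/J)_{n,l}=\dim\big(A/(J+C_N)\big)_{n,l}$. For $q\in\mathbb{C}$, $|q|<1$, let $g(z)=\sum_{n\in\mathbb{Z}}(-1)^nz^nq^{n(n-1)/2}$ (with $0^0=1$), and for $n,k\ge1$ let $$f_{n,k}(z_1,\dots,z_n)=(-1)^n\sum_{\sigma\in S_n}\ \prod_{j=1}^{n}\frac{g\big(z_{\sigma(1)}^{-1}\cdots z_{\sigma(j-1)}^{-1}z_{\sigma(j)}^{k}\big)}{g\big(z_{\sigma(1)}^{-1}\cdots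 z_{\sigma(j)}^{-1}\big)} .$$ Fix $k\ge2$. Then for every $q$ with $|q|<1$ there are coefficients $a_{\alpha}=a_\alpha(q)\in\mathbb{C}$, indexed by the integer sequences $\alpha_1\le\dots\le\alpha_k$ with $\alpha_1+\dots+\alpha_k=\frac{k(k-1)}2$, such that the Laurent series $$\sum_{\alpha}\sum_{\sigma\in S_k}a_{\alpha}\,z_{\sigma(1)}^{\alpha_1+1}\cdots z_{\sigma(k)}^{\alpha_k+1}$$ converges absolutely for all $z\in(\mathbb{C}\setminus\{0\})^k$ and equals $f_{k,k}(z_1,\dots,z_k)$ wherever no denominator in the formula for $f_{k,k}$ vanishes. For any such coefficients put $$y_i(q)=\sum_{\alpha}a_{\alpha}(q)\,x_{i+\alpha_1}x_{i+\alpha_2}\cdots x_{i+\alpha_k}\in A,\qquad i\in\mathbb{Z},$$ let $I_q$ be the ideal of $A$ generated by the $y_i(q)$, $i\in\mathbb{Z}$, and let $I_0$ be the ideal generated by the monomials $x_ix_{i+1}\cdots x_{i+k-1}$, $i\in\mathbb{Z}$. Then $A/I_q$ is a flat deformation of $A/I_0$: each $y_i(q)$ is homogeneous of a bidegree independent of $q$,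 its coefficients are holomorphic in $q$ on $|q|<1$, $y_i(0)=x_ix_{i+1}\cdots x_{i+k-1}$, and $$\dim_N(A/I_q)_{n,l}=\dim_N(A/I_0)_{n,l}\qquad\text{for all } N,n\in\mathbb{Z},\ l\ge0,\ |q|<1 .$$ -/

import Mathlib

/-- The weight of the monomial `∏ x_i ^ m_i` in the variables `x_i`, `i ∈ ℤ`: `x_i` has weight `i`. -/
def monWeight (m : ℤ →₀ ℕ) : ℤ := m.sum fun i a => (a : ℤ) * i

/-- The `ℤ × ℕ`-degree of a monomial, `deg x_i = (i, 1)`. -/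
def bideg (m : ℤ →₀ ℕ) : ℤ × ℕ := (monWeight m, m.sum fun _ a => a)

theorem bideg_zero : bideg 0 = 0 := by
  simp [bideg, monWeight]

theorem bideg_add (m m' : ℤ →₀ ℕ) : bideg (m + m') = bideg m + bideg m' := by
  unfold bideg monWeight
  rw [Finsupp.sum_add_index' (by simp) (by intros; push_cast; ring),
    Finsupp.sum_add_index' (by simp) (by intros; rfl)]
  rfl

/-- The set of bidegrees in which a formal sum of monomials is nonzero. -/
def bidegSupport (F : MvPowerSeries ℤ ℂ) : Set (ℤ × ℕ) :=
  bideg '' {m | MvPowerSeries.coeff m F ≠ 0}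

theorem bidegSupport_add_subset (F G : MvPowerSeries ℤ ℂ) :
    bidegSupport (F + G) ⊆ bidegSupport F ∪ bidegSupport G := by
  rintro _ ⟨m, hm, rfl⟩
  by_cases h : MvPowerSeries.coeff m F = 0
  · right
    refine ⟨m, fun h' => hm ?_, rfl⟩
    rw [map_add, h, h', add_zero]
  · left
    exact ⟨m, h, rfl⟩

theorem bidegSupport_mul_subset (F G : MvPowerSeries ℤ ℂ) :
    bidegSupport (F * G) ⊆ Set.image2 (· + ·) (bidegSupport F) (bidegSupport G) := by
  classical
  rintro _ ⟨m, hm, rfl⟩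
  have hm' : MvPowerSeries.coeff m (F * G) ≠ 0 := hm
  rw [MvPowerSeries.coeff_mul] at hm'
  obtain ⟨p, hp, hne⟩ := Finset.exists_ne_zero_of_sum_ne_zero hm'
  refine ⟨_, ⟨p.1, left_ne_zero_of_mul hne, rfl⟩, _, ⟨p.2, right_ne_zero_of_mul hne, rfl⟩, ?_⟩
  have := Finset.HasAntidiagonal.mem_antidiagonal.mp hp
  rw [← this, bideg_add]

theorem bidegSupport_algebraMap (c : ℂ) :
    bidegSupport (algebraMap ℂ (MvPowerSeries ℤ ℂ) c) ⊆ {0} := by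
  classical
  rintro _ ⟨m, hm, rfl⟩
  have hm' : MvPowerSeries.coeff m (algebraMap ℂ (MvPowerSeries ℤ ℂ) c) ≠ 0 := hm
  rw [MvPowerSeries.algebraMap_apply, MvPowerSeries.coeff_C] at hm'
  have : m = 0 := by
    by_contra h
    simp [h] at hm'
  rw [this, bideg_zero]
  rfl

/-- The algebra `A = ⨁ A_{n,l}`, where `A_{n,l}` consists of the infinite formal `ℂ`-linear
combinations of monomials of bidegree `(n, l)` in the variables `x_i`, `i ∈ ℤ`. -/
def algA : Subalgebra ℂ (MvPowerSeries ℤ ℂ) where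
  carrier := {F | (bidegSupport F).Finite}
  mul_mem' {F G} hF hG :=
    (Set.Finite.image2 _ hF hG).subset (bidegSupport_mul_subset F G)
  add_mem' {F G} hF hG := (Set.Finite.union hF hG).subset (bidegSupport_add_subset F G)
  algebraMap_mem' c := (Set.finite_singleton 0).subset (bidegSupport_algebraMap c)

/-- The coefficient of a monomial in an element of `A`. -/
noncomputable def coeffA (m : ℤ →₀ ℕ) (F : algA) : ℂ := MvPowerSeries.coeff m F.1

theorem coeffA_add (m : ℤ →₀ ℕ) (F G : algA) : coeffA m (F + G) = coeffA m F + coeffA m G := by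
  simp [coeffA]

theorem coeffA_zero (m : ℤ →₀ ℕ) : coeffA m 0 = 0 := by
  simp [coeffA]

theorem coeffA_mul (m : ℤ →₀ ℕ) (F G : algA) :
    coeffA m (F * G) = ∑ p ∈ Finset.HasAntidiagonal.antidiagonal m, coeffA p.1 F * coeffA p.2 G := by
  classical
  simp only [coeffA]
  exact MvPowerSeries.coeff_mul m F.1 G.1

/-- The homogeneous component `A_{n,l}`. -/
noncomputable def compA (n : ℤ) (l : ℕ) : Submodule ℂ algA where
  carrier := {F | ∀ m, coeffA m F ≠ 0 → bideg m = (n, l)}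
  add_mem' {F G} hF hG m hm := by
    by_cases h : coeffA m F = 0
    · refine hG m fun h' => hm ?_
      rw [coeffA_add, h, h', add_zero]
    · exact hF m h
  zero_mem' m hm := absurd (coeffA_zero m) hm
  smul_mem' c F hF m hm := by
    refine hF m fun h => hm ?_
    have : coeffA m (c • F) = c * coeffA m F := by simp [coeffA]
    rw [this, h, mul_zero]

/-- The variable `x_j` as an element of `A`. -/
noncomputable def varA (j : ℤ) : algA :=
  ⟨MvPowerSeries.X j, by
    classical
    refine (Set.finite_singleton (bideg (Finsupp.single j 1))).subset ?_
    rintro _ ⟨m, hm, rfl⟩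
    have hm' : MvPowerSeries.coeff m (MvPowerSeries.X j : MvPowerSeries ℤ ℂ) ≠ 0 := hm
    rw [MvPowerSeries.coeff_X] at hm'
    have : m = Finsupp.single j 1 := by
      by_contra h
      simp [h] at hm'
    rw [this]
    rfl⟩

/-- `F` is the infinite formal sum of the family `u`: every monomial occurs in only finitely many
members of the family, and its coefficient in `F` is the sum of its coefficients in the `u i`. -/
def IsFormalSum {ι : Type*} (u : ι → algA) (F : algA) : Prop :=
  ∀ m : ℤ →₀ ℕ, (Function.support fun i => coeffA m (u i)).Finite ∧
    coeffA m F = ∑ᶠ i, coeffA m (u i)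

/-- The ideal of `A` generated by a family `y`, in the completed sense: the set of all elements of
`A` that are infinite formal sums `∑ p_i y_i` with `p_i ∈ A`. -/
noncomputable def formalIdeal {ι : Type*} (y : ι → algA) : Ideal algA where
  carrier := {F | ∃ p : ι → algA, IsFormalSum (fun i => p i * y i) F}
  add_mem' := by
    rintro F G ⟨p, hp⟩ ⟨r, hr⟩
    refine ⟨fun i => p i + r i, fun m => ?_⟩
    have e : (fun i => coeffA m ((p i + r i) * y i)) =
        fun i => coeffA m (p i * y i) + coeffA m (r i * y i) := by
      funext i
      rw [add_mul, coeffA_add]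
    simp only [e]
    refine ⟨((hp m).1.union (hr m).1).subset (Function.support_add _ _), ?_⟩
    rw [coeffA_add, (hp m).2, (hr m).2, ← finsum_add_distrib (hp m).1 (hr m).1]
  zero_mem' := ⟨fun _ => 0, fun m => by simp [coeffA_zero, Function.support]⟩
  smul_mem' := by
    rintro a F ⟨p, hp⟩
    refine ⟨fun i => a * p i, fun m => ?_⟩
    have e : (fun i => coeffA m (a * p i * y i)) =
        fun i => ∑ d ∈ Finset.HasAntidiagonal.antidiagonal m, coeffA d.1 a * coeffA d.2 (p i * y i) := by
      funext i
      rw [mul_assoc, coeffA_mul]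
    simp only [e]
    have hfin : ∀ d ∈ Finset.HasAntidiagonal.antidiagonal m,
        (Function.support fun i => coeffA d.1 a * coeffA d.2 (p i * y i)).Finite := fun d _ =>
      (hp d.2).1.subset fun i hi => right_ne_zero_of_mul hi
    refine ⟨((Finset.HasAntidiagonal.antidiagonal m).finite_toSet.biUnion hfin).subset ?_, ?_⟩
    · intro i hi
      obtain ⟨d, hd, hne⟩ := Finset.exists_ne_zero_of_sum_ne_zero hi
      exact Set.mem_biUnion hd hne
    · rw [smul_eq_mul, coeffA_mul, finsum_sum_comm _ _ hfin]
      refine Finset.sum_congr rfl fun d _ => ?_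
      rw [(hp d.2).2]
      exact mul_finsum' _ _ (hp d.2).1

/-- The cut-off ideal `C_N`, generated by `x_{N+1}, x_{N+2}, …`. -/
noncomputable def cutoff (N : ℤ) : Ideal algA :=
  formalIdeal fun j : {j : ℤ // N < j} => varA j

/-- `(A/J)_{n,l}`: the image of `A_{n,l}` in `A/J`. -/
noncomputable def compQuot (J : Ideal algA) (n : ℤ) (l : ℕ) : Submodule ℂ (algA ⧸ J) :=
  (compA n l).map (Ideal.Quotient.mkₐ ℂ J).toLinearMap

/-- `dim_N (A/J)_{n,l}`, the dimension of the `(n,l)`-component of the quotient of `A/J` by (the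
image of) the cut-off ideal `C_N`. -/
noncomputable def dimCut (N : ℤ) (J : Ideal algA) (n : ℤ) (l : ℕ) : Cardinal :=
  Module.rank ℂ (compQuot (J ⊔ cutoff N) n l)

/-- The family of ideals generated by the `y q i`, `|q| < 1`, is a flat deformation of the ideal
generated by the `y₀ i`: the generators are homogeneous of a bidegree that does not depend on `q`,
depend holomorphically on `q` and specialize to `y₀` at `q = 0`, and the (cut-off) dimensions of
all homogeneous components of the quotient are, for every `q`, those of the undeformed quotient. -/
structure IsFlatDeformation {ι : Type*} (y : ℂ → ι → algA) (y₀ : ι → algA) : Prop where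
  homogeneous : ∀ i, ∃ n l, ∀ q : ℂ, ‖q‖ < 1 → y q i ∈ compA n l
  holomorphic : ∀ i m, DifferentiableOn ℂ (fun q => coeffA m (y q i)) (Metric.ball 0 1)
  special : ∀ i, y 0 i = y₀ i
  dim_eq : ∀ q : ℂ, ‖q‖ < 1 → ∀ (N n : ℤ) (l : ℕ),
    dimCut N (formalIdeal (y q)) n l = dimCut N (formalIdeal y₀) n l

/-- The index set of the coefficients: integers `α_1 ≤ … ≤ α_k` with sum `k(k-1)/2`. -/
def Expo (k : ℕ) : Type :=
  {α : Fin k → ℤ // Monotone α ∧ ∑ j, α j = (k : ℤ) * (k - 1) / 2}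

/-- The exponent of the monomial `x_{i+α_1} ⋯ x_{i+α_k}`. -/
noncomputable def shiftMon {k : ℕ} (α : Expo k) (i : ℤ) : ℤ →₀ ℕ :=
  ∑ j, Finsupp.single (i + α.1 j) 1

theorem bideg_shiftMon {k : ℕ} (α : Expo k) (i : ℤ) :
    bideg (shiftMon α i) = ((k : ℤ) * i + (k : ℤ) * (k - 1) / 2, k) := by
  have h : ∀ s : Finset (Fin k), bideg (∑ j ∈ s, Finsupp.single (i + α.1 j) 1) =
      (∑ j ∈ s, (i + α.1 j), s.card) := by
    classical
    intro s
    induction s using Finset.induction_on with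
    | empty => simp [bideg_zero]; rfl
    | insert a s ha ih =>
      rw [Finset.sum_insert ha, bideg_add, ih, Finset.sum_insert ha, Finset.card_insert_of_notMem ha]
      simp [bideg, monWeight, add_comm]
  unfold shiftMon
  rw [h, Finset.sum_add_distrib, α.2.2]
  simp

/-- The element `y_i = ∑_α a_α x_{i+α_1} ⋯ x_{i+α_k}` of `A`; distinct `α` give distinct monomials,
so each coefficient is a sum with at most one nonzero term. -/
noncomputable def deformedGen (k : ℕ) (a : Expo k → ℂ) (i : ℤ) : algA :=
  ⟨fun m => ∑ᶠ α : Expo k, if shiftMon α i = m then a α else 0, by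
    refine (Set.finite_singleton ((k : ℤ) * i + (k : ℤ) * (k - 1) / 2, k)).subset ?_
    rintro _ ⟨m, hm, rfl⟩
    have hm' : (∑ᶠ α : Expo k, if shiftMon α i = m then a α else 0) ≠ 0 := hm
    obtain ⟨α, this⟩ : ∃ α : Expo k, shiftMon α i = m := by
      by_contra! h
      simp [h] at hm'
    rw [← this]
    exact bideg_shiftMon α i⟩

/-- The theta function `g(z) = ∑_{n ∈ ℤ} (-1)^n z^n q^{n(n-1)/2}`. -/
noncomputable def thetaG (q z : ℂ) : ℂ :=
  ∑' n : ℤ, (-1 : ℂ) ^ n * z ^ n * q ^ (n * (n - 1) / 2)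

/-- The function `f_{n,k}`, given by
`(-1)^n ∑_σ ∏_j g(z_{σ(1)}⁻¹ ⋯ z_{σ(j-1)}⁻¹ z_{σ(j)}^k) / g(z_{σ(1)}⁻¹ ⋯ z_{σ(j)}⁻¹)`. -/
noncomputable def thetaF (n k : ℕ) (q : ℂ) (z : Fin n → ℂ) : ℂ :=
  (-1) ^ n * ∑ σ : Equiv.Perm (Fin n), ∏ j : Fin n,
    thetaG q ((∏ i ∈ Finset.Iio j, (z (σ i))⁻¹) * z (σ j) ^ k) /
      thetaG q (∏ i ∈ Finset.Iic j, (z (σ i))⁻¹)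

/-- None of the denominators in the formula for `f_{n,k}(z)` vanishes. -/
def DenomNeZero (n : ℕ) (q : ℂ) (z : Fin n → ℂ) : Prop :=
  ∀ S : Finset (Fin n), S.Nonempty → thetaG q (∏ i ∈ S, (z i)⁻¹) ≠ 0

/-- The term `a_α z_{σ(1)}^{α_1+1} ⋯ z_{σ(k)}^{α_k+1}` of the generating function. -/
noncomputable def genTerm (k : ℕ) (a : Expo k → ℂ) (z : Fin k → ℂ)
    (p : Expo k × Equiv.Perm (Fin k)) : ℂ :=
  a p.1 * ∏ j, z (p.2 j) ^ (p.1.1 j + 1)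

/-- The generating function `∑_{α,σ} a_α z_{σ(1)}^{α_1+1} ⋯ z_{σ(k)}^{α_k+1}` of the coefficients
`a` is (the Laurent expansion on `(ℂ \ {0})^k` of) `f_{k,k}`. -/
def HasThetaGeneratingFunction (k : ℕ) (q : ℂ) (a : Expo k → ℂ) : Prop :=
  ∀ z : Fin k → ℂ, (∀ j, z j ≠ 0) →
    Summable (genTerm k a z) ∧ (DenomNeZero k q z → ∑' p, genTerm k a z p = thetaF k k q z)

/-!
Write `ρ = (0, 1, …, k - 1)`, so that `y_i(0)` is the monomial of `ρ` shifted by `i`.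

*The coefficients exist.* If `∏ a_j = ∏ w_j` and no `g(w_j / w_r)`, `j ≠ r`, is zero, the sum
`∑_r ∏_j g(a_j / w_r) / ∏_{j ≠ r} g(w_j / w_r)` vanishes (`sum_prod_thetaG_div_eq_zero`); this is
the residue theorem for an elliptic function, proved here by induction from the fact that the
functions `x ↦ g(x / y) g(B / (x y))` lie in a space of dimension two for fixed `B`. Splitting off
the last factor of each product expresses `f_{n+1,k}` as a sum of products of `f_{n,k}` and theta
functions divided by `g(1 / ∏ z_i)`. The partial fraction identity, applied to the rotations of the
variables, shows that the numerator vanishes on `∏ z_i = 1` (`thetaRec_eq_zero`); it is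
quasi-periodic, hence it vanishes on all zeros of the denominator, and it is divisible by it
(`EntireLaurent.exists_mul_thetaG_eq`, which uses explicit Laurent expansions of `1 / g`, the Appell
series, in all annuli). By induction `f_{n,k}` is the sum of an everywhere convergent Laurent series
(`exists_entireLaurent_eq_thetaF`). For `n = k` it is symmetric and homogeneous, which gives the
coefficients `a_α` for `q ≠ 0`.

*The relations.* For `n = k` the numerator is homogeneous, so it vanishes identically, not only on
`∏ z_i = 1`. In terms of the coefficients this is the relation
`∑_n (-1) ^ n q ^ (n (n - 1) / 2) x_{kn+i-1} y_{i-n} = 0` (`HasThetaGeneratingFunction.isSyzygetic`,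
`IsSyzygetic.finsum_eq_zero`). Everything else follows from this relation together with
`∑_α a_α = 1`.

*Support and dependence on `q`.* Comparing energies `∑ (α_j + 1) ^ 2` in the relation shows that
every nonzero solution has a nonzero coefficient at `ρ`, that all other exponents in its support
have larger energy (`IsSyzygetic.rho_ne_zero`), and that they contain an index `≥ k - 1`
(`IsSyzygetic.exists_le`). So the solutions form a line, and replacing `q` by `sq` multiplies `a_α`
by a power of `s`. Hence `a_α(q) = c_α q ^ e_α / ∑_β c_β q ^ e_β` with constants `c_α`, where
`e_α > 0` if `α ≠ ρ` and `c_α ≠ 0` (`exists_coeff_eq`): the coefficients are holomorphic, and as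
`q → 0` they tend to those of `y_i = x_i x_{i+1} ⋯ x_{i+k-1}`.

*The dimensions.* Modulo the variables `x_j`, `j > N`, each component of `A` has a finite basis of
monomials, and the image of the ideal is spanned by the products `x ^ d y_i`, with leading monomial
`x ^ d x_i ⋯ x_{i+k-1}` of lowest energy. If two products have the same leading monomial, they agree
up to terms of higher energy by the relation above (when the two runs of indices overlap) or by
`y_i y_j = y_j y_i` (when they do not). So the products with distinct leading monomials form a basis
(`genVec_mem_span`, `linearIndependent_leadVec`), and for every `q` the dimension of the quotient is
the number of monomials not divisible by any `x_i x_{i+1} ⋯ x_{i+k-1}` (`dimCut_deformedGen`).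
-/

open Filter Topology

/-! ### The theta function -/

/-- The triangular number `n (n - 1) / 2`, the exponent of `q` in the theta function. -/
def tri (n : ℤ) : ℤ := n * (n - 1) / 2

theorem two_mul_tri (n : ℤ) : 2 * tri n = n * (n - 1) :=
  Int.mul_ediv_cancel' (Int.even_mul_pred_self n).two_dvd

theorem tri_nonneg (n : ℤ) : 0 ≤ tri n := by
  have h := two_mul_tri n
  rcases le_or_gt n 0 with h0 | h0 <;> nlinarith

theorem tri_zero : tri 0 = 0 := rfl

theorem tri_one : tri 1 = 0 := rfl

theorem tri_add (m n : ℤ) : tri (m + n) = tri m + tri n + m * n := by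
  have h1 := two_mul_tri m
  have h2 := two_mul_tri n
  have h3 := two_mul_tri (m + n)
  linarith [show (m + n) * (m + n - 1) = m * (m - 1) + n * (n - 1) + 2 * (m * n) by ring]

theorem tri_succ (n : ℤ) : tri (n + 1) = tri n + n := by
  rw [tri_add, tri_one]; ring

theorem tri_one_sub (n : ℤ) : tri (1 - n) = tri n := by
  have h1 := two_mul_tri n
  have h2 := two_mul_tri (1 - n)
  linarith [show (1 - n) * (1 - n - 1) = n * (n - 1) by ring]

theorem tri_neg (n : ℤ) : tri (-n) = tri n + n := by
  rw [← tri_succ, ← tri_one_sub (n + 1)]; ring_nf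

theorem tri_pos {n : ℤ} (h0 : n ≠ 0) (h1 : n ≠ 1) : 0 < tri n := by
  have h := two_mul_tri n
  have : n ≤ -1 ∨ 2 ≤ n := by omega
  rcases this with h2 | h2 <;> nlinarith

theorem HasSum.mul_prod {ι κ : Type*} {f : ι → ℂ} {g : κ → ℂ} {a b : ℂ} (hf : HasSum f a)
    (hg : HasSum g b) : HasSum (fun x : ι × κ => f x.1 * g x.2) (a * b) :=
  hf.mul hg (summable_mul_of_summable_norm hf.summable.norm hg.summable.norm)

theorem HasSum.of_forall_eq {ι : Type*} {f g : ι → ℂ} {a : ℂ} (hf : HasSum f a)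
    (h : ∀ i, f i = g i) : HasSum g a := by
  rwa [← funext h]

theorem summable_nat_tri {r ρ : ℝ} (hr0 : 0 ≤ r) (hr : r < 1) (hρ : 0 < ρ) (b : ℤ)
    (hb : 0 ≤ b) (hrb : r = 0 → b = 0) :
    Summable fun n : ℕ => r ^ (tri n + b * n) * ρ ^ (n : ℤ) := by
  have hlim : Tendsto (fun n : ℕ => r ^ n * (r ^ b * ρ)) atTop (𝓝 0) := by
    simpa using (tendsto_pow_atTop_nhds_zero_of_lt_one hr0 hr).mul_const (r ^ b * ρ)
  refine summable_of_ratio_norm_eventually_le (r := 1 / 2) (by norm_num) ?_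
  filter_upwards [hlim.eventually (gt_mem_nhds (show (0 : ℝ) < 1 / 2 by norm_num))] with n hn
  have e : r ^ (tri ((n + 1 : ℕ) : ℤ) + b * ((n + 1 : ℕ) : ℤ)) =
      r ^ (tri n + b * n) * (r ^ n * r ^ b) := by
    push_cast
    rw [tri_succ]
    rcases eq_or_lt_of_le hr0 with h0 | h0
    · obtain rfl := hrb h0.symm
      have ht := tri_nonneg n
      lift tri n to ℕ using ht with t
      rw [zero_mul, zero_mul, add_zero, add_zero, zpow_zero, mul_one, zpow_natCast, ← pow_add]
      norm_cast
    · rw [← zpow_natCast r n, ← zpow_add₀ h0.ne', ← zpow_add₀ h0.ne']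
      congr 1
      ring
  have hpos : 0 ≤ r ^ (tri n + b * n) * ρ ^ (n : ℤ) := by positivity
  rw [e, Real.norm_of_nonneg (by positivity), Real.norm_of_nonneg hpos]
  push_cast
  rw [zpow_add_one₀ hρ.ne']
  calc r ^ (tri n + b * n) * (r ^ n * r ^ b) * (ρ ^ (n : ℤ) * ρ)
      = (r ^ n * (r ^ b * ρ)) * (r ^ (tri n + b * n) * ρ ^ (n : ℤ)) := by ring
    _ ≤ _ := by gcongr

/-- Absolute convergence of the theta series. -/
theorem summable_tri {r ρ : ℝ} (hr0 : 0 ≤ r) (hr : r < 1) (hρ : 0 < ρ) :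
    Summable fun n : ℤ => r ^ tri n * ρ ^ n := by
  refine Summable.of_nat_of_neg ?_ ?_
  · simpa using summable_nat_tri hr0 hr hρ 0 le_rfl (fun _ => rfl)
  · rcases eq_or_lt_of_le hr0 with h0 | h0
    · subst h0
      refine summable_of_ne_finset_zero (s := {0}) fun n hn => ?_
      have hn : n ≠ 0 := by simpa using hn
      rw [zero_zpow _ (tri_pos (by omega) (by omega)).ne', zero_mul]
    · have := summable_nat_tri hr0 hr (inv_pos.2 hρ) 1 zero_le_one (fun h => absurd h h0.ne')
      refine this.congr fun n => ?_
      rw [tri_neg, one_mul, zpow_neg, inv_zpow]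

/-- The terms of the theta series are absolutely summable. -/
theorem summable_thetaG {q z : ℂ} (hq : ‖q‖ < 1) (hz : z ≠ 0) :
    Summable fun n : ℤ => (-1 : ℂ) ^ n * z ^ n * q ^ tri n := by
  refine Summable.of_norm ((summable_tri (norm_nonneg q) hq (norm_pos_iff.2 hz)).congr fun n => ?_)
  simp [norm_zpow, mul_comm]

theorem hasSum_thetaG {q z : ℂ} (hq : ‖q‖ < 1) (hz : z ≠ 0) :
    HasSum (fun n : ℤ => (-1 : ℂ) ^ n * z ^ n * q ^ tri n) (thetaG q z) :=
  (summable_thetaG hq hz).hasSum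

theorem neg_one_zpow_neg (n : ℤ) : (-1 : ℂ) ^ (-n) = (-1) ^ n := by
  rw [zpow_neg, ← inv_zpow, inv_neg_one]

theorem thetaG_inv {q z : ℂ} (hq : ‖q‖ < 1) (hz : z ≠ 0) :
    thetaG q z⁻¹ = -z⁻¹ * thetaG q z := by
  have h := (hasSum_thetaG hq (inv_ne_zero hz))
  have h2 := ((hasSum_thetaG hq hz).mul_left (-z⁻¹))
  rw [← (Equiv.subLeft (1 : ℤ)).hasSum_iff] at h2
  refine h.unique (h2.of_forall_eq fun n => ?_)
  simp only [Function.comp_apply, Equiv.subLeft_apply]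
  rw [tri_one_sub, sub_eq_add_neg, zpow_add₀ (by norm_num), zpow_add₀ hz, neg_one_zpow_neg,
    inv_zpow', zpow_one, zpow_one]
  field_simp

theorem thetaG_mul_q {q z : ℂ} (hq : ‖q‖ < 1) (hq0 : q ≠ 0) (hz : z ≠ 0) :
    thetaG q (q * z) = -z⁻¹ * thetaG q z := by
  have h := (hasSum_thetaG hq (mul_ne_zero hq0 hz))
  have h2 := ((hasSum_thetaG hq hz).mul_left (-z⁻¹))
  rw [← (Equiv.addRight (1 : ℤ)).hasSum_iff] at h2
  refine h.unique (h2.of_forall_eq fun n => ?_)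
  simp only [Function.comp_apply, Equiv.coe_addRight]
  rw [tri_succ, zpow_add₀ (by norm_num : (-1 : ℂ) ≠ 0), zpow_add₀ hz, mul_zpow,
    zpow_add₀ hq0, zpow_one, zpow_one]
  field_simp

theorem thetaG_one {q : ℂ} (hq : ‖q‖ < 1) : thetaG q 1 = 0 := by
  have h := thetaG_inv hq one_ne_zero
  rw [inv_one] at h
  linear_combination h / 2

theorem thetaG_q_mul_inv {q z : ℂ} (hq : ‖q‖ < 1) (hq0 : q ≠ 0) (hz : z ≠ 0) :
    thetaG q (q⁻¹ * z) = -(q⁻¹ * z) * thetaG q z := by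
  have h := thetaG_mul_q hq hq0 (mul_ne_zero (inv_ne_zero hq0) hz)
  rw [mul_inv_cancel_left₀ hq0] at h
  rw [h]
  field_simp

/-- Quasi-periodicity of the theta function. -/
theorem thetaG_zpow_mul {q z : ℂ} (hq : ‖q‖ < 1) (hq0 : q ≠ 0) (hz : z ≠ 0) (m : ℤ) :
    thetaG q (q ^ m * z) = (-1) ^ m * q ^ (-tri m) * z ^ (-m) * thetaG q z := by
  have hm1 : (-1 : ℂ) ≠ 0 := by norm_num
  have step : ∀ m : ℤ, thetaG q (q ^ (m + 1) * z) = -(q ^ m * z)⁻¹ * thetaG q (q ^ m * z) := by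
    intro m
    rw [← thetaG_mul_q hq hq0 (mul_ne_zero (zpow_ne_zero m hq0) hz), zpow_add_one₀ hq0]
    congr 1
    ring
  have key : ∀ m : ℤ, (-1 : ℂ) ^ (m + 1) * q ^ (-tri (m + 1)) * z ^ (-(m + 1)) =
      -(q ^ m * z)⁻¹ * ((-1) ^ m * q ^ (-tri m) * z ^ (-m)) := by
    intro m
    rw [tri_succ, neg_add, neg_add, zpow_add₀ hq0, zpow_add₀ hz, zpow_add_one₀ hm1, zpow_neg,
      zpow_neg q m, zpow_neg z 1, zpow_one]
    field_simp
  induction m using Int.induction_on with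
  | zero => simp [tri_zero]
  | succ m ih => rw [step, ih, key]; ring
  | pred m ih =>
    have h := step (-m - 1)
    have k := key (-m - 1)
    rw [sub_add_cancel] at h k
    rw [h, k] at ih
    have hne : -(q ^ (-(m : ℤ) - 1) * z)⁻¹ ≠ 0 :=
      neg_ne_zero.2 (inv_ne_zero (mul_ne_zero (zpow_ne_zero _ hq0) hz))
    rw [mul_assoc _ _ (thetaG q z)] at ih
    exact mul_left_cancel₀ hne ih

theorem thetaG_zpow {q : ℂ} (hq : ‖q‖ < 1) (hq0 : q ≠ 0) (m : ℤ) : thetaG q (q ^ m) = 0 := by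
  have h := thetaG_zpow_mul hq hq0 one_ne_zero m
  rwa [mul_one, thetaG_one hq, mul_zero] at h

/-- A lattice vector is of the form `(u + v, v - u)` or `(u + v + 1, v - u)`. -/
noncomputable def parityEquiv : (ℤ × ℤ) ⊕ (ℤ × ℤ) ≃ ℤ × ℤ :=
  Equiv.ofBijective
    (Sum.elim (fun p => (p.1 + p.2, p.2 - p.1)) (fun p => (p.1 + p.2 + 1, p.2 - p.1))) <| by
    constructor
    · rintro (⟨a, b⟩ | ⟨a, b⟩) (⟨c, d⟩ | ⟨c, d⟩) h <;>
        simp only [Sum.elim_inl, Sum.elim_inr, Prod.mk.injEq, Sum.inl.injEq, Sum.inr.injEq,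
          reduceCtorEq] at h ⊢ <;> omega
    · rintro ⟨m, n⟩
      rcases Int.even_or_odd' (m - n) with ⟨u, hu | hu⟩
      · exact ⟨Sum.inl (u, u + n), by ext <;> simp <;> omega⟩
      · exact ⟨Sum.inr (u, u + n), by ext <;> simp <;> omega⟩

theorem parityEquiv_inl (p : ℤ × ℤ) : parityEquiv (Sum.inl p) = (p.1 + p.2, p.2 - p.1) := rfl

theorem parityEquiv_inr (p : ℤ × ℤ) : parityEquiv (Sum.inr p) = (p.1 + p.2 + 1, p.2 - p.1) := rfl

/-- For fixed `B` the functions `a ↦ g(a / w) g(B / (a w))`, with `w` as a parameter, lie in a space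
of dimension two: they are sections of a line bundle of degree two on the elliptic curve
`ℂˣ / q^ℤ`. -/
theorem thetaG_mul_thetaG_rank_two {q B : ℂ} (hq : ‖q‖ < 1) (hq0 : q ≠ 0) (hB : B ≠ 0) :
    ∃ Θ₀ Θ₁ A₀ A₁ : ℂ → ℂ, ∀ a w : ℂ, a ≠ 0 → w ≠ 0 →
      thetaG q (a / w) * thetaG q (B / a / w) = Θ₀ a * A₀ w - Θ₁ a * A₁ w := by
  have hq2 : ‖q ^ 2‖ < 1 := by
    rw [norm_pow]
    exact pow_lt_one₀ (norm_nonneg q) hq two_ne_zero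
  -- all four series are theta series in `q²`, up to a monomial change of variable
  have S : ∀ x : ℂ, x ≠ 0 → Summable fun u : ℤ => x ^ u * (q ^ 2) ^ tri u := by
    intro x hx
    refine (summable_thetaG hq2 (neg_ne_zero.2 hx)).congr fun u => ?_
    rw [← mul_zpow, neg_one_mul, neg_neg]
  refine ⟨fun a => ∑' u : ℤ, (q * a ^ 2 / B) ^ u * (q ^ 2) ^ tri u,
    fun a => a * ∑' u : ℤ, (q ^ 2 * a ^ 2 / B) ^ u * (q ^ 2) ^ tri u,
    fun w => ∑' v : ℤ, (B / w ^ 2) ^ v * (q ^ 2) ^ tri v,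
    fun w => w⁻¹ * ∑' v : ℤ, (q * B / w ^ 2) ^ v * (q ^ 2) ^ tri v, fun a w ha hw => ?_⟩
  have h := (hasSum_thetaG hq (div_ne_zero ha hw)).mul_prod
    (hasSum_thetaG hq (div_ne_zero (div_ne_zero hB ha) hw))
  rw [← parityEquiv.hasSum_iff] at h
  refine h.unique ?_
  rw [sub_eq_add_neg]
  have e2 : ∀ n : ℤ, (q ^ 2) ^ tri n = q ^ (n * (n - 1)) := fun n => by
    rw [← zpow_natCast q 2, ← zpow_mul]
    congr 1
    exact_mod_cast two_mul_tri n
  have sq : ∀ (x : ℂ) (n : ℤ), (x ^ 2) ^ n = (x ^ n) ^ 2 := fun x n => by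
    rw [← zpow_natCast x, ← zpow_natCast (x ^ n), zpow_comm]
  have h1 : (-1 : ℂ) ≠ 0 := by norm_num
  have sign : ∀ n : ℤ, ((-1 : ℂ) ^ n) ^ 2 = 1 := fun n => by rw [← sq]; simp
  refine HasSum.sum ?_ ?_
  · refine ((S _ (by positivity)).hasSum.mul_prod (S _ (by positivity)).hasSum).of_forall_eq
      fun p => ?_
    obtain ⟨u, v⟩ := p
    have hqe : q ^ tri (u + v) * q ^ tri (v - u) =
        q ^ u * q ^ (u * (u - 1)) * q ^ (v * (v - 1)) := by
      rw [← zpow_add₀ hq0, ← zpow_add₀ hq0, ← zpow_add₀ hq0]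
      congr 1
      rw [sub_eq_add_neg, tri_add, tri_add, tri_neg]
      linarith [two_mul_tri u, two_mul_tri v]
    simp only [Function.comp_apply, parityEquiv_inl, e2]
    calc _ = (q ^ u * q ^ (u * (u - 1)) * q ^ (v * (v - 1))) * (1 * ((a ^ u) ^ 2 * B⁻¹ ^ u * B ^ v *
              w⁻¹ ^ v * w⁻¹ ^ v)) := by
            simp only [div_eq_mul_inv, mul_zpow, sq, inv_zpow]
            field_simp
      _ = (q ^ tri (u + v) * q ^ tri (v - u)) * (((-1) ^ v) ^ 2 * ((a ^ u) ^ 2 * B⁻¹ ^ u * B ^ v *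
              w⁻¹ ^ v * w⁻¹ ^ v)) := by rw [hqe, sign]
      _ = _ := by
        simp only [div_eq_mul_inv, mul_zpow, zpow_add₀ h1, zpow_sub₀ h1, zpow_add₀ ha,
          zpow_add₀ (inv_ne_zero hw), zpow_sub₀ (inv_ne_zero hw), zpow_sub₀ hB,
          zpow_sub₀ (inv_ne_zero ha), inv_zpow]
        field_simp
  · have := ((S (q ^ 2 * a ^ 2 / B) (by positivity)).hasSum.mul_left a).mul_prod
      ((S (q * B / w ^ 2) (by positivity)).hasSum.mul_left w⁻¹)
    refine this.neg.of_forall_eq fun p => ?_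
    obtain ⟨u, v⟩ := p
    have hqe : q ^ tri (u + v + 1) * q ^ tri (v - u) =
        (q ^ u) ^ 2 * q ^ (u * (u - 1)) * q ^ v * q ^ (v * (v - 1)) := by
      rw [← sq, ← zpow_natCast q 2, ← zpow_mul, ← zpow_add₀ hq0, ← zpow_add₀ hq0, ← zpow_add₀ hq0,
        ← zpow_add₀ hq0]
      congr 1
      rw [sub_eq_add_neg, tri_succ, tri_add, tri_add, tri_neg]
      push_cast
      linarith [two_mul_tri u, two_mul_tri v]
    simp only [Function.comp_apply, parityEquiv_inr, e2]
    calc _ = ((q ^ u) ^ 2 * q ^ (u * (u - 1)) * q ^ v * q ^ (v * (v - 1))) *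
              (-1 * ((a ^ u) ^ 2 * B⁻¹ ^ u * B ^ v * w⁻¹ ^ v * w⁻¹ ^ v * a * w⁻¹)) := by
            simp only [div_eq_mul_inv, mul_zpow, sq, inv_zpow]
            field_simp
      _ = (q ^ tri (u + v + 1) * q ^ tri (v - u)) * (-((-1) ^ v) ^ 2 * ((a ^ u) ^ 2 * B⁻¹ ^ u *
              B ^ v * w⁻¹ ^ v * w⁻¹ ^ v * a * w⁻¹)) := by rw [hqe, sign]
      _ = _ := by
        simp only [div_eq_mul_inv, mul_zpow, zpow_add₀ h1, zpow_sub₀ h1, zpow_add₀ ha,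
          zpow_add₀ (inv_ne_zero hw), zpow_sub₀ (inv_ne_zero hw), zpow_sub₀ hB,
          zpow_sub₀ (inv_ne_zero ha), inv_zpow, zpow_one]
        field_simp

/-! ### Laurent series in several variables -/

/-- The Laurent monomial `∏ z_i ^ γ_i`. -/
noncomputable def mono {ι : Type*} [Fintype ι] (γ : ι → ℤ) (z : ι → ℂ) : ℂ := ∏ i, z i ^ γ i

theorem mono_ne_zero {ι : Type*} [Fintype ι] (γ : ι → ℤ) {z : ι → ℂ} (hz : ∀ i, z i ≠ 0) :
    mono γ z ≠ 0 :=
  Finset.prod_ne_zero_iff.2 fun i _ => zpow_ne_zero _ (hz i)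

theorem mono_add {ι : Type*} [Fintype ι] (γ δ : ι → ℤ) {z : ι → ℂ} (hz : ∀ i, z i ≠ 0) :
    mono (γ + δ) z = mono γ z * mono δ z := by
  simp only [mono, Pi.add_apply, zpow_add₀ (hz _), Finset.prod_mul_distrib]

/-- A Laurent series that converges to `0` at all points of a torus has zero coefficients. -/
theorem laurent_coeff_eq_zero {ι : Type*} [Fintype ι] {c : (ι → ℤ) → ℂ} {r : ι → ℝ}
    (hr : ∀ i, 0 < r i)
    (h : ∀ z : ι → ℂ, (∀ i, ‖z i‖ = r i) → HasSum (fun γ => c γ * mono γ z) 0) (γ : ι → ℤ) :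
    c γ = 0 := by
  classical
  set R : ι → ℂ := fun i => (r i : ℂ) with hR
  have hRne : ∀ i, R i ≠ 0 := fun i => by simp [hR, (hr i).ne']
  have hnorm : ∀ i, ‖R i‖ = r i := fun i => by simp [hR, abs_of_pos (hr i)]
  set c' : (ι → ℤ) → ℂ := fun γ => c γ * mono γ R with hc'
  have hsum : Summable fun γ => c' γ • (UnitAddTorus.mFourier γ : C(UnitAddTorus ι, ℂ)) := by
    refine Summable.of_norm ?_
    refine (h R hnorm).summable.norm.congr fun γ => ?_
    rw [norm_smul, UnitAddTorus.mFourier_norm, mul_one]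
  have hzero : HasSum (fun γ => c' γ • (UnitAddTorus.mFourier γ : C(UnitAddTorus ι, ℂ))) 0 := by
    convert hsum.hasSum using 1
    ext x
    have h1 := (ContinuousMap.evalCLM ℂ x).hasSum hsum.hasSum
    set z : ι → ℂ := fun i => R i * fourier 1 (x i) with hz
    have h2 := h z (fun i => by simp [hz, hnorm, Circle.norm_coe])
    refine h2.unique (h1.of_forall_eq fun γ => ?_)
    simp only [hc', mono, hz, mul_zpow, Finset.prod_mul_distrib,
      ContinuousMap.evalCLM_apply, ContinuousMap.smul_apply, smul_eq_mul, UnitAddTorus.mFourier,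
      ContinuousMap.coe_mk]
    rw [mul_assoc]
    congr 2
    refine Finset.prod_congr rfl fun i _ => ?_
    simp [fourier_apply, AddCircle.toCircle_zsmul]
  -- the normalized Haar measure, for which the monomials are orthonormal
  let _ : MeasureTheory.MeasureSpace UnitAddCircle := ⟨AddCircle.haarAddCircle⟩
  have _ : MeasureTheory.IsProbabilityMeasure (MeasureTheory.volume : MeasureTheory.Measure
    UnitAddCircle) := inferInstanceAs (MeasureTheory.IsProbabilityMeasure AddCircle.haarAddCircle)
  have h4 := (innerSL ℂ (UnitAddTorus.mFourierLp (d := ι) 2 γ)).hasSum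
    ((ContinuousMap.toLp (E := ℂ) 2 _ ℂ).hasSum hzero)
  have h5 : c' γ = 0 := by
    refine (hasSum_ite_eq γ (c' γ)).unique ?_
    have := h4.of_forall_eq (g := fun δ => if δ = γ then c' γ else 0) fun δ => ?_
    · simpa using this
    · have := (orthonormal_iff_ite.1 (UnitAddTorus.orthonormal_mFourier (d := ι))) γ δ
      simp only [map_smul, innerSL_apply_apply, smul_eq_mul]
      erw [this]
      by_cases hd : δ = γ
      · simp [hd]
      · simp [hd, Ne.symm hd]
  exact (mul_eq_zero.1 h5).resolve_right (mono_ne_zero γ hRne)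

theorem mono_zsmul {ι : Type*} [Fintype ι] (n : ℤ) (γ : ι → ℤ) (z : ι → ℂ) :
    mono (n • γ) z = mono γ z ^ n := by
  rw [mono, mono, ← Finset.prod_zpow]
  exact Finset.prod_congr rfl fun i _ => by rw [Pi.smul_apply, smul_eq_mul, mul_comm, zpow_mul]

theorem mono_zero {ι : Type*} [Fintype ι] (z : ι → ℂ) : mono 0 z = 1 := by
  simp [mono]

theorem mono_sum {ι κ : Type*} [Fintype ι] (s : Finset κ) (γ : κ → ι → ℤ) {z : ι → ℂ}
    (hz : ∀ i, z i ≠ 0) : mono (∑ j ∈ s, γ j) z = ∏ j ∈ s, mono (γ j) z := by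
  classical
  induction s using Finset.induction_on with
  | empty => simp [mono_zero]
  | insert a s ha ih => rw [Finset.sum_insert ha, Finset.prod_insert ha, mono_add _ _ hz, ih]

theorem mono_mul {ι : Type*} [Fintype ι] (γ : ι → ℤ) (z w : ι → ℂ) :
    mono γ (fun i => z i * w i) = mono γ z * mono γ w := by
  simp only [mono, mul_zpow, Finset.prod_mul_distrib]

theorem mono_single {ι : Type*} [Fintype ι] [DecidableEq ι] (i : ι) (n : ℤ) (z : ι → ℂ) :
    mono (Pi.single i n) z = z i ^ n := by
  rw [mono, Finset.prod_eq_single i]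
  · simp
  · intro j _ hj
    simp [hj]
  · simp

theorem norm_mono {ι : Type*} [Fintype ι] (γ : ι → ℤ) (z : ι → ℂ) :
    ‖mono γ z‖ = ∏ i, ‖z i‖ ^ γ i := by
  simp [mono, norm_prod, norm_zpow]

/-- A function on `(ℂ \ {0})^ι` is entire Laurent if it is the sum of a Laurent series that
converges at every point of `(ℂ \ {0})^ι`; nothing is asked of its values at other points. -/
def EntireLaurent {ι : Type*} [Fintype ι] (f : (ι → ℂ) → ℂ) : Prop :=
  ∃ c : (ι → ℤ) → ℂ, ∀ z : ι → ℂ, (∀ i, z i ≠ 0) → HasSum (fun γ => c γ * mono γ z) (f z)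

namespace EntireLaurent

variable {ι : Type*} [Fintype ι]

/-- A sum of Laurent monomials over any index set can be regrouped into a Laurent series. -/
theorem of_hasSum {κ : Type*} {f : (ι → ℂ) → ℂ} (c : κ → ℂ) (e : κ → ι → ℤ)
    (h : ∀ z : ι → ℂ, (∀ i, z i ≠ 0) → HasSum (fun j => c j * mono (e j) z) (f z)) :
    EntireLaurent f := by
  refine ⟨fun γ => ∑' b : e ⁻¹' {γ}, c b, fun z hz => ?_⟩
  refine ((h z hz).tsum_fiberwise e).of_forall_eq fun γ => ?_
  rw [← tsum_mul_right]
  refine tsum_congr fun b => ?_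
  rw [show e b = γ from b.2]

theorem congr {f g : (ι → ℂ) → ℂ} (hf : EntireLaurent f)
    (h : ∀ z : ι → ℂ, (∀ i, z i ≠ 0) → f z = g z) : EntireLaurent g := by
  obtain ⟨c, hc⟩ := hf
  exact ⟨c, fun z hz => h z hz ▸ hc z hz⟩

theorem const_mul_mono (a : ℂ) (γ : ι → ℤ) : EntireLaurent fun z => a * mono γ z :=
  of_hasSum (κ := Unit) (fun _ => a) (fun _ => γ) fun z _ => by
    simp

theorem mul {f g : (ι → ℂ) → ℂ} (hf : EntireLaurent f) (hg : EntireLaurent g) :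
    EntireLaurent fun z => f z * g z := by
  obtain ⟨c, hc⟩ := hf
  obtain ⟨d, hd⟩ := hg
  refine of_hasSum (fun p : (ι → ℤ) × (ι → ℤ) => c p.1 * d p.2) (fun p => p.1 + p.2)
    fun z hz => ((hc z hz).mul_prod (hd z hz)).of_forall_eq fun p => ?_
  rw [mono_add _ _ hz]
  ring

theorem sum {κ : Type*} (s : Finset κ) {f : κ → (ι → ℂ) → ℂ} (hf : ∀ j, EntireLaurent (f j)) :
    EntireLaurent fun z => ∑ j ∈ s, f j z := by
  choose c hc using hf
  refine ⟨fun γ => ∑ j ∈ s, c j γ, fun z hz => ?_⟩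
  refine (hasSum_sum fun j _ => hc j z hz).of_forall_eq fun γ => ?_
  rw [Finset.sum_mul]

/-- Substitution of multiples of monomials for the variables. -/
theorem comp_mono {κ : Type*} [Fintype κ] {f : (κ → ℂ) → ℂ} (hf : EntireLaurent f) (s : κ → ℂ)
    (hs : ∀ j, s j ≠ 0) (δ : κ → ι → ℤ) :
    EntireLaurent fun z : ι → ℂ => f fun j => s j * mono (δ j) z := by
  obtain ⟨c, hc⟩ := hf
  refine of_hasSum (fun γ => c γ * mono γ s) (fun γ => ∑ j, γ j • δ j) fun z hz => ?_
  refine (hc _ fun j => mul_ne_zero (hs j) (mono_ne_zero _ hz)).of_forall_eq fun γ => ?_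
  rw [mono_mul, mono_sum _ _ hz]
  simp only [mono_zsmul]
  rw [mono, mono, mul_assoc]

theorem thetaG_mono {q : ℂ} (hq : ‖q‖ < 1) (δ : ι → ℤ) :
    EntireLaurent fun z => thetaG q (mono δ z) :=
  of_hasSum (fun n : ℤ => (-1 : ℂ) ^ n * q ^ tri n) (fun n => n • δ) fun z hz =>
    (hasSum_thetaG hq (mono_ne_zero δ hz)).of_forall_eq fun n => by rw [mono_zsmul]; ring

theorem eq_of_torus {f g : (ι → ℂ) → ℂ} (hf : EntireLaurent f) (hg : EntireLaurent g) {r : ι → ℝ}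
    (hr : ∀ i, 0 < r i) (h : ∀ z : ι → ℂ, (∀ i, ‖z i‖ = r i) → f z = g z) {z : ι → ℂ}
    (hz : ∀ i, z i ≠ 0) : f z = g z := by
  obtain ⟨c, hc⟩ := hf
  obtain ⟨d, hd⟩ := hg
  have key : ∀ γ, c γ - d γ = 0 := by
    refine fun γ => laurent_coeff_eq_zero (c := fun γ => c γ - d γ) hr (fun w hw => ?_) γ
    have hw0 : ∀ i, w i ≠ 0 := fun i => norm_pos_iff.1 ((hw i).symm ▸ hr i)
    have := (hc w hw0).sub (hd w hw0)
    rw [h w hw, sub_self] at this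
    exact this.of_forall_eq fun γ => by ring
  refine (hc z hz).unique ((hd z hz).of_forall_eq fun γ => ?_)
  rw [sub_eq_zero.1 (key γ)]

end EntireLaurent

/-! ### The reciprocal of the theta function -/

/-- The signs of the expansion of `∑_n a_n / (1 - q ^ n z)` in the annulus
`|q| ^ (s + 1) < |z| < |q| ^ s`, where `(q ^ n z) ^ l` occurs for `l ≥ 0` or for `l < 0`. -/
def expansionSign (s n l : ℤ) : ℂ :=
  if -s ≤ n ∧ 0 ≤ l then 1 else if n < -s ∧ l < 0 then -1 else 0

/-- The contribution of `(-1) ^ n q ^ (n (n + 1) / 2) / (1 - q ^ n z)` to the coefficient of `z ^ l`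
in the annulus
`|q| ^ (s + 1) < |z| < |q| ^ s`. -/
noncomputable def appellTerm (q : ℂ) (s n l : ℤ) : ℂ :=
  expansionSign s n l * ((-1) ^ n * q ^ (tri (n + 1) + n * l))

/-- The coefficient of `z ^ l` in the expansion of
`∑_n (-1) ^ n q ^ (n (n + 1) / 2) / (1 - q ^ n z)` in the annulus
`|q| ^ (s + 1) < |z| < |q| ^ s`. -/
noncomputable def appellCoeff (q : ℂ) (s l : ℤ) : ℂ := ∑' n, appellTerm q s n l

theorem norm_expansionSign_le (s n l : ℤ) : ‖expansionSign s n l‖ ≤ 1 := by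
  unfold expansionSign
  split_ifs <;> simp

theorem summable_two_sided_geometric {x y : ℝ} (hx0 : 0 < x) (hx : x < 1) (hy : 1 < y) :
    Summable fun l : ℤ => if 0 ≤ l then x ^ l else y ^ l := by
  refine Summable.of_nat_of_neg_add_one ?_ ?_
  · refine (summable_geometric_of_lt_one hx0.le hx).congr fun n => ?_
    simp
  · have := (summable_geometric_of_lt_one (inv_pos.2 (by linarith)).le (inv_lt_one_of_one_lt₀ hy))
    refine ((summable_nat_add_iff 1).2 this).congr fun n => ?_
    rw [if_neg (by omega), ← zpow_natCast, inv_zpow, ← zpow_neg]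
    push_cast
    rfl

theorem summable_tri_succ {r : ℝ} (hr0 : 0 < r) (hr : r < 1) :
    Summable fun n : ℤ => r ^ tri (n + 1) := by
  refine (summable_tri hr0.le hr hr0).congr fun n => ?_
  rw [tri_succ, zpow_add₀ hr0.ne']

/-- The double series that defines the expansion in the annulus converges absolutely. -/
theorem summable_appellTerm {q z : ℂ} (hq : ‖q‖ < 1) (hq0 : q ≠ 0) {s : ℤ}
    (h1 : ‖q‖ ^ (s + 1) < ‖z‖) (h2 : ‖z‖ < ‖q‖ ^ s) :
    Summable fun p : ℤ × ℤ => appellTerm q s p.1 p.2 * z ^ p.2 := by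
  have hr0 : 0 < ‖q‖ := norm_pos_iff.2 hq0
  set r := ‖q‖ with hr
  set ρ := ‖z‖ with hρ
  have hρ0 : 0 < ρ := (zpow_pos hr0 _).trans h1
  have hx : r ^ (-s) * ρ < 1 := by
    rw [zpow_neg, inv_mul_lt_one₀ (zpow_pos hr0 _)]
    exact h2
  have hy : 1 < r ^ (-s - 1) * ρ := by
    rw [show -s - 1 = -(s + 1) by ring, zpow_neg, ← div_eq_inv_mul, one_lt_div (zpow_pos hr0 _)]
    exact h1
  have S := (summable_tri_succ hr0 hq).mul_of_nonneg
    (summable_two_sided_geometric (by positivity) hx hy) (fun n => by positivity)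
    (fun l => by split_ifs <;> positivity)
  refine Summable.of_norm_bounded S fun p => ?_
  obtain ⟨n, l⟩ := p
  have e : ‖appellTerm q s n l * z ^ l‖ =
      ‖expansionSign s n l‖ * (r ^ tri (n + 1) * (r ^ n * ρ) ^ l) := by
    simp only [appellTerm, norm_mul, norm_zpow, norm_neg, norm_one, one_zpow, one_mul]
    rw [zpow_add₀ hr0.ne', zpow_mul, mul_zpow]
    ring
  rw [e]
  have hA : 0 ≤ r ^ tri (n + 1) := by positivity
  simp only
  by_cases c1 : -s ≤ n ∧ 0 ≤ l
  · rw [if_pos c1.2]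
    have : (r ^ n * ρ) ^ l ≤ (r ^ (-s) * ρ) ^ l :=
      zpow_le_zpow_left₀ c1.2 (by positivity)
        (mul_le_mul_of_nonneg_right (zpow_le_zpow_right_of_le_one₀ hr0 hq.le c1.1) hρ0.le)
    calc _ ≤ 1 * (r ^ tri (n + 1) * (r ^ n * ρ) ^ l) := by
          gcongr
          exact norm_expansionSign_le s n l
      _ ≤ _ := by
          rw [one_mul]
          gcongr
  · by_cases c2 : n < -s ∧ l < 0
    · rw [if_neg (by omega)]
      have : (r ^ n * ρ) ^ l ≤ (r ^ (-s - 1) * ρ) ^ l := by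
        obtain ⟨m, rfl⟩ : ∃ m : ℤ, l = -m := ⟨-l, by ring⟩
        rw [zpow_neg, zpow_neg]
        refine inv_anti₀ (by positivity) ?_
        exact zpow_le_zpow_left₀ (by omega) (by positivity)
          (mul_le_mul_of_nonneg_right (zpow_le_zpow_right_of_le_one₀ hr0 hq.le (by omega)) hρ0.le)
      calc _ ≤ 1 * (r ^ tri (n + 1) * (r ^ n * ρ) ^ l) := by
            gcongr
            exact norm_expansionSign_le s n l
        _ ≤ _ := by
            rw [one_mul]
            gcongr
    · have : expansionSign s n l = 0 := by rw [expansionSign, if_neg c1, if_neg c2]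
      rw [this, norm_zero, zero_mul]
      split_ifs <;> positivity

theorem hasSum_appellCoeff {q z : ℂ} (hq : ‖q‖ < 1) (hq0 : q ≠ 0) {s : ℤ}
    (h1 : ‖q‖ ^ (s + 1) < ‖z‖) (h2 : ‖z‖ < ‖q‖ ^ s) :
    HasSum (fun l => appellCoeff q s l * z ^ l)
      (∑' p : ℤ × ℤ, appellTerm q s p.1 p.2 * z ^ p.2) := by
  have S := (summable_appellTerm hq hq0 h1 h2).hasSum
  rw [← (Equiv.prodComm ℤ ℤ).hasSum_iff] at S
  have S2 := S.prod_fiberwise (g := fun l => appellCoeff q s l * z ^ l) fun l => ?_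
  · exact S2
  · rw [appellCoeff, ← tsum_mul_right]
    exact (S.summable.prod_factor l).hasSum

/-- A signed geometric sum, from `-s` to `m`. -/
theorem hasSum_expansionSign (x : ℂ) (hx : x ≠ 0) (s m : ℤ) :
    ∃ A : ℂ, HasSum (fun n => expansionSign s n (m - n) * x ^ n) A ∧
      (1 - x) * A = x ^ (-s) - x ^ (m + 1) ∧ (x = 1 → A = m + s + 1) := by
  have step : ∀ m n : ℤ, expansionSign s n (m + 1 - n) * x ^ n =
      expansionSign s n (m - n) * x ^ n + if n = m + 1 then x ^ (m + 1) else 0 := by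
    intro m n
    unfold expansionSign
    by_cases h : n = m + 1
    · subst h
      by_cases h2 : -s ≤ m + 1
      · rw [if_pos (by omega), if_neg (by omega), if_neg (by omega)]; simp
      · rw [if_neg (by omega), if_neg (by omega), if_neg (by omega), if_pos (by omega)]; simp
    · rw [if_neg h, add_zero]
      congr 1
      exact if_congr (by omega) rfl (if_congr (by omega) rfl rfl)
  induction m using Int.inductionOn' (b := -s - 1) with
  | zero =>
    refine ⟨0, ?_, by simp, fun _ => by push_cast; ring⟩
    have : ∀ n, expansionSign s n (-s - 1 - n) * x ^ n = 0 := fun n => by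
      rw [expansionSign, if_neg (by omega), if_neg (by omega), zero_mul]
    simp only [this]
    exact hasSum_zero
  | succ m _ ih =>
    obtain ⟨A, h1, h2, h3⟩ := ih
    refine ⟨A + x ^ (m + 1), ?_, ?_, ?_⟩
    · exact (h1.add (hasSum_ite_eq (m + 1) (x ^ (m + 1)))).of_forall_eq fun n => (step m n).symm
    · rw [mul_add, h2, zpow_add_one₀ hx (m + 1)]; ring
    · rintro rfl
      rw [h3 rfl]; push_cast; simp; ring
  | pred m _ ih =>
    obtain ⟨A, h1, h2, h3⟩ := ih
    have e : ∀ n, _ := step (m - 1)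
    simp only [sub_add_cancel] at e
    refine ⟨A - x ^ m, ?_, ?_, ?_⟩
    · refine (h1.sub (hasSum_ite_eq m (x ^ m))).of_forall_eq fun n => ?_
      rw [e n]; ring
    · rw [mul_sub, h2, zpow_add_one₀ hx m, sub_add_cancel]; ring
    · rintro rfl
      rw [h3 rfl]; push_cast; simp; ring

/-- The reindexing that diagonalizes the product of the theta series and the Appell series. -/
def appellReindex : ℤ × (ℤ × ℤ) ≃ (ℤ × ℤ) × ℤ where
  toFun x := ((x.2.2, x.1 - x.2.1 - x.2.2), x.2.1 + x.2.2)
  invFun y := (y.1.2 + y.2, (y.2 - y.1.1, y.1.1))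
  left_inv x := by ext <;> simp
  right_inv y := by ext <;> simp <;> ring

theorem zpow_ne_one_of_norm_lt {q : ℂ} (hq : ‖q‖ < 1) {j : ℤ} (hj : j ≠ 0) : q ^ j ≠ 1 := by
  intro h
  have h2 : ‖q‖ ^ j = 1 := by rw [← norm_zpow, h, norm_one]
  exact hj ((zpow_eq_one_iff_right₀ (norm_nonneg q) hq.ne).1 h2)

/-- Minus the derivative of the theta function at its zero `1`. -/
noncomputable def thetaSlope (q : ℂ) : ℂ := ∑' p : ℤ, (1 - p) * ((-1) ^ p * q ^ tri p)

/-- The product of the theta function and the Appell series is constant. -/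
theorem appell_mul_thetaG {q z : ℂ} (hq : ‖q‖ < 1) (hq0 : q ≠ 0) {s : ℤ}
    (h1 : ‖q‖ ^ (s + 1) < ‖z‖) (h2 : ‖z‖ < ‖q‖ ^ s) :
    (∑' p : ℤ × ℤ, appellTerm q s p.1 p.2 * z ^ p.2) * thetaG q z = thetaSlope q := by
  have hz : z ≠ 0 := norm_pos_iff.1 ((zpow_pos (norm_pos_iff.2 hq0) _).trans h1)
  have hm1 : (-1 : ℂ) ≠ 0 := by norm_num
  have S := (summable_appellTerm hq hq0 h1 h2).hasSum.mul_prod (hasSum_thetaG hq hz)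
  rw [← appellReindex.hasSum_iff] at S
  have S' := S.of_forall_eq (g := fun x : ℤ × (ℤ × ℤ) => (-1) ^ x.2.1 * q ^ tri x.2.1 * z ^ x.1 *
      (expansionSign s x.2.2 (x.1 - x.2.1 - x.2.2) * (q ^ x.1) ^ x.2.2)) (by
    rintro ⟨j, p, n⟩
    have hs : (-1 : ℂ) ^ n * (-1) ^ n = 1 := by rw [← mul_zpow]; simp
    have hqe : q ^ (tri (n + 1) + n * (j - p - n)) * q ^ tri (p + n) = q ^ tri p * (q ^ j) ^ n := by
      rw [← zpow_mul, ← zpow_add₀ hq0, ← zpow_add₀ hq0]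
      congr 1
      rw [tri_succ, tri_add]
      linarith [two_mul_tri n]
    have hze : z ^ (j - p - n) * z ^ (p + n) = z ^ j := by
      rw [← zpow_add₀ hz]; congr 1; ring
    simp only [Function.comp_apply, appellReindex, Equiv.coe_fn_mk, appellTerm]
    rw [zpow_add₀ hm1]
    linear_combination (expansionSign s n (j - p - n) * (-1) ^ p) *
        (q ^ (tri (n + 1) + n * (j - p - n)) * q ^ tri (p + n)) *
        (z ^ (j - p - n) * z ^ (p + n)) * hs +
      (expansionSign s n (j - p - n) * (-1) ^ p) * (z ^ (j - p - n) * z ^ (p + n)) * hqe +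
      (expansionSign s n (j - p - n) * (-1) ^ p) * q ^ tri p * (q ^ j) ^ n * hze)
  have S2 := S'.prod_fiberwise (g := fun j : ℤ => if j = 0 then thetaSlope q else 0) fun j => ?_
  · exact S2.unique (hasSum_ite_eq 0 _)
  -- the sum over the antidiagonal `j`
  have hfib := (S'.summable.prod_factor j).hasSum
  choose A hA hA1 hA2 using fun p : ℤ => hasSum_expansionSign (q ^ j) (zpow_ne_zero j hq0) s (j - p)
  have hin := hfib.prod_fiberwise fun p => (hA p).mul_left ((-1) ^ p * q ^ tri p * z ^ j)
  suffices hv : (∑' b : ℤ × ℤ, (-1) ^ b.1 * q ^ tri b.1 * z ^ j *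
      (expansionSign s b.2 (j - b.1 - b.2) * (q ^ j) ^ b.2)) =
      if j = 0 then thetaSlope q else 0 by
    rw [← hv]
    exact hfib
  split_ifs with hj
  · subst hj
    have hA3 : ∀ p, A p = s + 1 - p := fun p => by
      rw [hA2 p (zpow_zero q)]; push_cast; ring
    have h3 := hin.sub ((hasSum_thetaG hq one_ne_zero).mul_left (s : ℂ))
    rw [thetaG_one hq, mul_zero, sub_zero] at h3
    rw [thetaSlope]
    refine (h3.of_forall_eq fun p => ?_).tsum_eq.symm
    rw [hA3, one_zpow, zpow_zero]
    ring
  · have h3 := hin.mul_left (1 - q ^ j)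
    have h4 := (((hasSum_thetaG hq one_ne_zero).mul_left ((q ^ j) ^ (-s))).sub
      ((hasSum_thetaG hq (zpow_ne_zero (-j) hq0)).mul_left ((q ^ j) ^ (j + 1)))).mul_left (z ^ j)
    rw [thetaG_one hq, thetaG_zpow hq hq0] at h4
    have h5 := h3.unique (h4.of_forall_eq fun p => ?_)
    · have : (1 : ℂ) - q ^ j ≠ 0 := sub_ne_zero.2 (zpow_ne_one_of_norm_lt hq hj).symm
      rw [mul_zero, mul_zero, sub_zero, mul_zero] at h5
      exact (mul_eq_zero.1 h5).resolve_left this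
    · have e1 : (q ^ j) ^ (j - p + 1) = (q ^ j) ^ (j + 1) * (q ^ (-j)) ^ p := by
        rw [← zpow_mul, ← zpow_mul, ← zpow_mul, ← zpow_add₀ hq0]; congr 1; ring
      rw [one_zpow]
      linear_combination (-(-1) ^ p * q ^ tri p * z ^ j) * hA1 p +
        ((-1) ^ p * q ^ tri p * z ^ j) * e1

theorem differentiableAt_thetaG {q z : ℂ} (hq : ‖q‖ < 1) (hz : z ≠ 0) :
    DifferentiableAt ℂ (thetaG q) z := by
  have hz0 := norm_pos_iff.2 hz
  set a := ‖z‖ / 2 with ha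
  set b := ‖z‖ * 2 with hb
  have ha0 : 0 < a := by positivity
  have hb0 : 0 < b := by positivity
  set U : Set ℂ := {w | a < ‖w‖ ∧ ‖w‖ < b} with hU
  have hUo : IsOpen U := (isOpen_lt continuous_const continuous_norm).inter
    (isOpen_lt continuous_norm continuous_const)
  have hzU : z ∈ U := ⟨by rw [ha]; linarith, by rw [hb]; linarith⟩
  have hU0 : ∀ w ∈ U, w ≠ 0 := fun w hw => norm_pos_iff.1 (ha0.trans hw.1)
  have S := (summable_tri (norm_nonneg q) hq ha0).add (summable_tri (norm_nonneg q) hq hb0)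
  refine (Complex.differentiableOn_tsum_of_summable_norm S
    (F := fun (n : ℤ) (w : ℂ) => (-1 : ℂ) ^ n * w ^ n * q ^ tri n) (fun n => ?_) hUo
    fun n w hw => ?_).differentiableAt (hUo.mem_nhds hzU)
  · intro w hw
    exact (((differentiableAt_zpow.2 (Or.inl (hU0 w hw))).const_mul _).mul_const
      _).differentiableWithinAt
  · have e : ‖(-1 : ℂ) ^ n * w ^ n * q ^ tri n‖ = ‖q‖ ^ tri n * ‖w‖ ^ n := by
      simp [norm_zpow, mul_comm]
    rw [e, ← mul_add]
    gcongr
    rcases le_total 0 n with hn | hn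
    · have := zpow_le_zpow_left₀ hn (norm_nonneg w) hw.2.le
      have := zpow_pos ha0 n
      linarith
    · obtain ⟨m, rfl⟩ : ∃ m : ℤ, n = -m := ⟨-n, by ring⟩
      have h3 := zpow_le_zpow_left₀ (by omega : 0 ≤ m) ha0.le hw.1.le
      have h4 := inv_anti₀ (zpow_pos ha0 m) h3
      have h5 := zpow_pos hb0 (-m)
      rw [zpow_neg, zpow_neg a]
      linarith

/-- The theta function does not vanish identically. -/
theorem exists_thetaG_ne_zero {q : ℂ} (hq : ‖q‖ < 1) : ∃ z : ℂ, z ≠ 0 ∧ thetaG q z ≠ 0 := by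
  by_contra! h
  have := laurent_coeff_eq_zero (ι := Unit) (c := fun γ => (-1 : ℂ) ^ γ () * q ^ tri (γ ()))
    (r := fun _ => 1) (fun _ => one_pos) (fun z hz => ?_) 0
  · simp [tri_zero] at this
  · have hz0 : z () ≠ 0 := norm_pos_iff.1 ((hz ()).symm ▸ one_pos)
    have h2 := hasSum_thetaG hq hz0
    rw [h _ hz0, ← (Equiv.funUnique Unit ℤ).hasSum_iff] at h2
    refine h2.of_forall_eq fun γ => ?_
    simp [mono, mul_right_comm]

/-- The zero `1` of the theta function is simple. -/
theorem thetaSlope_ne_zero {q : ℂ} (hq : ‖q‖ < 1) (hq0 : q ≠ 0) : thetaSlope q ≠ 0 := by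
  intro hC
  have hr0 : 0 < ‖q‖ := norm_pos_iff.2 hq0
  obtain ⟨x₀, hx₀, hx₀1⟩ := exists_between hq
  have hx₀0 : 0 < x₀ := hr0.trans hx₀
  have hy : 1 < ‖q‖⁻¹ * x₀ := by rwa [← div_eq_inv_mul, one_lt_div hr0]
  -- away from its term `1 / (1 - z)` the Appell series is bounded near `1`
  have S := (summable_tri_succ hr0 hq).mul_of_nonneg
    (summable_two_sided_geometric hr0 hq hy) (fun n => by positivity)
    (fun l => by split_ifs <;> positivity)
  set M := ∑' p : ℤ × ℤ, ‖q‖ ^ tri (p.1 + 1) *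
    (if 0 ≤ p.2 then ‖q‖ ^ p.2 else (‖q‖⁻¹ * x₀) ^ p.2) with hM
  have key : ∀ x : ℝ, x₀ < x → x < 1 → M < (1 - x)⁻¹ → thetaG q x = 0 := by
    intro x h1 h2 h3
    have hx0 : 0 < x := hx₀0.trans h1
    have hnx : ‖(x : ℂ)‖ = x := by simp [abs_of_pos hx0]
    have ha1 : ‖q‖ ^ ((0 : ℤ) + 1) < ‖(x : ℂ)‖ := by rw [hnx, zero_add, zpow_one]; linarith
    have ha2 : ‖(x : ℂ)‖ < ‖q‖ ^ (0 : ℤ) := by rwa [hnx, zpow_zero]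
    have hprod := appell_mul_thetaG hq hq0 ha1 ha2
    rw [hC] at hprod
    refine (mul_eq_zero.1 hprod).resolve_left fun hL => ?_
    have T := (summable_appellTerm hq hq0 ha1 ha2).hasSum
    rw [hL] at T
    have hgeo : HasSum (fun p : ℤ × ℤ => if p.1 = 0 ∧ 0 ≤ p.2 then (x : ℂ) ^ p.2 else 0)
        (1 - (x : ℂ))⁻¹ := by
      have h := hasSum_geometric_of_norm_lt_one (ξ := (x : ℂ)) (by rwa [hnx])
      have hinj : Function.Injective (fun n : ℕ => ((0 : ℤ), (n : ℤ))) := fun a b hab => by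
        simpa using hab
      refine (hinj.hasSum_iff ?_).1 (h.of_forall_eq fun n => ?_)
      · rintro ⟨n, l⟩ hp
        refine if_neg fun h => hp ⟨l.toNat, ?_⟩
        simp only at h
        simp [h.1, h.2]
      · simp
    have D := T.sub hgeo
    have hle := D.norm_le_of_bounded S.hasSum fun p => ?_
    · rw [zero_sub, norm_neg, norm_inv, ← hM] at hle
      have : ‖1 - (x : ℂ)‖ = 1 - x := by
        rw [← Complex.ofReal_one, ← Complex.ofReal_sub, Complex.norm_real,
          Real.norm_of_nonneg (by linarith)]
      rw [this] at hle
      linarith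
    · obtain ⟨n, l⟩ := p
      have hpos : 0 ≤ ‖q‖ ^ tri (n + 1) * (if 0 ≤ l then ‖q‖ ^ l else (‖q‖⁻¹ * x₀) ^ l) := by
        split_ifs <;> positivity
      have e : ∀ a : ℂ, ‖a * ((-1) ^ n * q ^ (tri (n + 1) + n * l)) * (x : ℂ) ^ l‖ =
          ‖a‖ * (‖q‖ ^ tri (n + 1) * (‖q‖ ^ n * x) ^ l) := by
        intro a
        simp only [norm_mul, norm_zpow, norm_neg, norm_one, one_zpow, one_mul, hnx]
        rw [zpow_add₀ hr0.ne', zpow_mul, mul_zpow]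
        ring
      simp only [appellTerm, expansionSign, neg_zero]
      by_cases hn : n = 0
      · subst hn
        by_cases hl : 0 ≤ l
        · simpa [hl, tri_one] using by positivity
        · simpa [hl] using by positivity
      · rw [if_neg (show ¬(n = 0 ∧ 0 ≤ l) from fun h => hn h.1), sub_zero, e]
        by_cases c1 : 0 ≤ n ∧ 0 ≤ l
        · rw [if_pos c1, if_pos c1.2, norm_one, one_mul]
          have hn1 : ‖q‖ ^ n ≤ ‖q‖ ^ (1 : ℤ) :=
            zpow_le_zpow_right_of_le_one₀ hr0 hq.le (by omega)
          rw [zpow_one] at hn1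
          have := zpow_le_zpow_left₀ c1.2 (by positivity : 0 ≤ ‖q‖ ^ n * x)
            (by nlinarith : ‖q‖ ^ n * x ≤ ‖q‖)
          gcongr
        · rw [if_neg c1]
          by_cases c2 : n < 0 ∧ l < 0
          · rw [if_pos c2, if_neg (by omega), norm_neg, norm_one, one_mul]
            gcongr
            have hn1 : ‖q‖ ^ (-1 : ℤ) ≤ ‖q‖ ^ n :=
              zpow_le_zpow_right_of_le_one₀ hr0 hq.le (by omega)
            rw [zpow_neg_one] at hn1
            obtain ⟨m, rfl⟩ : ∃ m : ℤ, l = -m := ⟨-l, by ring⟩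
            rw [zpow_neg, zpow_neg]
            refine inv_anti₀ (by positivity) (zpow_le_zpow_left₀ (by omega) (by positivity) ?_)
            gcongr
          · rw [if_neg c2, norm_zero, zero_mul]
            exact hpos
  -- hence the theta function would vanish on an interval that ends at `1`
  have hev : ∀ᶠ x : ℝ in 𝓝[<] 1, thetaG q x = 0 := by
    have hlim : Tendsto (fun x : ℝ => (1 - x)⁻¹) (𝓝[<] 1) atTop := by
      refine tendsto_inv_nhdsGT_zero.comp ?_
      refine tendsto_nhdsWithin_iff.2 ⟨?_, ?_⟩
      · have : Tendsto (fun x : ℝ => 1 - x) (𝓝 1) (𝓝 (1 - 1)) :=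
          (continuous_const.sub continuous_id).tendsto 1
        rw [sub_self] at this
        exact this.mono_left nhdsWithin_le_nhds
      · filter_upwards [self_mem_nhdsWithin] with x hx
        simpa using hx
    filter_upwards [hlim.eventually_gt_atTop M, Ioo_mem_nhdsLT hx₀1] with x h1 h2
    exact key x h2.1 h2.2 h1
  have hfreq : ∃ᶠ z : ℂ in 𝓝[≠] 1, thetaG q z = 0 := by
    have ht : Tendsto (fun x : ℝ => (x : ℂ)) (𝓝[<] 1) (𝓝[≠] 1) := by
      refine tendsto_nhdsWithin_iff.2 ⟨?_, ?_⟩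
      · have : Tendsto (fun x : ℝ => (x : ℂ)) (𝓝 1) (𝓝 ((1 : ℝ) : ℂ)) :=
          Complex.continuous_ofReal.tendsto 1
        rw [Complex.ofReal_one] at this
        exact this.mono_left nhdsWithin_le_nhds
      · filter_upwards [self_mem_nhdsWithin] with x hx
        have : x ≠ 1 := ne_of_lt hx
        simpa using this
    exact ht.frequently hev.frequently
  have han : AnalyticOnNhd ℂ (thetaG q) {0}ᶜ :=
    DifferentiableOn.analyticOnNhd
      (fun z hz => (differentiableAt_thetaG hq hz).differentiableWithinAt) isOpen_compl_singleton
  have hcon : IsPreconnected ({0}ᶜ : Set ℂ) :=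
    (isConnected_compl_singleton_of_one_lt_rank (by simp) 0).isPreconnected
  have hz := han.eqOn_zero_of_preconnected_of_frequently_eq_zero hcon
    (by simp : (1 : ℂ) ∈ ({0}ᶜ : Set ℂ)) hfreq
  obtain ⟨z, hz0, hzne⟩ := exists_thetaG_ne_zero hq
  exact hzne (hz hz0)

/-- The theta function has no zeros in the open annuli between the circles `|z| = |q| ^ s`. -/
theorem thetaG_ne_zero {q z : ℂ} (hq : ‖q‖ < 1) (hq0 : q ≠ 0) {s : ℤ}
    (h1 : ‖q‖ ^ (s + 1) < ‖z‖) (h2 : ‖z‖ < ‖q‖ ^ s) : thetaG q z ≠ 0 := by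
  intro h
  have := appell_mul_thetaG hq hq0 h1 h2
  rw [h, mul_zero] at this
  exact thetaSlope_ne_zero hq hq0 this.symm

/-! ### Division of Laurent series by the theta function -/

/-- If the sum of a Laurent series vanishes on the hypersurface `∏ z_i = w`, then all the sums of
its coefficients along the direction `(1, …, 1)`, with weights `w ^ l`, vanish. -/
theorem hasSum_diagonal_eq_zero {n : ℕ} {F : (Fin (n + 1) → ℂ) → ℂ} {c : (Fin (n + 1) → ℤ) → ℂ}
    (hc : ∀ z : Fin (n + 1) → ℂ, (∀ i, z i ≠ 0) → HasSum (fun γ => c γ * mono γ z) (F z))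
    {w : ℂ} (hw : w ≠ 0)
    (hF : ∀ z : Fin (n + 1) → ℂ, (∀ i, z i ≠ 0) → ∏ i, z i = w → F z = 0)
    (β : Fin (n + 1) → ℤ) :
    HasSum (fun l : ℤ => c (fun i => β i + l) * w ^ l) 0 := by
  obtain ⟨e, he⟩ : ∃ e : (Fin n → ℤ) × ℤ ≃ (Fin (n + 1) → ℤ),
      ∀ p, e p = Fin.cons p.2 fun i => p.1 i + p.2 := ⟨
    { toFun := fun p => Fin.cons p.2 fun i => p.1 i + p.2
      invFun := fun γ => (fun i => γ i.succ - γ 0, γ 0)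
      left_inv := fun p => by ext <;> simp
      right_inv := fun γ => by
        ext i
        refine Fin.cases ?_ (fun i => ?_) i <;> simp }, fun _ => rfl⟩
  have hsum : ∀ z' : Fin n → ℂ, (∀ i, z' i ≠ 0) →
      HasSum (fun p : (Fin n → ℤ) × ℤ => c (e p) * w ^ p.2 * mono p.1 z') 0 := by
    intro z' hz'
    have hP : ∏ i, z' i ≠ 0 := Finset.prod_ne_zero_iff.2 fun i _ => hz' i
    set z : Fin (n + 1) → ℂ := Fin.cons (w / ∏ i, z' i) z' with hz
    have hz0 : ∀ i, z i ≠ 0 := by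
      intro i
      refine Fin.cases ?_ (fun i => ?_) i
      · exact div_ne_zero hw hP
      · exact hz' i
    have h := hc z hz0
    rw [hF z hz0 (by rw [Fin.prod_univ_succ]; simp [hz, div_mul_cancel₀ _ hP]),
      ← e.hasSum_iff] at h
    refine h.of_forall_eq fun p => ?_
    simp only [Function.comp_apply]
    rw [mul_assoc]
    congr 1
    rw [mono, Fin.prod_univ_succ]
    simp only [he, hz, Fin.cons_zero, Fin.cons_succ, mono, div_zpow,
      ← Finset.prod_zpow]
    simp only [zpow_add₀ (hz' _), Finset.prod_mul_distrib]
    have : ∏ i, z' i ^ p.2 ≠ 0 := Finset.prod_ne_zero_iff.2 fun i _ => zpow_ne_zero _ (hz' i)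
    field_simp
  have hfib : ∀ δ : Fin n → ℤ, Summable fun l : ℤ => c (e (δ, l)) * w ^ l := by
    intro δ
    have := (hsum 1 (fun _ => one_ne_zero)).summable.prod_factor δ
    refine this.congr fun l => ?_
    simp [mono]
  have hzero : ∀ δ : Fin n → ℤ, ∑' l : ℤ, c (e (δ, l)) * w ^ l = 0 := by
    refine laurent_coeff_eq_zero (c := fun δ => ∑' l : ℤ, c (e (δ, l)) * w ^ l) (r := fun _ => 1)
      (fun _ => one_pos) fun z' hz' => ?_
    have hz0 : ∀ i, z' i ≠ 0 := fun i => norm_pos_iff.1 ((hz' i).symm ▸ one_pos)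
    have hδ := fun δ => (hfib δ).hasSum.mul_right (mono δ z')
    exact (hsum z' hz0).prod_fiberwise hδ
  have h := (hfib fun i => β i.succ - β 0).hasSum
  rw [hzero, ← (Equiv.addLeft (β 0)).hasSum_iff] at h
  have h2 := h.mul_left (w ^ (-β 0))
  rw [mul_zero] at h2
  refine h2.of_forall_eq fun l => ?_
  have : e (fun i => β i.succ - β 0, β 0 + l) = fun i => β i + l := by
    ext i
    refine Fin.cases ?_ (fun i => ?_) i
    · simp [he]
    · simp only [he, Fin.cons_succ]
      ring
  simp only [Function.comp_apply, Equiv.coe_addLeft, this]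
  rw [zpow_add₀ hw, zpow_neg]
  have := zpow_ne_zero (β 0) hw
  field_simp

/-- A circle in the annulus `|q| ^ (s + 1) < |z| < |q| ^ s`. -/
theorem exists_mem_annulus {q : ℂ} (hq : ‖q‖ < 1) (hq0 : q ≠ 0) (s : ℤ) :
    ∃ x : ℝ, 0 < x ∧ ‖q‖ ^ (s + 1) < x ∧ x < ‖q‖ ^ s := by
  have hr0 : 0 < ‖q‖ := norm_pos_iff.2 hq0
  obtain ⟨x, h1, h2⟩ := exists_between (zpow_lt_zpow_right_of_lt_one₀ hr0 hq (lt_add_one s))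
  exact ⟨x, (zpow_pos hr0 _).trans h1, h1, h2⟩

theorem summable_appellTerm_fiber {q : ℂ} (hq : ‖q‖ < 1) (hq0 : q ≠ 0) (s l : ℤ) :
    Summable fun n => appellTerm q s n l := by
  obtain ⟨x, hx0, h1, h2⟩ := exists_mem_annulus hq hq0 s
  have hn : ‖(x : ℂ)‖ = x := by simp [abs_of_pos hx0]
  have hx : (x : ℂ) ^ l ≠ 0 := zpow_ne_zero _ (by simpa using hx0.ne')
  have h := (summable_appellTerm (z := x) hq hq0 (by rwa [hn]) (by rwa [hn]))
  rw [← (Equiv.prodComm ℤ ℤ).summable_iff] at h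
  exact (summable_mul_right_iff hx).1 (h.prod_factor l)

/-- The expansions in adjacent annuli differ by the expansion of a delta function. -/
theorem appellCoeff_succ {q : ℂ} (hq : ‖q‖ < 1) (hq0 : q ≠ 0) (s l : ℤ) :
    appellCoeff q (s + 1) l = appellCoeff q s l +
      (-1) ^ (s + 1) * q ^ tri (-s) * (q ^ (s + 1)) ^ (-l) := by
  rw [appellCoeff, appellCoeff]
  refine (((summable_appellTerm_fiber hq hq0 s l).hasSum.add
    (hasSum_ite_eq (-s - 1) _)).of_forall_eq fun n => ?_).tsum_eq
  by_cases hn : n = -s - 1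
  · subst hn
    have e : (-1 : ℂ) ^ (-s - 1) * q ^ (tri (-s - 1 + 1) + (-s - 1) * l) =
        (-1) ^ (s + 1) * q ^ tri (-s) * (q ^ (s + 1)) ^ (-l) := by
      rw [sub_add_cancel, zpow_add₀ hq0, ← zpow_mul, ← mul_assoc,
        show -s - 1 = -(s + 1) by ring, neg_one_zpow_neg]
      congr 2
      ring
    rw [if_pos rfl, appellTerm, appellTerm, e, expansionSign, expansionSign]
    by_cases hl : 0 ≤ l
    · rw [if_neg (by omega), if_neg (by omega), if_pos (by omega)]
      ring
    · rw [if_neg (by omega), if_pos (by omega), if_neg (by omega), if_neg (by omega)]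
      ring
  · rw [if_neg hn, add_zero, appellTerm, appellTerm]
    congr 1
    unfold expansionSign
    exact if_congr (by omega) rfl (if_congr (by omega) rfl rfl)

section division

variable {q : ℂ} {n : ℕ} {F : (Fin (n + 1) → ℂ) → ℂ} {c : (Fin (n + 1) → ℤ) → ℂ}

/-- Multiplication of a Laurent series by the Appell series in one of the annuli. -/
theorem hasSum_appell_mul (hq : ‖q‖ < 1) (hq0 : q ≠ 0)
    (hc : ∀ z : Fin (n + 1) → ℂ, (∀ i, z i ≠ 0) → HasSum (fun γ => c γ * mono γ z) (F z))
    {s : ℤ} {z : Fin (n + 1) → ℂ} (hz : ∀ i, z i ≠ 0)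
    (h1 : ‖q‖ ^ (s + 1) < ‖∏ i, z i‖) (h2 : ‖∏ i, z i‖ < ‖q‖ ^ s) :
    (∀ β : Fin (n + 1) → ℤ, Summable fun l => appellCoeff q s l * c (fun i => β i - l)) ∧
    HasSum (fun β : Fin (n + 1) → ℤ =>
        (∑' l, appellCoeff q s l * c (fun i => β i - l)) * mono β z)
      (thetaSlope q / thetaG q (∏ i, z i) * F z) := by
  have h := hasSum_appellCoeff hq hq0 h1 h2
  rw [eq_div_of_mul_eq (thetaG_ne_zero hq hq0 h1 h2) (appell_mul_thetaG hq hq0 h1 h2)] at h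
  have S := h.mul_prod (hc z hz)
  obtain ⟨e, he⟩ : ∃ e : (Fin (n + 1) → ℤ) × ℤ ≃ ℤ × (Fin (n + 1) → ℤ),
      ∀ p, e p = (p.2, fun i => p.1 i - p.2) := ⟨
    { toFun := fun p => (p.2, fun i => p.1 i - p.2)
      invFun := fun p => (fun i => p.2 i + p.1, p.1)
      left_inv := fun p => by ext <;> simp
      right_inv := fun p => by ext <;> simp }, fun _ => rfl⟩
  rw [← e.hasSum_iff] at S
  have S' := S.of_forall_eq (g := fun p : (Fin (n + 1) → ℤ) × ℤ =>
      appellCoeff q s p.2 * c (fun i => p.1 i - p.2) * mono p.1 z) fun p => by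
    have : mono p.1 z = (∏ i, z i) ^ p.2 * mono (fun i => p.1 i - p.2) z := by
      rw [mono, mono, ← Finset.prod_zpow, ← Finset.prod_mul_distrib]
      refine Finset.prod_congr rfl fun i _ => ?_
      rw [← zpow_add₀ (hz i), add_sub_cancel]
    simp only [Function.comp_apply, he, this]
    ring
  have hfib : ∀ β : Fin (n + 1) → ℤ,
      Summable fun l => appellCoeff q s l * c (fun i => β i - l) := fun β =>
    (summable_mul_right_iff (mono_ne_zero β hz)).1 (S'.summable.prod_factor β)
  have hβ := fun β => (hfib β).hasSum.mul_right (mono β z)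
  exact ⟨hfib, S'.prod_fiberwise hβ⟩

theorem exists_norm_prod_eq {x : ℝ} (hx : 0 < x) :
    ∃ r : Fin (n + 1) → ℝ, (∀ i, 0 < r i) ∧ ∏ i, r i = x := by
  refine ⟨Fin.cons x fun _ => 1, fun i => ?_, by rw [Fin.prod_univ_succ]; simp⟩
  refine Fin.cases hx (fun i => ?_) i
  simp

/-- The product does not depend on the annulus if `F` vanishes where the theta function does. -/
theorem appell_mul_eq (hq : ‖q‖ < 1) (hq0 : q ≠ 0)
    (hc : ∀ z : Fin (n + 1) → ℂ, (∀ i, z i ≠ 0) → HasSum (fun γ => c γ * mono γ z) (F z))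
    (hF : ∀ z : Fin (n + 1) → ℂ, (∀ i, z i ≠ 0) → ∀ m : ℤ, ∏ i, z i = q ^ m → F z = 0)
    (β : Fin (n + 1) → ℤ) (s : ℤ) :
    ∑' l, appellCoeff q s l * c (fun i => β i - l) =
      ∑' l, appellCoeff q 0 l * c (fun i => β i - l) := by
  have hsm : ∀ s, Summable fun l => appellCoeff q s l * c (fun i => β i - l) := by
    intro s
    obtain ⟨x, hx0, h1, h2⟩ := exists_mem_annulus hq hq0 s
    obtain ⟨r, hr, hrx⟩ := exists_norm_prod_eq (n := n) hx0
    have hn : ‖∏ i, (r i : ℂ)‖ = x := by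
      rw [norm_prod, ← hrx]
      exact Finset.prod_congr rfl fun i _ => by simp [abs_of_pos (hr i)]
    exact (hasSum_appell_mul hq hq0 hc (z := fun i => (r i : ℂ))
      (fun i => by simpa using (hr i).ne') (hn.symm ▸ h1) (hn.symm ▸ h2)).1 β
  have step : ∀ s, ∑' l, appellCoeff q (s + 1) l * c (fun i => β i - l) =
      ∑' l, appellCoeff q s l * c (fun i => β i - l) := by
    intro s
    have hd := hasSum_diagonal_eq_zero hc (zpow_ne_zero (s + 1) hq0)
      (fun z hz hzw => hF z hz (s + 1) hzw) β
    rw [← (Equiv.neg ℤ).hasSum_iff] at hd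
    have := (hsm s).hasSum.add (hd.mul_left ((-1) ^ (s + 1) * q ^ tri (-s)))
    rw [mul_zero, add_zero] at this
    refine (this.of_forall_eq fun l => ?_).tsum_eq
    rw [appellCoeff_succ hq hq0]
    simp only [Function.comp_apply, Equiv.neg_apply, ← sub_eq_add_neg]
    ring
  induction s using Int.induction_on with
  | zero => rfl
  | succ m ih => rw [step, ih]
  | pred m ih => rw [← ih, ← step, sub_add_cancel]

/-- **Division by the theta function.** An entire Laurent function that vanishes wherever the theta
function of the product of the variables does is divisible by it. -/
theorem EntireLaurent.exists_mul_thetaG_eq (hq : ‖q‖ < 1) (hq0 : q ≠ 0) (hFL : EntireLaurent F)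
    (hF : ∀ z : Fin (n + 1) → ℂ, (∀ i, z i ≠ 0) → ∀ m : ℤ, ∏ i, z i = q ^ m → F z = 0) :
    ∃ E : (Fin (n + 1) → ℂ) → ℂ, EntireLaurent E ∧
      ∀ z : Fin (n + 1) → ℂ, (∀ i, z i ≠ 0) → E z * thetaG q (∏ i, z i) = F z := by
  obtain ⟨c, hc⟩ := hFL
  have hr0 : 0 < ‖q‖ := norm_pos_iff.2 hq0
  set ψ : (Fin (n + 1) → ℤ) → ℂ := fun β => ∑' l, appellCoeff q 0 l * c (fun i => β i - l) with hψ
  have hann : ∀ z : Fin (n + 1) → ℂ, (∀ i, z i ≠ 0) → ∀ s : ℤ, ‖q‖ ^ (s + 1) < ‖∏ i, z i‖ →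
      ‖∏ i, z i‖ < ‖q‖ ^ s →
      HasSum (fun β => ψ β * mono β z) (thetaSlope q / thetaG q (∏ i, z i) * F z) := by
    intro z hz s h1 h2
    refine (hasSum_appell_mul hq hq0 hc hz h1 h2).2.of_forall_eq fun β => ?_
    rw [appell_mul_eq hq hq0 hc hF]
  have hsummable : ∀ z : Fin (n + 1) → ℂ, (∀ i, z i ≠ 0) → Summable fun β => ψ β * mono β z := by
    intro z hz
    have hZ : 0 < ‖∏ i, z i‖ := norm_pos_iff.2 (Finset.prod_ne_zero_iff.2 fun i _ => hz i)
    obtain ⟨m, hm1, hm2⟩ := exists_mem_Ioc_zpow hZ (one_lt_inv₀ hr0 |>.2 hq)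
    obtain ⟨s, rfl⟩ : ∃ s, m = -(s + 1) := ⟨-m - 1, by ring⟩
    rw [inv_zpow', neg_neg] at hm1
    rw [show -(s + 1) + 1 = -s by ring, inv_zpow', neg_neg] at hm2
    rcases lt_or_eq_of_le hm2 with hlt | heq
    · exact (hann z hz s hm1 hlt).summable
    · -- on a boundary circle the series is dominated by its values at two nearby points
      obtain ⟨t, ht1, ht2⟩ := exists_between hq
      have ht0 : 0 < t := hr0.trans ht1
      have hscale : ∀ x : ℝ, 0 < x → ∃ w : Fin (n + 1) → ℂ, (∀ i, w i ≠ 0) ∧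
          ‖∏ i, w i‖ = ‖∏ i, z i‖ * x ∧ ∀ β, ‖mono β w‖ = ‖mono β z‖ * x ^ β 0 := by
        intro x hx
        refine ⟨fun i => z i * (Fin.cons (x : ℂ) (fun _ => 1) : Fin (n + 1) → ℂ) i, ?_, ?_, ?_⟩
        · intro i
          refine mul_ne_zero (hz i) ?_
          refine Fin.cases ?_ (fun i => ?_) i
          · simpa using hx.ne'
          · simp
        · rw [Finset.prod_mul_distrib, norm_mul]
          congr 1
          rw [Fin.prod_univ_succ]
          simp [abs_of_pos hx]
        · intro β
          rw [mono_mul, norm_mul, norm_mono β (Fin.cons _ _), Fin.prod_univ_succ]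
          simp [abs_of_pos hx]
      obtain ⟨w, hw, hw1, hw2⟩ := hscale t ht0
      obtain ⟨v, hv, hv1, hv2⟩ := hscale t⁻¹ (inv_pos.2 ht0)
      have hs0 : 0 < ‖q‖ ^ s := zpow_pos hr0 s
      have hW := (hann w hw s (by
          rw [hw1, heq, zpow_add_one₀ hr0.ne']
          gcongr) (by
          rw [hw1, heq]
          exact mul_lt_of_lt_one_right hs0 ht2)).summable.norm
      have hV := (hann v hv (s - 1) (by
          rw [hv1, heq, sub_add_cancel]
          exact lt_mul_of_one_lt_right hs0 ((one_lt_inv₀ ht0).2 ht2)) (by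
          rw [hv1, heq, zpow_sub_one₀ hr0.ne']
          gcongr)).summable.norm
      refine Summable.of_norm_bounded (hW.add hV) fun β => ?_
      rw [norm_mul, norm_mul, norm_mul, hw2, hv2, ← mul_add, ← mul_add]
      gcongr
      refine le_mul_of_one_le_right (norm_nonneg _) ?_
      rcases le_total 0 (β 0) with hb | hb
      · have := one_le_zpow₀ ((one_le_inv₀ ht0).2 ht2.le) hb
        have := zpow_pos ht0 (β 0)
        linarith
      · have := one_le_zpow_of_nonpos₀ ht0 ht2.le hb
        have := zpow_pos (inv_pos.2 ht0) (β 0)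
        linarith
  have hE : EntireLaurent fun z => (thetaSlope q)⁻¹ * ∑' β, ψ β * mono β z :=
    (EntireLaurent.const_mul_mono (thetaSlope q)⁻¹ 0).mul ⟨ψ, fun z hz => (hsummable z hz).hasSum⟩
      |>.congr fun z _ => by rw [mono_zero, mul_one]
  refine ⟨_, hE, ?_⟩
  have hg : EntireLaurent fun z : Fin (n + 1) → ℂ => thetaG q (∏ i, z i) :=
    (EntireLaurent.thetaG_mono hq 1).congr fun z _ => by simp [mono]
  obtain ⟨x, hx0, h1, h2⟩ := exists_mem_annulus hq hq0 0
  obtain ⟨r, hr, hrx⟩ := exists_norm_prod_eq (n := n) hx0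
  intro z hz
  refine (hE.mul hg).eq_of_torus ⟨c, hc⟩ hr (fun w hw => ?_) hz
  have hw0 : ∀ i, w i ≠ 0 := fun i => norm_pos_iff.1 ((hw i).symm ▸ hr i)
  have hn : ‖∏ i, w i‖ = x := by
    rw [norm_prod, ← hrx]
    exact Finset.prod_congr rfl fun i _ => hw i
  rw [← hn] at h1 h2
  rw [(hann w hw0 0 h1 h2).tsum_eq]
  have := thetaG_ne_zero hq hq0 h1 h2
  have := thetaSlope_ne_zero hq hq0
  field_simp

end division

/-! ### Partial fractions for theta functions -/

theorem thetaG_div_swap {q x y : ℂ} (hq : ‖q‖ < 1) (hx : x ≠ 0) (hy : y ≠ 0) :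
    thetaG q (x / y) = -(x / y) * thetaG q (y / x) := by
  have := thetaG_inv hq (div_ne_zero hy hx)
  rwa [inv_div] at this

/-- Zeros of the theta function can be avoided by moving the argument slightly inwards. -/
theorem eventually_thetaG_div_ne_zero {q y : ℂ} (hq : ‖q‖ < 1) (hq0 : q ≠ 0) (hy : y ≠ 0) :
    ∀ᶠ t : ℝ in 𝓝[>] 1, thetaG q (y / t) ≠ 0 := by
  have hr0 : 0 < ‖q‖ := norm_pos_iff.2 hq0
  have hy0 : 0 < ‖y‖ := norm_pos_iff.2 hy
  obtain ⟨m, hm1, hm2⟩ := exists_mem_Ioc_zpow hy0 (one_lt_inv₀ hr0 |>.2 hq)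
  obtain ⟨s, rfl⟩ : ∃ s, m = -(s + 1) := ⟨-m - 1, by ring⟩
  rw [inv_zpow', neg_neg] at hm1
  rw [show -(s + 1) + 1 = -s by ring, inv_zpow', neg_neg] at hm2
  have hpos := zpow_pos hr0 (s + 1)
  filter_upwards [Ioo_mem_nhdsGT ((one_lt_div hpos).2 hm1)] with t ht
  have ht0 : 0 < t := one_pos.trans ht.1
  have hn : ‖y / t‖ = ‖y‖ / t := by
    rw [norm_div, Complex.norm_real, Real.norm_of_nonneg ht0.le]
  refine thetaG_ne_zero hq hq0 (s := s) ?_ ?_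
  · rw [hn, lt_div_iff₀ ht0, mul_comm]
    exact (lt_div_iff₀ hpos).1 ht.2
  · rw [hn]
    exact (div_lt_self hy0 ht.1).trans_le hm2

/-- The denominator `∏_{j ≠ r} g(w_j / w_r)` of a partial fraction expansion. -/
noncomputable def thetaDenom (q : ℂ) {n : ℕ} (w : Fin n → ℂ) (r : Fin n) : ℂ :=
  ∏ j, if j = r then 1 else thetaG q (w j / w r)

/-- The sum of the residues of the elliptic function
`t ↦ g(a₀/t) g(a₁/t) ∏_j g(b_j/t) / ∏_j g(w_j/t)` vanishes. As a function of `a₀`, with the product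
`a₀ a₁` fixed, the sum lies in a two-dimensional space, and by induction on the number of factors it
vanishes at all the points `w_j`. -/
theorem sum_thetaG_div_thetaDenom_eq_zero {q : ℂ} (hq : ‖q‖ < 1) (hq0 : q ≠ 0) (m : ℕ)
    (b : Fin m → ℂ) (a₀ a₁ : ℂ) (w : Fin (m + 2) → ℂ) (hb : ∀ j, b j ≠ 0) (ha₀ : a₀ ≠ 0)
    (ha₁ : a₁ ≠ 0) (hw : ∀ j, w j ≠ 0) (hprod : a₀ * a₁ * ∏ j, b j = ∏ j, w j)
    (hne : ∀ i j, i ≠ j → thetaG q (w i / w j) ≠ 0) :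
    ∑ r, thetaG q (a₀ / w r) * thetaG q (a₁ / w r) * (∏ j, thetaG q (b j / w r)) /
      thetaDenom q w r = 0 := by
  induction m generalizing a₀ a₁ with
  | zero =>
    rw [Fin.sum_univ_two]
    have p2 : ∀ f : Fin (0 + 2) → ℂ, ∏ j, f j = f 0 * f 1 := fun f => Fin.prod_univ_two f
    simp only [thetaDenom, p2, Finset.univ_eq_empty, Finset.prod_empty, mul_one,
      Fin.isValue] at hprod ⊢
    have h10 := hne 1 0 (by decide)
    have h01 := hne 0 1 (by decide)
    have e1 : a₁ / w 0 = w 1 / a₀ := by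
      rw [div_eq_div_iff (hw 0) ha₀]; linear_combination hprod
    have e2 : a₁ / w 1 = w 0 / a₀ := by
      rw [div_eq_div_iff (hw 1) ha₀]; linear_combination hprod
    rw [e1, e2, thetaG_div_swap hq (hw 1) ha₀, thetaG_div_swap hq (hw 0) ha₀]
    rw [thetaG_div_swap hq (hw 0) (hw 1)]
    have := hw 0
    have := hw 1
    simp only [if_true, one_mul, mul_one, if_neg (show (1 : Fin (0 + 2)) ≠ 0 by decide),
      if_neg (show (0 : Fin (0 + 2)) ≠ 1 by decide)]
    field_simp
    ring
  | succ m ih =>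
    -- the claim for one value of `B = a₀ a₁`, assumed to be generic
    have generic : ∀ (b : Fin (m + 1) → ℂ) (a₁ : ℂ), (∀ j, b j ≠ 0) → a₁ ≠ 0 →
        a₀ * a₁ * ∏ j, b j = ∏ j, w j → thetaG q (a₀ * a₁ / w 1 / w 0) ≠ 0 →
        ∑ r, thetaG q (a₀ / w r) * thetaG q (a₁ / w r) * (∏ j, thetaG q (b j / w r)) /
          thetaDenom q w r = 0 := by
      intro b a₁ hb ha₁ hprod hgen
      set B := a₀ * a₁ with hB
      have hB0 : B ≠ 0 := mul_ne_zero ha₀ ha₁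
      obtain ⟨Θ₀, Θ₁, A₀, A₁, hG⟩ := thetaG_mul_thetaG_rank_two hq hq0 hB0
      set K : Fin (m + 1 + 2) → ℂ := fun r => (∏ j, thetaG q (b j / w r)) / thetaDenom q w r with hK
      set H₀ := ∑ r, A₀ (w r) * K r with hH₀
      set H₁ := ∑ r, A₁ (w r) * K r with hH₁
      have hh : ∀ x, x ≠ 0 →
          ∑ r, thetaG q (x / w r) * thetaG q (B / x / w r) * K r = Θ₀ x * H₀ - Θ₁ x * H₁ := by
        intro x hx
        rw [hH₀, hH₁, Finset.mul_sum, Finset.mul_sum, ← Finset.sum_sub_distrib]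
        refine Finset.sum_congr rfl fun r _ => ?_
        rw [hG x (w r) hx (hw r)]
        ring
      have hzero : ∀ i, Θ₀ (w i) * H₀ - Θ₁ (w i) * H₁ = 0 := by
        intro i
        rw [← hh (w i) (hw i), Fin.sum_univ_succAbove _ i, div_self (hw i), thetaG_one hq, zero_mul,
          zero_mul, zero_add]
        have := ih (fun j => b j.succ) (B / w i) (b 0) (fun j => w (i.succAbove j))
          (fun j => hb _) (div_ne_zero hB0 (hw i)) (hb 0) (fun j => hw _) ?_ ?_
        · rw [← this]
          refine Finset.sum_congr rfl fun r _ => ?_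
          have hir : thetaG q (w i / w (i.succAbove r)) ≠ 0 := hne _ _ (Fin.succAbove_ne i r).symm
          have hD : thetaDenom q w (i.succAbove r) =
              thetaG q (w i / w (i.succAbove r)) *
                thetaDenom q (fun j => w (i.succAbove j)) r := by
            rw [thetaDenom, Fin.prod_univ_succAbove _ i, if_neg (Fin.succAbove_ne i r).symm]
            simp only [thetaDenom, Fin.succAbove_right_inj]
          rw [hK]
          simp only
          rw [hD, Fin.prod_univ_succ]
          field_simp
        · rw [Fin.prod_univ_succ, Fin.prod_univ_succAbove _ i] at hprod
          have := hw i
          field_simp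
          linear_combination hprod
        · intro j l hjl
          exact hne _ _ fun h => hjl (Fin.succAbove_right_injective h)
      have h0 := hzero 0
      have h1 := hzero 1
      have g00 := hG (w 0) (w 0) (hw 0) (hw 0)
      rw [div_self (hw 0), thetaG_one hq, zero_mul] at g00
      have g10 := hG (w 1) (w 0) (hw 1) (hw 0)
      have g10ne := mul_ne_zero (hne 1 0 (by simp)) hgen
      rw [g10] at g10ne
      have g01 := hG (w 0) (w 1) (hw 0) (hw 1)
      have g01ne := mul_ne_zero (hne 0 1 (by simp)) hgen
      rw [div_right_comm, g01] at g01ne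
      -- if `(Θ₀, Θ₁)` had proportional values at `w 0` and `w 1`, the product
      -- `g(w 1 / w 0) g(B / (w 0 w 1))` would vanish along with `g(w 0 / w 0)`
      have hdet : Θ₀ (w 0) * Θ₁ (w 1) - Θ₁ (w 0) * Θ₀ (w 1) ≠ 0 := by
        intro hdet
        have e0 : Θ₀ (w 0) * (Θ₀ (w 1) * A₀ (w 0) - Θ₁ (w 1) * A₁ (w 0)) = 0 := by
          linear_combination -Θ₀ (w 1) * g00 - A₁ (w 0) * hdet
        have e1 : Θ₁ (w 0) * (Θ₀ (w 1) * A₀ (w 0) - Θ₁ (w 1) * A₁ (w 0)) = 0 := by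
          linear_combination -Θ₁ (w 1) * g00 - A₀ (w 0) * hdet
        have e0' := (mul_eq_zero.1 e0).resolve_right g10ne
        have e1' := (mul_eq_zero.1 e1).resolve_right g10ne
        rw [e0', e1'] at g01ne
        simp at g01ne
      have hH1 : H₁ = 0 := by
        refine (mul_eq_zero.1 (?_ :
          (Θ₀ (w 0) * Θ₁ (w 1) - Θ₁ (w 0) * Θ₀ (w 1)) * H₁ = 0)).resolve_left hdet
        linear_combination Θ₀ (w 1) * h0 - Θ₀ (w 0) * h1
      have hH0 : H₀ = 0 := by
        refine (mul_eq_zero.1 (?_ :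
          (Θ₀ (w 0) * Θ₁ (w 1) - Θ₁ (w 0) * Θ₀ (w 1)) * H₀ = 0)).resolve_left hdet
        linear_combination Θ₁ (w 1) * h0 - Θ₁ (w 0) * h1
      have := hh a₀ ha₀
      rw [hH0, hH1, mul_zero, mul_zero, sub_zero, hB, mul_div_cancel_left₀ _ ha₀] at this
      rw [← this]
      refine Finset.sum_congr rfl fun r _ => ?_
      rw [hK]
      ring
    -- the general case by continuity
    set φ : ℝ → ℂ := fun t => ∑ r, thetaG q (a₀ / w r) * thetaG q (a₁ / t / w r) *
      (∏ j, thetaG q (b j * (if j = 0 then (t : ℂ) else 1) / w r)) / thetaDenom q w r with hφ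
    have hcont : ContinuousAt φ 1 := by
      have hg : ∀ x : ℂ, x ≠ 0 → ContinuousAt (thetaG q) x := fun x hx =>
        (differentiableAt_thetaG hq hx).continuousAt
      have ht : ContinuousAt (fun t : ℝ => (t : ℂ)) 1 := Complex.continuous_ofReal.continuousAt
      refine tendsto_finsetSum _ fun r _ => Tendsto.div_const ?_ _
      refine Tendsto.mul (Tendsto.const_mul _ ?_) (tendsto_finsetProd _ fun j _ => ?_)
      · refine ContinuousAt.comp (g := thetaG q) (f := fun t : ℝ => a₁ / t / w r) (hg _ ?_) ?_
        · exact div_ne_zero (div_ne_zero ha₁ (by simp)) (hw r)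
        · exact (continuousAt_const.div ht (by simp)).div_const _
      · refine ContinuousAt.comp (g := thetaG q)
          (f := fun t : ℝ => b j * (if j = 0 then (t : ℂ) else 1) / w r) (hg _ ?_) ?_
        · refine div_ne_zero (mul_ne_zero (hb j) ?_) (hw r)
          split_ifs <;> simp
        · refine (continuousAt_const.mul ?_).div_const _
          split_ifs
          · exact ht
          · exact continuousAt_const
    have hev : ∀ᶠ t : ℝ in 𝓝[>] 1, φ t = 0 := by
      have hy : a₀ * a₁ / w 1 / w 0 ≠ 0 :=
        div_ne_zero (div_ne_zero (mul_ne_zero ha₀ ha₁) (hw 1)) (hw 0)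
      filter_upwards [eventually_thetaG_div_ne_zero hq hq0 hy, self_mem_nhdsWithin] with t ht ht1
      have ht0 : (t : ℂ) ≠ 0 := by
        have : (1 : ℝ) < t := ht1
        exact_mod_cast (by linarith : t ≠ 0)
      refine generic _ _ (fun j => mul_ne_zero (hb j) ?_) (div_ne_zero ha₁ ht0) ?_ ?_
      · split_ifs
        · exact ht0
        · exact one_ne_zero
      · rw [← hprod, Finset.prod_mul_distrib, Finset.prod_ite_eq' Finset.univ 0]
        simp only [Finset.mem_univ, if_true]
        field_simp
      · convert ht using 2
        field_simp
    have hlim : Tendsto φ (𝓝[>] 1) (𝓝 (φ 1)) := hcont.tendsto.mono_left nhdsWithin_le_nhds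
    have h1 : φ 1 = 0 := tendsto_nhds_unique hlim
      (tendsto_const_nhds.congr' (hev.mono fun t ht => ht.symm))
    rw [← h1, hφ]
    simp

/-- The residue theorem for quotients of products of theta functions. -/
theorem sum_prod_thetaG_div_eq_zero {q : ℂ} (hq : ‖q‖ < 1) (hq0 : q ≠ 0) {n : ℕ}
    (a w : Fin (n + 1) → ℂ) (ha : ∀ j, a j ≠ 0) (hw : ∀ j, w j ≠ 0) (hprod : ∏ j, a j = ∏ j, w j)
    (hne : ∀ i j, i ≠ j → thetaG q (w i / w j) ≠ 0) :
    ∑ r, (∏ j, thetaG q (a j / w r)) / thetaDenom q w r = 0 := by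
  rcases n with _ | n
  · have p1 : ∀ f : Fin (0 + 1) → ℂ, ∏ j, f j = f 0 := fun f => Fin.prod_univ_one f
    have s1 : ∀ f : Fin (0 + 1) → ℂ, ∑ j, f j = f 0 := fun f => Fin.sum_univ_one f
    simp only [p1, s1] at hprod ⊢
    rw [hprod, div_self (hw 0), thetaG_one hq, zero_div]
  · rw [← sum_thetaG_div_thetaDenom_eq_zero hq hq0 n (fun j => a j.succ.succ) (a 0) (a 1) w
      (fun j => ha _) (ha 0) (ha 1) hw ?_ hne]
    · refine Finset.sum_congr rfl fun r _ => ?_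
      rw [Fin.prod_univ_succ, Fin.prod_univ_succ, ← mul_assoc]
      rfl
    · rw [← hprod, Fin.prod_univ_succ, Fin.prod_univ_succ, ← mul_assoc]
      rfl

/-! ### The recursion for the functions `f_{n,k}` -/

/-- The permutation of `n + 1` letters that sends the last letter to `j` and permutes the others
like `τ`. -/
noncomputable def permSnoc {n : ℕ} (j : Fin (n + 1)) (τ : Equiv.Perm (Fin n)) :
    Equiv.Perm (Fin (n + 1)) :=
  Equiv.ofBijective (Fin.snoc (fun i => j.succAbove (τ i)) j : Fin (n + 1) → Fin (n + 1)) <| by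
    refine Finite.injective_iff_bijective.1 fun a b => ?_
    refine Fin.lastCases ?_ (fun a => ?_) a <;> refine Fin.lastCases ?_ (fun b => ?_) b
    · simp
    · simp [(Fin.succAbove_ne j _).symm]
    · simp [Fin.succAbove_ne j _]
    · simp

theorem permSnoc_last {n : ℕ} (j : Fin (n + 1)) (τ : Equiv.Perm (Fin n)) :
    permSnoc j τ (Fin.last n) = j := by
  simp [permSnoc]

theorem permSnoc_castSucc {n : ℕ} (j : Fin (n + 1)) (τ : Equiv.Perm (Fin n)) (i : Fin n) :
    permSnoc j τ i.castSucc = j.succAbove (τ i) := by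
  simp [permSnoc]

theorem permSnoc_bijective (n : ℕ) :
    Function.Bijective fun p : Fin (n + 1) × Equiv.Perm (Fin n) => permSnoc p.1 p.2 := by
  rw [Fintype.bijective_iff_injective_and_card]
  constructor
  · rintro ⟨j, τ⟩ ⟨j', τ'⟩ h
    simp only at h
    obtain rfl : j = j' := by rw [← permSnoc_last j τ, h, permSnoc_last]
    refine Prod.ext rfl (Equiv.ext fun i => ?_)
    have := congrArg (fun σ => σ i.castSucc) h
    simpa [permSnoc_castSucc] using this
  · simp [Fintype.card_perm, Nat.factorial_succ]

/-- Permutations of `n + 1` letters, sorted by the image of the last letter. -/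
noncomputable def permSnocEquiv (n : ℕ) :
    Fin (n + 1) × Equiv.Perm (Fin n) ≃ Equiv.Perm (Fin (n + 1)) :=
  Equiv.ofBijective _ (permSnoc_bijective n)

theorem permSnocEquiv_apply {n : ℕ} (p : Fin (n + 1) × Equiv.Perm (Fin n)) :
    permSnocEquiv n p = permSnoc p.1 p.2 := rfl

theorem prod_Iio_castSucc {n : ℕ} (u : Fin (n + 1) → ℂ) (j : Fin n) :
    ∏ i ∈ Finset.Iio j.castSucc, u i = ∏ i ∈ Finset.Iio j, u i.castSucc := by
  rw [← Fin.map_castSuccEmb_Iio, Finset.prod_map]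
  rfl

theorem prod_Iic_castSucc {n : ℕ} (u : Fin (n + 1) → ℂ) (j : Fin n) :
    ∏ i ∈ Finset.Iic j.castSucc, u i = ∏ i ∈ Finset.Iic j, u i.castSucc := by
  rw [← Fin.map_castSuccEmb_Iic, Finset.prod_map]
  rfl

theorem prod_Iio_last {n : ℕ} (u : Fin (n + 1) → ℂ) :
    ∏ i ∈ Finset.Iio (Fin.last n), u i = ∏ i : Fin n, u i.castSucc := by
  have : Finset.Iio (Fin.last n) = Finset.univ.map Fin.castSuccEmb := by
    ext i
    refine Fin.lastCases ?_ (fun i => ?_) i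
    · simp
    · simp
  rw [this, Finset.prod_map]
  rfl

/-- The numerator `-g(1 / ∏ z_i) f_{n+1,k}(z)` in the recursion for `f_{n+1,k}`. -/
noncomputable def thetaRec (n k : ℕ) (q : ℂ) (z : Fin (n + 1) → ℂ) : ℂ :=
  ∑ j, thetaF n k q (fun i => z (j.succAbove i)) *
    thetaG q ((∏ i, (z (j.succAbove i))⁻¹) * z j ^ k)

/-- The expression `thetaRec` as a sum over all permutations. -/
theorem thetaRec_eq_sum_perm (n k : ℕ) (q : ℂ) (z : Fin (n + 1) → ℂ) :
    thetaRec n k q z = (-1) ^ n * ∑ σ : Equiv.Perm (Fin (n + 1)),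
      (∏ j, thetaG q ((∏ i ∈ Finset.Iio j, (z (σ i))⁻¹) * z (σ j) ^ k)) /
        ∏ j : Fin n, thetaG q (∏ i ∈ Finset.Iic j.castSucc, (z (σ i))⁻¹) := by
  rw [← (permSnocEquiv n).sum_comp, Fintype.sum_prod_type, Finset.mul_sum, thetaRec]
  refine Finset.sum_congr rfl fun j _ => ?_
  rw [thetaF, mul_assoc, Finset.sum_mul]
  congr 1
  refine Finset.sum_congr rfl fun τ _ => ?_
  rw [permSnocEquiv_apply, Fin.prod_univ_castSucc]
  simp only [prod_Iio_castSucc, prod_Iic_castSucc, prod_Iio_last, permSnoc_castSucc,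
    permSnoc_last, Finset.prod_div_distrib]
  rw [Equiv.prod_comp τ fun i => (z (j.succAbove i))⁻¹]
  ring

theorem thetaF_succ (n k : ℕ) (q : ℂ) (z : Fin (n + 1) → ℂ) :
    thetaF (n + 1) k q z = -thetaRec n k q z / thetaG q (∏ i, (z i)⁻¹) := by
  rw [thetaRec_eq_sum_perm, thetaF, pow_succ, neg_div, mul_div_assoc, Finset.sum_div, mul_assoc,
    neg_one_mul, mul_neg]
  congr 2
  refine Finset.sum_congr rfl fun σ _ => ?_
  rw [Finset.prod_div_distrib, Fin.prod_univ_castSucc (f := fun j => thetaG q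
    (∏ i ∈ Finset.Iic j, (z (σ i))⁻¹)), ← div_div]
  have : Finset.Iic (Fin.last n) = Finset.univ := by
    ext i
    simp [Fin.le_last]
  rw [this, Equiv.prod_comp σ fun i => (z i)⁻¹]

/-- Partial products of a cyclic sequence. -/
noncomputable def cycProd {n : ℕ} (u : Fin (n + 1) → ℂ) (m : ℕ) : ℂ :=
  ∏ i ∈ Finset.range m, u (Fin.ofNat (n + 1) i)

theorem cycProd_eq_Iio {n : ℕ} (u : Fin (n + 1) → ℂ) (j : Fin (n + 1)) :
    ∏ i ∈ Finset.Iio j, u i = cycProd u j := by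
  refine Finset.prod_nbij' (fun i => (i : ℕ)) (fun i => Fin.ofNat (n + 1) i) ?_ ?_ ?_ ?_ ?_
  · intro i hi
    simpa using hi
  · intro i hi
    have hi : i < j := by simpa using hi
    rw [Finset.mem_Iio, Fin.lt_def, Fin.val_ofNat, Nat.mod_eq_of_lt (by omega)]
    exact hi
  · intro i _
    simp
  · intro i hi
    have hi : i < j := by simpa using hi
    simp only [Fin.val_ofNat]
    exact Nat.mod_eq_of_lt (by omega)
  · intro i _
    simp

theorem cycProd_eq_Iic {n : ℕ} (u : Fin (n + 1) → ℂ) (j : Fin (n + 1)) :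
    ∏ i ∈ Finset.Iic j, u i = cycProd u (j + 1) := by
  have : Finset.Iic j = insert j (Finset.Iio j) := by
    ext i
    simp [le_iff_eq_or_lt]
  rw [this, Finset.prod_insert (by simp), cycProd_eq_Iio, cycProd, cycProd, Finset.prod_range_succ,
    mul_comm]
  congr 2
  simp

theorem cycProd_ne_zero {n : ℕ} {u : Fin (n + 1) → ℂ} (hu : ∀ i, u i ≠ 0) (m : ℕ) :
    cycProd u m ≠ 0 :=
  Finset.prod_ne_zero_iff.2 fun _ _ => hu _

theorem cycProd_add {n : ℕ} (u : Fin (n + 1) → ℂ) (s : Fin (n + 1)) (m : ℕ) :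
    cycProd u (s + m) = cycProd u s * cycProd (fun i => u (i + s)) m := by
  rw [cycProd, Finset.prod_range_add, cycProd, cycProd]
  congr 1
  refine Finset.prod_congr rfl fun i _ => ?_
  congr 1
  ext
  simp [Fin.val_add, add_comm]

theorem cycProd_period {n : ℕ} {u : Fin (n + 1) → ℂ} (hu : ∏ i, u i = 1) (m : ℕ) :
    cycProd u (m + (n + 1)) = cycProd u m := by
  induction m with
  | zero =>
    have : cycProd u (0 + (n + 1)) = ∏ i, u i := by
      have h := cycProd_eq_Iic u (Fin.last n)
      rw [Fin.val_last] at h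
      rw [zero_add, ← h]
      congr 1
      ext i
      simp [Fin.le_last]
    rw [this, hu, cycProd, Finset.range_zero, Finset.prod_empty]
  | succ m ih =>
    have h1 : cycProd u (m + 1 + (n + 1)) =
        cycProd u (m + (n + 1)) * u (Fin.ofNat (n + 1) (m + (n + 1))) := by
      rw [cycProd, show m + 1 + (n + 1) = m + (n + 1) + 1 by ring, Finset.prod_range_succ]
      rfl
    have h2 : cycProd u (m + 1) = cycProd u m * u (Fin.ofNat (n + 1) m) :=
      Finset.prod_range_succ _ _
    rw [h1, h2, ih]
    congr 2
    ext
    simp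

theorem cycProd_mod {n : ℕ} {u : Fin (n + 1) → ℂ} (hu : ∏ i, u i = 1) (m : ℕ) :
    cycProd u (m % (n + 1)) = cycProd u m := by
  conv_rhs => rw [← Nat.mod_add_div m (n + 1)]
  generalize m / (n + 1) = d
  induction d with
  | zero => simp
  | succ d ih => rw [Nat.mul_succ, ← add_assoc, cycProd_period hu, ih]

/-- The cyclic sum over the rotations of a sequence with product `1` is a sum of residues. -/
theorem sum_rotations_eq_zero {q : ℂ} (hq : ‖q‖ < 1) (hq0 : q ≠ 0) {n : ℕ} (k : ℕ)
    (u : Fin (n + 1) → ℂ) (hu : ∀ i, u i ≠ 0) (hu1 : ∏ i, u i = 1)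
    (hne : ∀ S : Finset (Fin (n + 1)), S.Nonempty → S ≠ Finset.univ →
      thetaG q (∏ i ∈ S, (u i)⁻¹) ≠ 0) :
    ∑ s : Fin (n + 1),
      (∏ j, thetaG q ((∏ i ∈ Finset.Iio j, (u (i + s))⁻¹) * u (j + s) ^ k)) /
        ∏ j : Fin n, thetaG q (∏ i ∈ Finset.Iic j.castSucc, (u (i + s))⁻¹) = 0 := by
  set a : Fin (n + 1) → ℂ := fun j => (cycProd u j)⁻¹ * u j ^ k with ha
  set w : Fin (n + 1) → ℂ := fun j => (cycProd u (j + 1))⁻¹ with hw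
  have hw0 : ∀ j, w j ≠ 0 := fun j => inv_ne_zero (cycProd_ne_zero hu _)
  have hpshift : ∏ j : Fin (n + 1), cycProd u (j + 1) = ∏ j : Fin (n + 1), cycProd u j := by
    rw [Fin.prod_univ_castSucc, Fin.prod_univ_succ (fun j : Fin (n + 1) => cycProd u j)]
    simp only [Fin.val_castSucc, Fin.val_last, Fin.val_zero, Fin.val_succ]
    rw [← zero_add (n + 1), cycProd_period hu1, mul_comm]
  have hprod : ∏ j, a j = ∏ j, w j := by
    simp only [ha, hw, Finset.prod_mul_distrib, Finset.prod_inv_distrib, Finset.prod_pow, hu1,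
      one_pow, mul_one, hpshift]
  have hwne : ∀ i j, i ≠ j → thetaG q (w i / w j) ≠ 0 := by
    have hsplit : ∀ i j : Fin (n + 1), i < j → ∏ l ∈ Finset.Ioc i j, (u l)⁻¹ = w j / w i := by
      intro i j hij
      have h1 : Finset.Iic j = Finset.Iic i ∪ Finset.Ioc i j := by
        ext l
        simp only [Finset.mem_Iic, Finset.mem_union, Finset.mem_Ioc]
        omega
      have hd : Disjoint (Finset.Iic i) (Finset.Ioc i j) := by
        rw [Finset.disjoint_left]
        intro l
        simp only [Finset.mem_Iic, Finset.mem_Ioc]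
        omega
      have h2 := cycProd_eq_Iic (fun l => (u l)) j
      rw [h1, Finset.prod_union hd, cycProd_eq_Iic] at h2
      rw [hw, Finset.prod_inv_distrib]
      simp only
      rw [← h2]
      have := cycProd_ne_zero hu (i + 1)
      have : ∏ l ∈ Finset.Ioc i j, u l ≠ 0 := Finset.prod_ne_zero_iff.2 fun l _ => hu l
      field_simp
    intro i j hij
    rcases lt_or_gt_of_ne hij with h | h
    · have e : w i / w j = ∏ l ∈ (Finset.Ioc i j)ᶜ, (u l)⁻¹ := by
        have h1 := Finset.prod_mul_prod_compl (Finset.Ioc i j) fun l => (u l)⁻¹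
        rw [hsplit i j h, Finset.prod_inv_distrib (s := Finset.univ), hu1, inv_one] at h1
        have := hw0 i
        have := hw0 j
        rw [div_mul_eq_mul_div, div_eq_one_iff_eq (hw0 i)] at h1
        rw [← h1]
        field_simp
      rw [e]
      refine hne _ ⟨i, by simp⟩ fun hS => ?_
      have : j ∈ (Finset.Ioc i j)ᶜ := hS ▸ Finset.mem_univ j
      simp [h] at this
    · rw [← hsplit j i h]
      refine hne _ ⟨i, by simp [h]⟩ fun hS => ?_
      have : j ∈ Finset.Ioc j i := hS ▸ Finset.mem_univ j
      simp at this
  have key := sum_prod_thetaG_div_eq_zero hq hq0 a w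
    (fun j => mul_ne_zero (inv_ne_zero (cycProd_ne_zero hu _)) (pow_ne_zero _ (hu j)))
    hw0 hprod hwne
  rw [← (Equiv.subRight (1 : Fin (n + 1))).sum_comp] at key
  rw [← key]
  refine Finset.sum_congr rfl fun s _ => ?_
  -- the rotation by `s` corresponds to the residue at `w_r` with `r = s - 1`
  have hws : w (s - 1) = (cycProd u s)⁻¹ := by
    rw [hw]
    simp only
    rw [← cycProd_mod hu1 ((s - 1 : Fin (n + 1)) + 1 : ℕ)]
    have : (((s - 1 : Fin (n + 1)) : ℕ) + 1) % (n + 1) = ((s - 1 + 1 : Fin (n + 1)) : ℕ) := by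
      rw [Fin.val_add, Nat.add_mod, Nat.add_mod (s - 1 : Fin (n + 1)).val]
      congr 2
      rcases n with _ | n
      · simp
      · simp
    rw [this, sub_add_cancel]
  have hadd : ∀ j : Fin (n + 1), ∀ e : ℕ, cycProd u ((j + s : Fin (n + 1)) + e) =
      cycProd u (s + (j + e)) := by
    intro j e
    rw [← cycProd_mod hu1, ← cycProd_mod hu1 (s + (j + e)), Fin.val_add]
    congr 1
    rw [Nat.mod_add_mod]
    congr 1
    ring
  simp only [Equiv.subRight_apply]
  congr 1
  · rw [← Equiv.prod_comp (Equiv.addRight s) fun j => thetaG q (a j / w (s - 1))]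
    refine Finset.prod_congr rfl fun j _ => ?_
    have h0 := hadd j 0
    rw [add_zero, add_zero, cycProd_add] at h0
    rw [Finset.prod_inv_distrib, cycProd_eq_Iio fun i => u (i + s), hws]
    simp only [Equiv.coe_addRight, ha, h0]
    have := cycProd_ne_zero hu s
    congr 1
    field_simp
  · rw [thetaDenom, ← Equiv.prod_comp (Equiv.addRight s), Fin.prod_univ_castSucc]
    have hlast : Fin.last n + s = s - 1 := by
      have : Fin.last n + 1 = 0 := Fin.last_add_one n
      rw [eq_sub_iff_add_eq, add_right_comm, this, zero_add]
    rw [if_pos (show Equiv.addRight s (Fin.last n) = s - 1 from hlast), mul_one]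
    refine Finset.prod_congr rfl fun j _ => ?_
    have hj : j.castSucc + s ≠ s - 1 := by
      rw [← hlast]
      intro h
      exact (Fin.castSucc_lt_last j).ne (add_right_cancel h)
    rw [if_neg (show Equiv.addRight s j.castSucc ≠ s - 1 from hj), hws, Finset.prod_inv_distrib,
      cycProd_eq_Iic fun i => u (i + s)]
    simp only [hw, Equiv.coe_addRight]
    rw [hadd, cycProd_add u s]
    have := cycProd_ne_zero hu s
    congr 1
    field_simp

/-- The sum `thetaRec` vanishes where the product of the variables is `1`: the sum over all
permutations splits into sums over rotations. -/
theorem thetaRec_eq_zero {q : ℂ} (hq : ‖q‖ < 1) (hq0 : q ≠ 0) {n : ℕ} (k : ℕ)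
    (z : Fin (n + 1) → ℂ) (hz : ∀ i, z i ≠ 0) (hz1 : ∏ i, z i = 1)
    (hne : ∀ S : Finset (Fin (n + 1)), S.Nonempty → S ≠ Finset.univ →
      thetaG q (∏ i ∈ S, (z i)⁻¹) ≠ 0) :
    thetaRec n k q z = 0 := by
  rw [thetaRec_eq_sum_perm]
  set T : Equiv.Perm (Fin (n + 1)) → ℂ := fun σ =>
      (∏ j, thetaG q ((∏ i ∈ Finset.Iio j, (z (σ i))⁻¹) * z (σ j) ^ k)) /
        ∏ j : Fin n, thetaG q (∏ i ∈ Finset.Iic j.castSucc, (z (σ i))⁻¹) with hT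
  have h1 : ∀ s : Fin (n + 1), ∑ σ, T σ = ∑ σ, T ((Equiv.addRight s).trans σ) := by
    intro s
    refine Fintype.sum_equiv (Equiv.mulRight (Equiv.addRight (-s) : Equiv.Perm (Fin (n + 1)))) _ _
      fun σ => ?_
    congr 1
    ext i
    simp
  have h2 : ∀ σ, ∑ s : Fin (n + 1), T ((Equiv.addRight s).trans σ) = 0 := by
    intro σ
    refine sum_rotations_eq_zero hq hq0 k (fun i => z (σ i)) (fun i => hz _) ?_ ?_
    · rw [Equiv.prod_comp σ z, hz1]
    · intro S hS hSu
      have := hne (S.map σ.toEmbedding) (hS.map) ?_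
      · rwa [Finset.prod_map] at this
      · intro h
        refine hSu (Finset.eq_univ_of_card S ?_)
        rw [← Finset.card_map σ.toEmbedding, h, Finset.card_univ]
  have h3 : ∑ s : Fin (n + 1), ∑ σ, T σ = 0 := by
    rw [Finset.sum_congr rfl fun s _ => h1 s, Finset.sum_comm]
    exact Finset.sum_eq_zero fun σ _ => h2 σ
  rw [Finset.sum_const, Finset.card_univ, Fintype.card_fin, nsmul_eq_mul] at h3
  rw [(mul_eq_zero.1 h3).resolve_left (Nat.cast_ne_zero.2 (Nat.succ_ne_zero n)), mul_zero]

/-! ### The functions `f_{n,k}` have no poles -/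

theorem thetaG_zero (z : ℂ) : thetaG 0 z = 1 - z := by
  rw [thetaG, tsum_eq_sum (s := {0, 1})]
  · simp
    ring
  · intro n hn
    have h : 0 < n * (n - 1) / 2 := by
      have := tri_pos (n := n) (by simpa using fun h => hn (by simp [h]))
        (by simpa using fun h => hn (by simp [h]))
      exact this
    rw [zero_zpow _ h.ne', mul_zero]

/-- The theta function does not vanish on the circles `‖z‖ = t ^ m`, `m ≠ 0`, that are closer to
the unit circle than the other circles containing zeros. -/
theorem thetaG_ne_zero_of_norm_eq_zpow {q z : ℂ} {t : ℝ} {n : ℕ} {m : ℤ} (ht : 1 < t)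
    (htq : t ^ n * ‖q‖ < 1) (hm : m ≠ 0) (hmn : |m| ≤ n) (hz : ‖z‖ = t ^ m) : thetaG q z ≠ 0 := by
  have ht0 : 0 < t := one_pos.trans ht
  have hq : ‖q‖ < 1 := by
    refine lt_of_le_of_lt ?_ htq
    exact le_mul_of_one_le_left (norm_nonneg q) (one_le_pow₀ ht.le)
  rcases eq_or_ne q 0 with rfl | hq0
  · rw [thetaG_zero]
    intro h
    rw [← sub_eq_zero.1 h, norm_one] at hz
    exact hm (zpow_right_injective₀ ht0 ht.ne' (by simp [← hz]))
  have hr0 : 0 < ‖q‖ := norm_pos_iff.2 hq0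
  have hmn' := abs_le.1 hmn
  rcases lt_or_gt_of_ne hm with h | h
  · refine thetaG_ne_zero hq hq0 (s := 0) ?_ ?_
    · rw [hz, zero_add, zpow_one]
      have h1 : t ^ (-(n : ℤ)) ≤ t ^ m := zpow_le_zpow_right₀ ht.le hmn'.1
      refine lt_of_lt_of_le ?_ h1
      rw [zpow_neg, zpow_natCast, lt_inv_comm₀ hr0 (pow_pos ht0 n),
        lt_inv_comm₀ (pow_pos ht0 n) hr0, ← one_div, lt_div_iff₀ (pow_pos ht0 n), mul_comm]
      exact htq
    · rw [hz, zpow_zero]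
      exact zpow_lt_one_of_neg₀ ht h
  · refine thetaG_ne_zero hq hq0 (s := -1) ?_ ?_
    · rw [hz, neg_add_cancel, zpow_zero]
      exact one_lt_zpow₀ ht h
    · rw [hz, zpow_neg_one]
      have h1 : t ^ m ≤ t ^ (n : ℤ) := zpow_le_zpow_right₀ ht.le hmn'.2
      refine lt_of_le_of_lt h1 ?_
      rw [zpow_natCast, ← one_div, lt_div_iff₀ hr0]
      exact htq

theorem exists_radius {q : ℂ} (hq : ‖q‖ < 1) (n : ℕ) : ∃ t : ℝ, 1 < t ∧ t ^ n * ‖q‖ < 1 := by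
  have hc : ContinuousAt (fun t : ℝ => t ^ n * ‖q‖) 1 := by fun_prop
  have h1 : ∀ᶠ t in 𝓝 (1 : ℝ), t ^ n * ‖q‖ < 1 :=
    hc.eventually_lt continuousAt_const (by simpa using hq)
  obtain ⟨t, ht, ht1⟩ := ((h1.filter_mono nhdsWithin_le_nhds).and
    (self_mem_nhdsWithin (s := Set.Ioi (1 : ℝ)))).exists
  exact ⟨t, ht1, ht⟩

/-- The denominators do not vanish on a torus whose radii are equal and slightly above `1`. -/
theorem denomNeZero_of_norm_eq {q : ℂ} {t : ℝ} {n : ℕ} (ht : 1 < t) (htq : t ^ n * ‖q‖ < 1)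
    {z : Fin n → ℂ} (hz : ∀ i, ‖z i‖ = t) : DenomNeZero n q z := by
  intro S hS
  refine thetaG_ne_zero_of_norm_eq_zpow ht htq (m := -(S.card : ℤ)) ?_ ?_ ?_
  · have := hS.card_pos
    omega
  · rw [abs_neg, Nat.abs_cast]
    exact_mod_cast (Finset.card_le_univ S).trans_eq (Fintype.card_fin n)
  · simp [norm_prod, hz]

theorem DenomNeZero.succAbove {q : ℂ} {n : ℕ} {z : Fin (n + 1) → ℂ}
    (h : ∀ S : Finset (Fin (n + 1)), S.Nonempty → S ≠ Finset.univ →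
      thetaG q (∏ i ∈ S, (z i)⁻¹) ≠ 0) (j : Fin (n + 1)) :
    DenomNeZero n q fun i => z (j.succAbove i) := by
  intro S hS
  have := h (S.map (Fin.succAboveEmb j)) hS.map fun hu => ?_
  · rwa [Finset.prod_map] at this
  · have hj : j ∈ S.map (Fin.succAboveEmb j) := hu ▸ Finset.mem_univ j
    obtain ⟨i, _, hi⟩ := Finset.mem_map.1 hj
    exact Fin.succAbove_ne j i hi

/-- The numerator of the recursion with `f_{n,k}` replaced by `E`. -/
noncomputable def recNum (n k : ℕ) (q : ℂ) (E : (Fin n → ℂ) → ℂ) (z : Fin (n + 1) → ℂ) : ℂ :=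
  ∑ j, E (fun i => z (j.succAbove i)) * thetaG q ((∏ i, (z (j.succAbove i))⁻¹) * z j ^ k)

theorem recNum_eq_thetaRec {n k : ℕ} {q : ℂ} {E : (Fin n → ℂ) → ℂ}
    (hE : ∀ z : Fin n → ℂ, (∀ i, z i ≠ 0) → DenomNeZero n q z → E z = thetaF n k q z)
    {z : Fin (n + 1) → ℂ} (hz : ∀ i, z i ≠ 0)
    (h : ∀ S : Finset (Fin (n + 1)), S.Nonempty → S ≠ Finset.univ →
      thetaG q (∏ i ∈ S, (z i)⁻¹) ≠ 0) : recNum n k q E z = thetaRec n k q z :=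
  Finset.sum_congr rfl fun j _ => by
    rw [hE _ (fun i => hz _) (DenomNeZero.succAbove h j)]

theorem mono_eq_prod_succAbove {n k : ℕ} (j : Fin (n + 1)) (z : Fin (n + 1) → ℂ) :
    mono (fun i => if i = j then (k : ℤ) else -1) z =
      (∏ i, (z (j.succAbove i))⁻¹) * z j ^ k := by
  rw [mono, Fin.prod_univ_succAbove _ j, mul_comm]
  simp [Fin.succAbove_ne]

theorem EntireLaurent.comp_mono' {ι κ : Type*} [Fintype ι] [Fintype κ] {f : (κ → ℂ) → ℂ}
    (hf : EntireLaurent f) (δ : κ → ι → ℤ) :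
    EntireLaurent fun z : ι → ℂ => f fun j => mono (δ j) z := by
  simpa using hf.comp_mono (fun _ => 1) (fun _ => one_ne_zero) δ

theorem EntireLaurent.comp_proj {ι κ : Type*} [Fintype ι] [Fintype κ] {f : (κ → ℂ) → ℂ}
    (hf : EntireLaurent f) (e : κ → ι) : EntireLaurent fun z : ι → ℂ => f fun j => z (e j) := by
  classical
  simpa [mono_single] using hf.comp_mono' fun j => Pi.single (e j) 1

theorem EntireLaurent.comp_mul {ι : Type*} [Fintype ι] {f : (ι → ℂ) → ℂ}
    (hf : EntireLaurent f) {s : ι → ℂ} (hs : ∀ i, s i ≠ 0) :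
    EntireLaurent fun z : ι → ℂ => f fun j => s j * z j := by
  classical
  simpa [mono_single] using hf.comp_mono s hs fun j => Pi.single j 1

theorem EntireLaurent.recNum {n : ℕ} (k : ℕ) {q : ℂ} (hq : ‖q‖ < 1) {E : (Fin n → ℂ) → ℂ}
    (hE : EntireLaurent E) : EntireLaurent (recNum n k q E) := by
  refine EntireLaurent.sum _ fun j => ?_
  refine (hE.comp_proj j.succAbove).mul ?_
  have := EntireLaurent.thetaG_mono hq fun i => if i = j then (k : ℤ) else -1
  simpa only [mono_eq_prod_succAbove] using this

theorem prod_zpow_eq_zpow_sum {ι K : Type*} [Field K] {t : K} (ht : t ≠ 0) (s : Finset ι)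
    (e : ι → ℤ) : ∏ i ∈ s, t ^ e i = t ^ ∑ i ∈ s, e i := by
  classical
  induction s using Finset.induction_on with
  | empty => simp
  | insert a s ha ih => rw [Finset.prod_insert ha, Finset.sum_insert ha, ih, zpow_add₀ ht]

/-- The numerator of the recursion vanishes where the product of the variables is `1`. -/
theorem recNum_eq_zero {n k : ℕ} {q : ℂ} (hq : ‖q‖ < 1) (hq0 : q ≠ 0) {E : (Fin n → ℂ) → ℂ}
    (hEL : EntireLaurent E)
    (hE : ∀ z : Fin n → ℂ, (∀ i, z i ≠ 0) → DenomNeZero n q z → E z = thetaF n k q z)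
    {z : Fin (n + 1) → ℂ} (hz : ∀ i, z i ≠ 0) (hz1 : ∏ i, z i = 1) :
    recNum n k q E z = 0 := by
  classical
  obtain ⟨t, ht, htq⟩ := exists_radius hq n
  have ht0 : 0 < t := one_pos.trans ht
  -- the points with product `1` are parametrized by the last `n` coordinates
  set δ : Fin (n + 1) → Fin n → ℤ := Fin.cons (fun _ => -1) fun i => Pi.single i 1 with hδ
  have hδz : ∀ w : Fin n → ℂ, (fun j => mono (δ j) w) =
      (Fin.cons (∏ i, (w i)⁻¹) w : Fin (n + 1) → ℂ) := by
    intro w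
    funext j
    refine Fin.cases ?_ (fun j => ?_) j
    · simp [hδ, mono]
    · simp [hδ, mono_single]
  have hFL := (hEL.recNum k hq).comp_mono' δ
  have h0 : EntireLaurent fun _ : Fin n → ℂ => (0 : ℂ) := by
    simpa using EntireLaurent.const_mul_mono (ι := Fin n) 0 0
  have key := hFL.eq_of_torus h0 (r := fun _ => t) (fun _ => ht0) (fun w hw => ?_)
    (z := fun i => z i.succ) fun i => hz _
  · simp only [hδz] at key
    convert key
    refine (Fin.cons_self_tail z).symm.trans ?_
    congr 1
    rw [Fin.prod_univ_succ] at hz1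
    rw [Finset.prod_inv_distrib]
    exact eq_inv_of_mul_eq_one_left hz1
  simp only [hδz]
  set u : Fin (n + 1) → ℂ := Fin.cons (∏ i, (w i)⁻¹) w with hu
  have hw0 : ∀ i, w i ≠ 0 := fun i => norm_pos_iff.1 ((hw i).symm ▸ ht0)
  have hu0 : ∀ i, u i ≠ 0 := by
    intro i
    refine Fin.cases ?_ (fun i => ?_) i
    · simpa [hu] using Finset.prod_ne_zero_iff.2 fun i _ => hw0 i
    · simpa [hu] using hw0 i
  have hu1 : ∏ i, u i = 1 := by
    rw [Fin.prod_univ_succ]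
    simp only [hu, Fin.cons_zero, Fin.cons_succ, Finset.prod_inv_distrib]
    exact inv_mul_cancel₀ (Finset.prod_ne_zero_iff.2 fun i _ => hw0 i)
  have hun : ∀ i, ‖u i‖ = t ^ (if i = 0 then -(n : ℤ) else 1) := by
    intro i
    refine Fin.cases ?_ (fun i => ?_) i
    · simp [hu, hw]
    · simp [hu, hw]
  have hne : ∀ S : Finset (Fin (n + 1)), S.Nonempty → S ≠ Finset.univ →
      thetaG q (∏ i ∈ S, (u i)⁻¹) ≠ 0 := by
    intro S hS hSu
    have hc : S.card < n + 1 := by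
      have := Finset.card_lt_univ_of_notMem (s := S) (x := ?_) ?_
      · simpa using this
      · exact (not_forall.1 fun h => hSu (Finset.eq_univ_of_forall h)).choose
      · exact (not_forall.1 fun h => hSu (Finset.eq_univ_of_forall h)).choose_spec
    have hpos := hS.card_pos
    have hnorm : ‖∏ i ∈ S, (u i)⁻¹‖ =
        t ^ (∑ i ∈ S, -(if i = 0 then -(n : ℤ) else 1)) := by
      rw [norm_prod, Finset.prod_congr rfl fun i _ => by rw [norm_inv, hun, ← zpow_neg]]
      exact (prod_zpow_eq_zpow_sum ht0.ne' S _)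
    have hsum : ∑ i ∈ S, -(if i = 0 then -(n : ℤ) else 1) =
        (if (0 : Fin (n + 1)) ∈ S then (n : ℤ) + 1 else 0) - S.card := by
      have : ∀ i : Fin (n + 1), -(if i = 0 then -(n : ℤ) else 1) =
          (if i = 0 then (n : ℤ) + 1 else 0) - 1 := by
        intro i
        split_ifs <;> ring
      simp only [this, Finset.sum_sub_distrib, Finset.sum_ite_eq']
      simp
    rw [hsum] at hnorm
    refine thetaG_ne_zero_of_norm_eq_zpow ht htq ?_ ?_ hnorm
    · split_ifs <;> omega
    · rw [abs_le]
      split_ifs <;> constructor <;> omega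
  rw [recNum_eq_thetaRec hE hu0 hne]
  exact thetaRec_eq_zero hq hq0 k u hu0 hu1 hne

/-- The constant in the quasi-periodicity of `f_{n,k}`. -/
noncomputable def quasiConst (k : ℕ) (q : ℂ) : ℂ := (-1) ^ (k + 1) * q ^ (1 - tri k)

/-- Quasi-periodicity of `f_{n,k}` in each variable. -/
def QuasiPeriodic (n k : ℕ) (q : ℂ) (E : (Fin n → ℂ) → ℂ) : Prop :=
  ∀ i : Fin n, ∀ z : Fin n → ℂ, (∀ i, z i ≠ 0) →
    E (Function.update z i (q * z i)) =
      quasiConst k q * z i ^ (-((k : ℤ) * (k + 1))) * (∏ i, z i) ^ (k + 1) * E z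

theorem update_mul_ne_zero {n : ℕ} {q : ℂ} (hq0 : q ≠ 0) {z : Fin n → ℂ} (hz : ∀ i, z i ≠ 0)
    (i j : Fin n) : Function.update z i (q * z i) j ≠ 0 := by
  rcases eq_or_ne j i with rfl | h
  · simpa using ⟨hq0, hz j⟩
  · simpa [h] using hz j

theorem prod_update_mul {n : ℕ} (q : ℂ) (z : Fin n → ℂ) (i : Fin n) :
    ∏ j, Function.update z i (q * z i) j = q * ∏ j, z j := by
  rw [Finset.prod_update_of_mem (Finset.mem_univ i), mul_assoc,
    ← Finset.mul_prod_erase _ _ (Finset.mem_univ i), Finset.sdiff_singleton_eq_erase]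

theorem recNum_update {n k : ℕ} {q : ℂ} (hq : ‖q‖ < 1) (hq0 : q ≠ 0) {E : (Fin n → ℂ) → ℂ}
    (hE : QuasiPeriodic n k q E) (i : Fin (n + 1)) {z : Fin (n + 1) → ℂ} (hz : ∀ i, z i ≠ 0) :
    recNum n k q E (Function.update z i (q * z i)) =
      -quasiConst k q * q⁻¹ * z i ^ (-((k : ℤ) * (k + 1))) * (∏ i, z i) ^ k *
        recNum n k q E z := by
  rw [recNum, recNum, Finset.mul_sum]
  refine Finset.sum_congr rfl fun j _ => ?_
  have hP : ∏ i, z i = z j * ∏ i, z (j.succAbove i) := Fin.prod_univ_succAbove _ j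
  have hP0 : ∏ i, z (j.succAbove i) ≠ 0 := Finset.prod_ne_zero_iff.2 fun i _ => hz _
  have ha0 : (∏ i, (z (j.succAbove i))⁻¹) * z j ^ k ≠ 0 :=
    mul_ne_zero (Finset.prod_ne_zero_iff.2 fun i _ => inv_ne_zero (hz _)) (pow_ne_zero _ (hz j))
  have hzj := hz j
  rcases eq_or_ne i j with rfl | hij
  · have h1 : ∀ l, Function.update z i (q * z i) (i.succAbove l) = z (i.succAbove l) := fun l =>
      Function.update_of_ne (Fin.succAbove_ne i l) _ _
    simp only [h1, Function.update_self]
    rw [show (∏ l, (z (i.succAbove l))⁻¹) * (q * z i) ^ k =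
      q ^ (k : ℤ) * ((∏ l, (z (i.succAbove l))⁻¹) * z i ^ k) by rw [zpow_natCast]; ring,
      thetaG_zpow_mul hq hq0 ha0, hP, Finset.prod_inv_distrib, quasiConst]
    have e1 : q ^ (1 - tri k) = q * q ^ (-tri k) := by
      rw [sub_eq_add_neg, zpow_add₀ hq0, zpow_one]
    have e2 : z i ^ (-((k : ℤ) * (k + 1))) = (z i ^ (k * k) * z i ^ k)⁻¹ := by
      rw [zpow_neg, ← pow_add, ← zpow_natCast]
      congr 2
    rw [e1, e2, zpow_neg _ (k : ℤ), zpow_natCast, zpow_natCast]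
    generalize q ^ (-tri k) = Q
    generalize thetaG q _ = G
    generalize E _ = X
    simp only [mul_pow, ← pow_mul, inv_pow]
    field_simp
    ring
  · obtain ⟨l, rfl⟩ := Fin.exists_succAbove_eq hij
    have h1 : (fun i => Function.update z (j.succAbove l) (q * z (j.succAbove l)) (j.succAbove i)) =
        Function.update (fun i => z (j.succAbove i)) l (q * z (j.succAbove l)) :=
      Function.update_comp_eq_of_injective z Fin.succAbove_right_injective l _
    have h2 : ∏ i, (Function.update z (j.succAbove l) (q * z (j.succAbove l)) (j.succAbove i))⁻¹ =
        q⁻¹ * ∏ i, (z (j.succAbove i))⁻¹ := by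
      rw [Finset.prod_inv_distrib, Finset.prod_inv_distrib, ← mul_inv]
      congr 1
      rw [← prod_update_mul q (fun i => z (j.succAbove i)) l]
      exact Finset.prod_congr rfl fun i _ => congrFun h1 i
    rw [h1, h2, Function.update_of_ne (Fin.succAbove_ne j l).symm, mul_assoc q⁻¹,
      thetaG_q_mul_inv hq hq0 ha0, hE l _ fun i => hz _, hP, Finset.prod_inv_distrib]
    generalize thetaG q _ = G
    generalize E _ = X
    generalize z (j.succAbove l) ^ _ = Y
    generalize quasiConst k q = C
    simp only [mul_pow, pow_succ]
    field_simp

theorem update_mul_eq {n : ℕ} (q : ℂ) (z : Fin n → ℂ) (i : Fin n) :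
    Function.update z i (q * z i) = fun j => (if j = i then q else 1) * z j := by
  funext j
  rcases eq_or_ne j i with rfl | h
  · simp
  · simp [h]

/-- For `q ≠ 0` the function `f_{n,k}` extends to an entire Laurent function, which is
quasi-periodic. -/
theorem exists_entireLaurent_eq_thetaF (k : ℕ) {q : ℂ} (hq : ‖q‖ < 1) (hq0 : q ≠ 0) (n : ℕ) :
    ∃ E : (Fin n → ℂ) → ℂ, EntireLaurent E ∧
      (∀ z : Fin n → ℂ, (∀ i, z i ≠ 0) → DenomNeZero n q z → E z = thetaF n k q z) ∧
      QuasiPeriodic n k q E := by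
  induction n with
  | zero =>
    refine ⟨fun _ => 1,
      (EntireLaurent.const_mul_mono (ι := Fin 0) 1 0).congr fun z _ => by simp [mono],
      fun z _ _ => ?_, fun i => i.elim0⟩
    simp [thetaF]
  | succ n ih =>
    obtain ⟨E, hEL, hE, hEq⟩ := ih
    have hup : ∀ (z : Fin (n + 1) → ℂ), (∀ i, z i ≠ 0) →
        (recNum n k q E (Function.update z 0 (q * z 0)) = 0 ↔ recNum n k q E z = 0) := by
      intro z hz
      rw [recNum_update hq hq0 hEq 0 hz, mul_eq_zero]
      refine or_iff_right ?_
      have : ∏ i, z i ≠ 0 := Finset.prod_ne_zero_iff.2 fun i _ => hz i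
      refine mul_ne_zero (mul_ne_zero (mul_ne_zero (neg_ne_zero.2 ?_) (inv_ne_zero hq0))
        (zpow_ne_zero _ (hz 0))) (pow_ne_zero _ this)
      exact mul_ne_zero (pow_ne_zero _ (by norm_num)) (zpow_ne_zero _ hq0)
    have hvan : ∀ m : ℤ, ∀ z : Fin (n + 1) → ℂ, (∀ i, z i ≠ 0) → ∏ i, z i = q ^ m →
        recNum n k q E z = 0 := by
      intro m
      induction m using Int.induction_on with
      | zero =>
        intro z hz hzm
        exact recNum_eq_zero hq hq0 hEL hE hz (by simpa using hzm)
      | succ m ihm =>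
        intro z hz hzm
        set w := Function.update z 0 (q⁻¹ * z 0) with hw
        have hw0 : ∀ i, w i ≠ 0 := update_mul_ne_zero (inv_ne_zero hq0) hz 0
        have hzw : z = Function.update w 0 (q * w 0) := by
          simp [hw, hq0]
        rw [hzw, hup w hw0]
        refine ihm w hw0 ?_
        rw [hw, prod_update_mul, hzm, zpow_add_one₀ hq0]
        field_simp
      | pred m ihm =>
        intro z hz hzm
        rw [← hup z hz]
        refine ihm _ (update_mul_ne_zero hq0 hz 0) ?_
        rw [prod_update_mul, hzm, zpow_sub_one₀ hq0]
        field_simp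
    obtain ⟨G, hGL, hG⟩ := (hEL.recNum k hq).exists_mul_thetaG_eq hq hq0 fun z hz m => hvan m z hz
    have hG' : ∀ z : Fin (n + 1) → ℂ, (∀ i, z i ≠ 0) →
        (G z * ∏ i, z i) * thetaG q (∏ i, (z i)⁻¹) = -recNum n k q E z := by
      intro z hz
      have : ∏ i, z i ≠ 0 := Finset.prod_ne_zero_iff.2 fun i _ => hz i
      rw [Finset.prod_inv_distrib, thetaG_inv hq this, ← hG z hz]
      field_simp
    have hL : EntireLaurent fun z : Fin (n + 1) → ℂ => G z * ∏ i, z i := by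
      refine hGL.mul ?_
      simpa [mono] using EntireLaurent.const_mul_mono (ι := Fin (n + 1)) 1 1
    refine ⟨fun z => G z * ∏ i, z i, hL, fun z hz hd => ?_, fun i z hz => ?_⟩
    · rw [thetaF_succ, eq_div_iff (hd Finset.univ Finset.univ_nonempty), hG' z hz,
        recNum_eq_thetaRec hE hz fun S hS _ => hd S hS]
    · -- both sides are entire Laurent functions, so it suffices to compare them on a torus
      obtain ⟨t, ht, htq⟩ := exists_radius hq (n + 1)
      have hs : ∀ j, (if j = i then q else 1) ≠ 0 := fun j => by split_ifs <;> simp [hq0]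
      have h1 := hL.comp_mul hs
      have h2 : EntireLaurent fun z : Fin (n + 1) → ℂ =>
          quasiConst k q * z i ^ (-((k : ℤ) * (k + 1))) * (∏ i, z i) ^ (k + 1) *
            (G z * ∏ i, z i) := by
        refine EntireLaurent.mul ?_ hL
        have := (EntireLaurent.const_mul_mono (ι := Fin (n + 1)) (quasiConst k q)
          (Pi.single i (-((k : ℤ) * (k + 1))))).mul
          (EntireLaurent.const_mul_mono (ι := Fin (n + 1)) 1 fun _ => ((k + 1 : ℕ) : ℤ))
        refine this.congr fun z _ => ?_
        rw [mono_single, one_mul, mono]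
        simp only [zpow_natCast, Finset.prod_pow]
      have := h1.eq_of_torus h2 (r := fun _ => t) (fun _ => one_pos.trans ht) (fun w hw => ?_) hz
      · rw [update_mul_eq]
        exact this
      · have hw0 : ∀ i, w i ≠ 0 := fun i => norm_pos_iff.1 ((hw i).symm ▸ one_pos.trans ht)
        have hP : ∏ i, w i ≠ 0 := Finset.prod_ne_zero_iff.2 fun i _ => hw0 i
        have hd := denomNeZero_of_norm_eq ht htq hw Finset.univ Finset.univ_nonempty
        have hd' : thetaG q (∏ i, w i)⁻¹ ≠ 0 := by simpa [Finset.prod_inv_distrib] using hd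
        have e1 := hG' _ (update_mul_ne_zero hq0 hw0 i)
        have e2 := hG' w hw0
        rw [recNum_update hq hq0 hEq i hw0, Finset.prod_inv_distrib, prod_update_mul, mul_inv,
          thetaG_q_mul_inv hq hq0 (inv_ne_zero hP)] at e1
        rw [← update_mul_eq]
        refine mul_right_cancel₀ hd' ?_
        rw [Finset.prod_inv_distrib] at e2
        rw [mul_assoc _ (G w * _), e2, prod_update_mul]
        have e3 := congrArg (fun x => -(q * ∏ i, w i) * x) e1
        simp only at e3
        rw [pow_succ]
        calc _ = -(q * ∏ i, w i) * (G (Function.update w i (q * w i)) * (q * ∏ i, w i) *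
            (-(q⁻¹ * (∏ i, w i)⁻¹) * thetaG q (∏ i, w i)⁻¹)) := by field_simp
          _ = _ := by
            rw [e3]
            generalize recNum n k q E w = R
            generalize w i ^ _ = Y
            field_simp

/-! ### The coefficients of `f_{k,k}` -/

theorem laurent_coeff_unique {ι : Type*} [Fintype ι] {c d : (ι → ℤ) → ℂ} {f : (ι → ℂ) → ℂ}
    {r : ι → ℝ} (hr : ∀ i, 0 < r i)
    (hc : ∀ z : ι → ℂ, (∀ i, ‖z i‖ = r i) → HasSum (fun γ => c γ * mono γ z) (f z))
    (hd : ∀ z : ι → ℂ, (∀ i, ‖z i‖ = r i) → HasSum (fun γ => d γ * mono γ z) (f z)) (γ : ι → ℤ) :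
    c γ = d γ := by
  refine sub_eq_zero.1 (laurent_coeff_eq_zero (c := fun γ => c γ - d γ) hr (fun z hz => ?_) γ)
  have := (hc z hz).sub (hd z hz)
  rw [sub_self] at this
  exact this.of_forall_eq fun γ => by ring

theorem ne_zero_of_norm_eq {ι : Type*} {t : ℝ} (ht : 0 < t) {z : ι → ℂ} (hz : ∀ i, ‖z i‖ = t)
    (i : ι) : z i ≠ 0 :=
  norm_pos_iff.1 ((hz i).symm ▸ ht)

theorem thetaF_comp_perm (n k : ℕ) (q : ℂ) (z : Fin n → ℂ) (τ : Equiv.Perm (Fin n)) :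
    thetaF n k q (z ∘ τ) = thetaF n k q z := by
  rw [thetaF, thetaF]
  congr 1
  exact Fintype.sum_equiv (Equiv.mulLeft τ) _ _ fun σ => rfl

theorem mono_comp_perm {n : ℕ} (γ : Fin n → ℤ) (σ : Equiv.Perm (Fin n)) (z : Fin n → ℂ) :
    mono (γ ∘ σ.symm) z = ∏ j, z (σ j) ^ γ j := by
  rw [mono, ← Equiv.prod_comp σ]
  simp

/-- Applying the quasi-periodicity to all the variables in turn shows that `f_{k,k}` is homogeneous
under multiplication of the variables by `q`. -/
theorem QuasiPeriodic.apply_mul {k : ℕ} {q : ℂ} (hq0 : q ≠ 0) {E : (Fin k → ℂ) → ℂ}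
    (hE : QuasiPeriodic k k q E) {z : Fin k → ℂ} (hz : ∀ i, z i ≠ 0) :
    E (fun i => q * z i) = q ^ tri (k + 1) * E z := by
  classical
  have key : ∀ S : Finset (Fin k), E (fun i => if i ∈ S then q * z i else z i) =
      quasiConst k q ^ S.card * (∏ i ∈ S, z i) ^ (-((k : ℤ) * (k + 1))) *
        (∏ i, z i) ^ ((k + 1) * S.card) * q ^ ((k + 1) * tri S.card) * E z := by
    intro S
    induction S using Finset.induction_on with
    | empty => simp [tri_zero]
    | insert a S ha ih =>
      set w : Fin k → ℂ := fun i => if i ∈ S then q * z i else z i with hw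
      have hw0 : ∀ i, w i ≠ 0 := fun i => by
        simp only [hw]
        split_ifs
        exacts [mul_ne_zero hq0 (hz i), hz i]
      have hwa : w a = z a := by simp [hw, ha]
      have h1 : (fun i => if i ∈ insert a S then q * z i else z i) =
          Function.update w a (q * w a) := by
        funext i
        rcases eq_or_ne i a with rfl | h
        · simp [hwa]
        · simp [hw, h]
      have h2 : ∏ i, w i = q ^ S.card * ∏ i, z i := by
        have : ∀ i, w i = (if i ∈ S then q else 1) * z i := fun i => by
          simp only [hw]
          split_ifs <;> simp
        simp only [this, Finset.prod_mul_distrib, Finset.prod_ite_mem, Finset.univ_inter,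
          Finset.prod_const]
      rw [h1, hE a w hw0, ih, h2, hwa, Finset.card_insert_of_notMem ha, Finset.prod_insert ha,
        mul_zpow, Nat.cast_add, Nat.cast_one, tri_succ, mul_add (k + 1 : ℤ), zpow_add₀ hq0]
      have h3 : q ^ (((k : ℤ) + 1) * (S.card : ℤ)) = (q ^ S.card) ^ (k + 1) := by
        rw [← pow_mul, ← zpow_natCast]
        congr 1
        push_cast
        ring
      rw [h3]
      ring
  have h := key Finset.univ
  simp only [Finset.mem_univ, if_true, Finset.card_univ, Fintype.card_fin] at h
  have hP : ∏ i, z i ≠ 0 := Finset.prod_ne_zero_iff.2 fun i _ => hz i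
  have h4 : (∏ i, z i) ^ (-((k : ℤ) * (k + 1))) * (∏ i, z i) ^ ((k + 1) * k) = 1 := by
    rw [← zpow_natCast, ← zpow_add₀ hP]
    push_cast
    ring_nf
    simp
  have h5 : quasiConst k q ^ k * q ^ ((k + 1) * tri k) = q ^ tri (k + 1) := by
    have : Even ((k + 1) * k) := by
      rw [mul_comm]
      exact Nat.even_mul_succ_self k
    rw [quasiConst, mul_pow, ← pow_mul, this.neg_one_pow, one_mul, ← zpow_natCast, ← zpow_mul,
      ← zpow_add₀ hq0, tri_succ]
    congr 1
    ring
  rw [h, mul_assoc (_ ^ k), h4, ← h5]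
  ring

theorem sum_fun_add_one {k : ℕ} (α : Fin k → ℤ) : ∑ j, (α j + 1) = ∑ j, α j + k := by
  simp [Finset.sum_add_distrib]

theorem card_monotone_comp_perm {k : ℕ} (γ : Fin k → ℤ) (τ : Equiv.Perm (Fin k)) :
    Nat.card {σ : Equiv.Perm (Fin k) // Monotone ((γ ∘ τ) ∘ σ)} =
      Nat.card {σ : Equiv.Perm (Fin k) // Monotone (γ ∘ σ)} :=
  Nat.card_congr ((Equiv.mulLeft τ).subtypeEquiv fun _ => Iff.rfl)

/-- A symmetric Laurent series that is homogeneous of degree `k (k + 1) / 2` is a sum over the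
exponents in `Expo k` and permutations. Multiple occurrences of a monomial are compensated by the
number of permutations that sort it. -/
theorem exists_genTerm_of_symm {k : ℕ} {c : (Fin k → ℤ) → ℂ} {f : (Fin k → ℂ) → ℂ}
    (hc : ∀ z : Fin k → ℂ, (∀ i, z i ≠ 0) → HasSum (fun γ => c γ * mono γ z) (f z))
    (hsym : ∀ γ (σ : Equiv.Perm (Fin k)), c (γ ∘ σ) = c γ)
    (hd : ∀ γ, c γ ≠ 0 → ∑ i, γ i = tri (k + 1)) :
    ∃ a : Expo k → ℂ, ∀ z : Fin k → ℂ, (∀ i, z i ≠ 0) → HasSum (genTerm k a z) (f z) := by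
  classical
  set N : (Fin k → ℤ) → ℕ := fun γ => Nat.card {σ : Equiv.Perm (Fin k) // Monotone (γ ∘ σ)}
    with hN
  have hNpos : ∀ γ, 0 < N γ := fun γ =>
    Nat.card_pos_iff.2 ⟨⟨⟨Tuple.sort γ, Tuple.monotone_sort γ⟩⟩, inferInstance⟩
  refine ⟨fun α => c (fun i => α.1 i + 1) / N (fun i => α.1 i + 1), fun z hz => ?_⟩
  set w : (Fin k → ℤ) × Equiv.Perm (Fin k) → ℂ := fun p =>
    if Monotone (p.1 ∘ p.2) then c p.1 / N p.1 * mono p.1 z else 0 with hw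
  have hsw : Summable w := by
    have h1 : Summable fun p : (Fin k → ℤ) × Equiv.Perm (Fin k) =>
        ‖c p.1 * mono p.1 z‖ * (1 : ℝ) :=
      (hc z hz).summable.norm.mul_of_nonneg (hasSum_fintype fun _ : Equiv.Perm (Fin k) =>
        (1 : ℝ)).summable (fun _ => norm_nonneg _) fun _ => zero_le_one
    refine Summable.of_norm_bounded h1 fun p => ?_
    simp only [hw]
    split_ifs
    · rw [mul_one, norm_mul, norm_mul, norm_div]
      refine mul_le_mul_of_nonneg_right (div_le_self (norm_nonneg _) ?_) (norm_nonneg _)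
      rw [Complex.norm_natCast]
      exact_mod_cast hNpos p.1
    · simp only [norm_zero, mul_one, norm_nonneg]
  have hws : HasSum w (f z) := by
    have h1 := hsw.hasSum.prod_fiberwise fun γ => hasSum_fintype fun σ => w (γ, σ)
    refine (h1.unique ((hc z hz).of_forall_eq fun γ => ?_)) ▸ hsw.hasSum
    have h2 : (N γ : ℂ) ≠ 0 := Nat.cast_ne_zero.2 (hNpos γ).ne'
    simp only [hw]
    rw [← Finset.sum_filter, Finset.sum_const, nsmul_eq_mul, ← Fintype.card_subtype,
      ← Nat.card_eq_fintype_card]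
    change _ = (N γ : ℂ) * _
    field_simp
  set j : Expo k × Equiv.Perm (Fin k) → (Fin k → ℤ) × Equiv.Perm (Fin k) := fun p =>
    ((fun i => p.1.1 i + 1) ∘ p.2.symm, p.2) with hj
  have hji : Function.Injective j := by
    rintro ⟨α, σ⟩ ⟨β, τ⟩ h
    simp only [hj, Prod.mk.injEq] at h
    obtain ⟨h1, rfl⟩ := h
    refine Prod.ext (Subtype.ext (funext fun i => ?_)) rfl
    simpa using congrFun h1 (σ i)
  have hjr : ∀ p ∉ Set.range j, w p = 0 := by
    rintro ⟨γ, σ⟩ hp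
    simp only [hw]
    split_ifs with hm
    · by_contra hne
      have hcγ : c γ ≠ 0 := fun h => hne (by rw [h, zero_div, zero_mul])
      refine hp ⟨(⟨fun i => γ (σ i) - 1, fun a b hab => sub_le_sub_right (hm hab) 1, ?_⟩, σ), ?_⟩
      · rw [Finset.sum_sub_distrib, Equiv.sum_comp σ γ, hd γ hcγ, tri_succ]
        simp [tri]
      · simp only [hj, Prod.mk.injEq, and_true]
        funext i
        simp
    · rfl
  refine ((hji.hasSum_iff hjr).2 hws).of_forall_eq fun p => ?_
  simp only [Function.comp_apply, hw, hj, genTerm]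
  have hm : Monotone (((fun i => p.1.1 i + 1) ∘ p.2.symm) ∘ p.2) := by
    have : (((fun i => p.1.1 i + 1) ∘ p.2.symm) ∘ p.2) = fun i => p.1.1 i + 1 := by
      funext i
      simp
    rw [this]
    exact fun a b hab => add_le_add_left (p.1.2.1 hab) 1
  rw [if_pos hm, mono_comp_perm, hsym, hN]
  simp only
  rw [card_monotone_comp_perm]

/-- For `q ≠ 0` the function `f_{k,k}` has a Laurent expansion of the required form. -/
theorem exists_hasThetaGeneratingFunction_of_ne_zero (k : ℕ) {q : ℂ} (hq : ‖q‖ < 1)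
    (hq0 : q ≠ 0) : ∃ a : Expo k → ℂ, HasThetaGeneratingFunction k q a := by
  obtain ⟨E, hEL, hE, hEq⟩ := exists_entireLaurent_eq_thetaF k hq hq0 k
  obtain ⟨c, hc⟩ := hEL
  obtain ⟨t, ht, htq⟩ := exists_radius hq k
  have ht0 : 0 < t := one_pos.trans ht
  have hsym : ∀ γ (σ : Equiv.Perm (Fin k)), c (γ ∘ σ) = c γ := by
    intro γ σ
    refine laurent_coeff_unique (c := fun γ => c (γ ∘ σ)) (f := E) (r := fun _ => t)
      (fun _ => ht0) (fun z hz => ?_) (fun z hz => hc z (ne_zero_of_norm_eq ht0 hz)) γ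
    have hz' : ∀ i, ‖(z ∘ σ) i‖ = t := fun i => hz _
    have h1 := hc (z ∘ σ) (ne_zero_of_norm_eq ht0 hz')
    rw [hE _ (ne_zero_of_norm_eq ht0 hz') (denomNeZero_of_norm_eq ht htq hz'), thetaF_comp_perm,
      ← hE _ (ne_zero_of_norm_eq ht0 hz) (denomNeZero_of_norm_eq ht htq hz),
      ← (Equiv.arrowCongr σ.symm (Equiv.refl ℤ)).hasSum_iff] at h1
    refine h1.of_forall_eq fun γ => ?_
    have e : (Equiv.arrowCongr σ.symm (Equiv.refl ℤ)) γ = γ ∘ σ := by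
      funext i
      simp [Equiv.arrowCongr]
    simp only [Function.comp_apply, e]
    congr 1
    rw [mono, mono, ← Equiv.prod_comp σ fun i => z i ^ γ i]
    rfl
  have hd : ∀ γ, c γ ≠ 0 → ∑ i, γ i = tri (k + 1) := by
    intro γ hγ
    have h1 : c γ * q ^ (∑ i, γ i) = q ^ tri (k + 1) * c γ := by
      refine laurent_coeff_unique (c := fun γ => c γ * q ^ (∑ i, γ i))
        (d := fun γ => q ^ tri (k + 1) * c γ) (f := fun z => E fun i => q * z i)
        (r := fun _ => t) (fun _ => ht0) (fun z hz => ?_) (fun z hz => ?_) γ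
      · refine (hc _ fun i => mul_ne_zero hq0 (ne_zero_of_norm_eq ht0 hz i)).of_forall_eq
          fun γ => ?_
        rw [mono_mul, mul_assoc]
        congr 2
        exact prod_zpow_eq_zpow_sum hq0 Finset.univ γ
      · simp only [hEq.apply_mul hq0 (ne_zero_of_norm_eq ht0 hz)]
        exact ((hc z (ne_zero_of_norm_eq ht0 hz)).mul_left _).of_forall_eq fun γ => by ring
    have h2 : q ^ (∑ i, γ i) = q ^ tri (k + 1) := by
      rw [mul_comm] at h1
      exact mul_right_cancel₀ hγ h1
    have h3 := congrArg norm h2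
    rw [norm_zpow, norm_zpow] at h3
    exact zpow_right_injective₀ (norm_pos_iff.2 hq0) hq.ne h3
  obtain ⟨a, ha⟩ := exists_genTerm_of_symm hc hsym hd
  exact ⟨a, fun z hz => ⟨(ha z hz).summable, fun hD => (ha z hz).tsum_eq.trans (hE z hz hD)⟩⟩

/-! ### Relations between the coefficients -/

/-- Two sequences are rearrangements of each other. -/
def IsRearr {n : ℕ} (v w : Fin n → ℤ) : Prop := ∃ σ : Equiv.Perm (Fin n), v = w ∘ σ

theorem IsRearr.sum_comp {n : ℕ} {v w : Fin n → ℤ} (h : IsRearr v w) (f : ℤ → ℤ) :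
    ∑ i, f (v i) = ∑ i, f (w i) := by
  obtain ⟨σ, rfl⟩ := h
  exact Equiv.sum_comp σ fun i => f (w i)

theorem IsRearr.exists_apply_eq {n : ℕ} {v w : Fin n → ℤ} (h : IsRearr v w) (i : Fin n) :
    ∃ j, w j = v i := by
  obtain ⟨σ, rfl⟩ := h
  exact ⟨σ i, rfl⟩

/-- If the symmetrization of a sum of Laurent monomials vanishes, then the coefficients of the
monomials with the same exponents up to order sum to zero. -/
theorem hasSum_rearr_eq_zero {n : ℕ} {κ : Type*} {b : κ → ℂ} {v : κ → Fin n → ℤ} {t : ℝ}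
    (ht : 0 < t)
    (h : ∀ z : Fin n → ℂ, (∀ i, ‖z i‖ = t) → HasSum (fun p : κ × Equiv.Perm (Fin n) =>
      b p.1 * ∏ j, z (p.2 j) ^ v p.1 j) 0) (γ : Fin n → ℤ) :
    HasSum (fun p => (open Classical in if IsRearr (v p) γ then b p else 0)) 0 := by
  classical
  set e : κ × Equiv.Perm (Fin n) → Fin n → ℤ := fun p => v p.1 ∘ p.2.symm with he
  have h' : ∀ z : Fin n → ℂ, (∀ i, ‖z i‖ = t) →
      HasSum (fun p => b p.1 * mono (e p) z) 0 := fun z hz =>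
    (h z hz).of_forall_eq fun p => by rw [he, mono_comp_perm]
  have hc : ∀ γ, ∑' p : (e ⁻¹' {γ} : Set (κ × Equiv.Perm (Fin n))), b p.1.1 = 0 := by
    refine laurent_coeff_eq_zero (r := fun _ => t) (fun _ => ht) fun z hz => ?_
    refine ((h' z hz).tsum_fiberwise e).of_forall_eq fun γ => ?_
    rw [← tsum_mul_right]
    refine tsum_congr fun p => ?_
    have hp : e p.1 = γ := p.2
    rw [hp]
  have hfib : HasSum (fun p : (e ⁻¹' {γ} : Set (κ × Equiv.Perm (Fin n))) => b p.1.1) 0 := by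
    rw [← hc γ]
    refine Summable.hasSum ?_
    have hz : ∀ i : Fin n, ‖(fun _ => (t : ℂ)) i‖ = t := fun i => by simp [abs_of_pos ht]
    have h1 := (h' (fun _ => (t : ℂ)) hz).summable.subtype (e ⁻¹' {γ})
    have h2 : mono γ (fun _ => (t : ℂ)) ≠ 0 :=
      mono_ne_zero γ (z := fun _ => (t : ℂ)) fun _ => Complex.ofReal_ne_zero.2 ht.ne'
    refine ((h1.mul_right (mono γ fun _ => (t : ℂ))⁻¹)).congr fun p => ?_
    have hp : e p.1 = γ := p.2
    simp only [Function.comp_apply]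
    rw [hp, mul_inv_cancel_right₀ h2]
  have hind : HasSum (fun p => if e p = γ then b p.1 else 0) 0 := by
    have h1 := (hasSum_subtype_iff_indicator (f := fun p : κ × Equiv.Perm (Fin n) => b p.1)
      (s := e ⁻¹' {γ})).1 hfib
    refine h1.of_forall_eq fun p => ?_
    simp [Set.indicator_apply]
  have h2 := hind.prod_fiberwise fun p => hasSum_fintype fun σ => if e (p, σ) = γ then b p else 0
  set N : ℕ := Fintype.card {σ : Equiv.Perm (Fin n) // γ ∘ σ = γ} with hN
  have hN0 : (N : ℂ) ≠ 0 :=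
    Nat.cast_ne_zero.2 (Fintype.card_pos_iff.2 ⟨⟨1, rfl⟩⟩).ne'
  have h3 := h2.mul_left (N : ℂ)⁻¹
  rw [mul_zero] at h3
  refine h3.of_forall_eq fun p => ?_
  rw [← Finset.sum_filter, Finset.sum_const, nsmul_eq_mul, ← Fintype.card_subtype]
  split_ifs with hp
  · obtain ⟨τ, hτ⟩ := hp
    have : Fintype.card {σ : Equiv.Perm (Fin n) // e (p, σ) = γ} = N := by
      refine Fintype.card_congr ((Equiv.inv _).trans (Equiv.mulLeft τ) |>.subtypeEquiv fun σ => ?_)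
      simp only [he, hτ]
      rfl
    rw [this, inv_mul_cancel_left₀ hN0]
  · have : IsEmpty {σ : Equiv.Perm (Fin n) // e (p, σ) = γ} := by
      refine ⟨fun σ => hp ⟨σ.1, ?_⟩⟩
      funext i
      simp [← congrFun σ.2 (σ.1 i), he]
    simp

theorem Expo.eq_of_isRearr {k : ℕ} {α β : Expo k}
    (h : IsRearr (fun i => α.1 i + 1) fun i => β.1 i + 1) : α = β := by
  obtain ⟨σ, hσ⟩ := h
  have h1 : α.1 = β.1 ∘ σ := by
    funext i
    simpa using congrFun hσ i
  have h2 := Tuple.unique_monotone (f := β.1) (σ := σ) (τ := 1) (h1 ▸ α.2.1) (by simpa using β.2.1)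
  refine Subtype.ext (h1.trans (h2.trans ?_))
  simp

/-- The coefficients are determined by their generating function. -/
theorem HasThetaGeneratingFunction.unique {k : ℕ} {q : ℂ} (hq : ‖q‖ < 1) {a b : Expo k → ℂ}
    (ha : HasThetaGeneratingFunction k q a) (hb : HasThetaGeneratingFunction k q b) : a = b := by
  classical
  obtain ⟨t, ht, htq⟩ := exists_radius hq k
  have ht0 : 0 < t := one_pos.trans ht
  funext α
  have h := hasSum_rearr_eq_zero (b := fun α => a α - b α) (v := fun α i => α.1 i + 1) ht0
    (fun z hz => ?_) fun i => α.1 i + 1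
  · refine sub_eq_zero.1 ((hasSum_ite_eq α (a α - b α)).unique (h.of_forall_eq fun β => ?_))
    by_cases hβ : β = α
    · rw [if_pos hβ, if_pos (hβ ▸ ⟨1, rfl⟩), hβ]
    · rw [if_neg hβ, if_neg fun h => hβ (Expo.eq_of_isRearr h)]
  · obtain ⟨ha1, ha2⟩ := ha z (ne_zero_of_norm_eq ht0 hz)
    obtain ⟨hb1, hb2⟩ := hb z (ne_zero_of_norm_eq ht0 hz)
    have hD := denomNeZero_of_norm_eq ht htq hz
    have h1 := ha1.hasSum.sub hb1.hasSum
    rw [ha2 hD, hb2 hD, sub_self] at h1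
    exact h1.of_forall_eq fun p => by simp only [genTerm]; ring

theorem thetaF_const {k : ℕ} {q : ℂ} (hq : ‖q‖ < 1) {t : ℂ} (ht : t ≠ 0)
    (hD : DenomNeZero k q fun _ => t) :
    thetaF k k q (fun _ => t) = (k.factorial : ℂ) * t ^ tri (k + 1) := by
  have hne : ∀ m : ℕ, m < k → thetaG q (t ^ (m + 1)) ≠ 0 := by
    intro m hm h0
    have h1 := hD (Finset.univ.filter fun i : Fin k => (i : ℕ) < m + 1) ⟨⟨0, by omega⟩, by simp⟩
    have h2 : (Finset.univ.filter fun i : Fin k => (i : ℕ) < m + 1).card = m + 1 := by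
      rw [Fin.card_filter_val_lt]
      omega
    simp only [Finset.prod_const, h2] at h1
    rw [inv_pow, thetaG_inv hq (pow_ne_zero _ ht), h0, mul_zero] at h1
    exact h1 rfl
  have hprod : ∏ j : Fin k, thetaG q ((∏ i ∈ Finset.Iio j, t⁻¹) * t ^ k) /
      thetaG q (∏ i ∈ Finset.Iic j, t⁻¹) = (-1) ^ k * t ^ tri (k + 1) := by
    have h1 : ∀ j : Fin k, thetaG q ((∏ i ∈ Finset.Iio j, t⁻¹) * t ^ k) /
        thetaG q (∏ i ∈ Finset.Iic j, t⁻¹) =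
        thetaG q (t ^ (k - 1 - (j : ℕ) + 1)) / thetaG q (t ^ ((j : ℕ) + 1)) *
          (-t ^ ((j : ℕ) + 1)) := by
      intro j
      have hj := j.2
      rw [Finset.prod_const, Finset.prod_const, Fin.card_Iio, Fin.card_Iic, inv_pow, inv_pow,
        thetaG_inv hq (pow_ne_zero _ ht)]
      have : (t ^ (j : ℕ))⁻¹ * t ^ k = t ^ (k - 1 - (j : ℕ) + 1) := by
        rw [inv_mul_eq_iff_eq_mul₀ (pow_ne_zero _ ht), ← pow_add]
        congr 1
        omega
      rw [this]
      have := hne j hj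
      field_simp
    rw [Finset.prod_congr rfl fun j _ => h1 j, Fin.prod_univ_eq_prod_range (fun j =>
      thetaG q (t ^ (k - 1 - j + 1)) / thetaG q (t ^ (j + 1)) * (-t ^ (j + 1))) k,
      Finset.prod_mul_distrib, Finset.prod_div_distrib,
      Finset.prod_range_reflect (fun j => thetaG q (t ^ (j + 1))) k, div_self, one_mul]
    · clear hD hne h1
      induction k with
      | zero => simp [tri_one]
      | succ k ih =>
        rw [Finset.prod_range_succ, ih, Nat.cast_add, Nat.cast_one, tri_succ (k + 1 : ℤ),
          zpow_add₀ ht, show t ^ ((k : ℤ) + 1) = t ^ (k + 1) from mod_cast zpow_natCast t (k + 1)]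
        ring
    · exact Finset.prod_ne_zero_iff.2 fun j hj => hne j (Finset.mem_range.1 hj)
  rw [thetaF, Finset.sum_const, Finset.card_univ, Fintype.card_perm, Fintype.card_fin, hprod,
    nsmul_eq_mul, mul_left_comm, ← mul_assoc ((-1 : ℂ) ^ k), ← mul_pow]
  simp

/-- Evaluation of the generating function at points with equal coordinates. -/
theorem HasThetaGeneratingFunction.hasSum_one {k : ℕ} {q : ℂ} (hq : ‖q‖ < 1) {a : Expo k → ℂ}
    (ha : HasThetaGeneratingFunction k q a) : HasSum a 1 := by
  obtain ⟨t, ht, htq⟩ := exists_radius hq k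
  have ht0 : (t : ℂ) ≠ 0 := by simp [(one_pos.trans ht).ne']
  have hn : ∀ i : Fin k, ‖(fun _ => (t : ℂ)) i‖ = t := fun _ => by
    simp [abs_of_pos (one_pos.trans ht)]
  obtain ⟨h1, h2⟩ := ha _ (ne_zero_of_norm_eq (one_pos.trans ht) hn)
  have hD := denomNeZero_of_norm_eq ht htq hn
  have h3 := h1.hasSum
  rw [h2 hD, thetaF_const hq ht0 hD] at h3
  have h4 : ∀ p : Expo k × Equiv.Perm (Fin k),
      genTerm k a (fun _ => (t : ℂ)) p = a p.1 * t ^ tri (k + 1) := by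
    intro p
    rw [genTerm, prod_zpow_eq_zpow_sum ht0, sum_fun_add_one, p.1.2.2, tri_succ]
    rfl
  have h5 := (h3.of_forall_eq h4).prod_fiberwise fun α =>
    hasSum_fintype fun _ : Equiv.Perm (Fin k) => a α * t ^ tri (k + 1)
  simp only [Finset.sum_const, Finset.card_univ, Fintype.card_perm, Fintype.card_fin,
    nsmul_eq_mul] at h5
  have h6 : (k.factorial : ℂ) * t ^ tri (k + 1) ≠ 0 :=
    mul_ne_zero (Nat.cast_ne_zero.2 k.factorial_ne_zero) (zpow_ne_zero _ ht0)
  have h7 := h5.mul_left ((k.factorial : ℂ) * t ^ tri (k + 1))⁻¹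
  rw [inv_mul_cancel₀ h6] at h7
  refine h7.of_forall_eq fun α => ?_
  rw [mul_left_comm _ (a α), mul_comm (a α), inv_mul_cancel_left₀ h6]

theorem hasSum_prod_of_fintype {J X : Type*} [Fintype J] {G : J → X → ℂ} {s : J → ℂ}
    (h : ∀ j, HasSum (G j) (s j)) : HasSum (fun p : J × X => G p.1 p.2) (∑ j, s j) := by
  classical
  have h1 : ∀ j, HasSum (fun p : J × X => if p.1 = j then G j p.2 else 0) (s j) := by
    intro j
    have hinj : Function.Injective fun x : X => (j, x) := fun x y h => (Prod.mk.inj h).2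
    refine (hinj.hasSum_iff fun p hp => ?_).1 ?_
    · rw [if_neg]
      rintro rfl
      exact hp ⟨p.2, rfl⟩
    · simpa [Function.comp_def] using h j
  refine (hasSum_sum fun j (_ : j ∈ Finset.univ) => h1 j).of_forall_eq fun p => ?_
  simp

/-- The generating function as a function of the variables. -/
noncomputable def genFun (k : ℕ) (a : Expo k → ℂ) (z : Fin k → ℂ) : ℂ := ∑' p, genTerm k a z p

theorem HasThetaGeneratingFunction.hasSum {k : ℕ} {q : ℂ} {a : Expo k → ℂ}
    (ha : HasThetaGeneratingFunction k q a) {z : Fin k → ℂ} (hz : ∀ i, z i ≠ 0) :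
    HasSum (genTerm k a z) (genFun k a z) :=
  (ha z hz).1.hasSum

theorem HasThetaGeneratingFunction.entireLaurent {k : ℕ} {q : ℂ} {a : Expo k → ℂ}
    (ha : HasThetaGeneratingFunction k q a) : EntireLaurent (genFun k a) := by
  refine EntireLaurent.of_hasSum (fun p : Expo k × Equiv.Perm (Fin k) => a p.1)
    (fun p => (fun i => p.1.1 i + 1) ∘ p.2.symm) fun z hz => (ha.hasSum hz).of_forall_eq fun p => ?_
  rw [mono_comp_perm, genTerm]

theorem genFun_mul {k : ℕ} (a : Expo k → ℂ) {s : ℂ} (hs : s ≠ 0) (z : Fin k → ℂ) :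
    genFun k a (fun i => s * z i) = s ^ tri (k + 1) * genFun k a z := by
  rw [genFun, genFun, ← tsum_mul_left]
  refine tsum_congr fun p => ?_
  simp only [genTerm, mul_zpow, Finset.prod_mul_distrib]
  rw [prod_zpow_eq_zpow_sum hs, sum_fun_add_one, p.1.2.2, tri_succ, tri]
  ring

/-- By homogeneity the vanishing on the hypersurface `∏ z_i = 1` extends to all points. -/
theorem HasThetaGeneratingFunction.recNum_eq_zero {k : ℕ} {q : ℂ} (hq : ‖q‖ < 1) (hq0 : q ≠ 0)
    {a : Expo k → ℂ} (ha : HasThetaGeneratingFunction k q a) {z : Fin (k + 1) → ℂ}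
    (hz : ∀ i, z i ≠ 0) : recNum k k q (genFun k a) z = 0 := by
  have hP : ∏ i, z i ≠ 0 := Finset.prod_ne_zero_iff.2 fun i _ => hz i
  obtain ⟨s, hs⟩ := IsAlgClosed.exists_pow_nat_eq (∏ i, z i)⁻¹ (Nat.succ_pos k)
  have hs0 : s ≠ 0 := by
    rintro rfl
    rw [zero_pow (Nat.succ_ne_zero k)] at hs
    exact inv_ne_zero hP hs.symm
  have h1 : recNum k k q (genFun k a) (fun i => s * z i) =
      s ^ tri (k + 1) * recNum k k q (genFun k a) z := by
    rw [recNum, recNum, Finset.mul_sum]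
    refine Finset.sum_congr rfl fun j _ => ?_
    rw [genFun_mul a hs0, ← mul_assoc]
    congr 2
    simp only [mul_inv, Finset.prod_mul_distrib, Finset.prod_const, Finset.card_univ,
      Fintype.card_fin, mul_pow]
    generalize ∏ i, (z (j.succAbove i))⁻¹ = X
    rw [inv_pow]
    field_simp
  have h2 := _root_.recNum_eq_zero hq hq0 ha.entireLaurent (fun z hz hD => (ha z hz).2 hD)
    (z := fun i => s * z i) (fun i => mul_ne_zero hs0 (hz i)) (by
      rw [Finset.prod_mul_distrib, Finset.prod_const, Finset.card_univ, Fintype.card_fin, hs,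
        inv_mul_cancel₀ hP])
  rw [h1] at h2
  exact (mul_eq_zero.1 h2).resolve_left (zpow_ne_zero _ hs0)

/-- The exponents of the monomials in the product of `x_{kn}` and `y_{1-n}`. -/
noncomputable def syzExp {k : ℕ} (p : Expo k × ℤ) : Fin (k + 1) → ℤ :=
  Fin.snoc (fun i => p.1.1 i + 1 - p.2) (k * p.2)

/-- The relation `∑_n (-1)^n q^{n(n-1)/2} x_{kn} y_{1-n} = 0` for the elements `y_i` with
coefficients `a`, written out for the coefficients of monomials. -/
def IsSyzygetic (k : ℕ) (q : ℂ) (a : Expo k → ℂ) : Prop :=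
  ∀ γ : Fin (k + 1) → ℤ, HasSum (fun p : Expo k × ℤ =>
    (open Classical in if IsRearr (syzExp p) γ then (-1) ^ p.2 * q ^ tri p.2 * a p.1 else 0)) 0

theorem HasThetaGeneratingFunction.isSyzygetic {k : ℕ} {q : ℂ} (hq : ‖q‖ < 1) (hq0 : q ≠ 0)
    {a : Expo k → ℂ} (ha : HasThetaGeneratingFunction k q a) : IsSyzygetic k q a := by
  refine fun γ => hasSum_rearr_eq_zero (b := fun p : Expo k × ℤ => (-1) ^ p.2 * q ^ tri p.2 * a p.1)
    (v := syzExp) one_pos (fun z hz1 => ?_) γ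
  have hz := ne_zero_of_norm_eq one_pos hz1
  have h1 : ∀ j : Fin (k + 1), HasSum (fun p : (Expo k × Equiv.Perm (Fin k)) × ℤ =>
      genTerm k a (fun i => z (j.succAbove i)) p.1 *
        ((-1) ^ p.2 * ((∏ i, (z (j.succAbove i))⁻¹) * z j ^ k) ^ p.2 * q ^ tri p.2))
      (genFun k a (fun i => z (j.succAbove i)) *
        thetaG q ((∏ i, (z (j.succAbove i))⁻¹) * z j ^ k)) := by
    intro j
    have hw : (∏ i, (z (j.succAbove i))⁻¹) * z j ^ k ≠ 0 :=
      mul_ne_zero (Finset.prod_ne_zero_iff.2 fun i _ => inv_ne_zero (hz _)) (pow_ne_zero _ (hz j))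
    have hs := ha.hasSum (z := fun i => z (j.succAbove i)) fun i => hz _
    have ht := hasSum_thetaG hq hw
    have hst := HasSum.mul_prod hs ht
    exact hst.of_forall_eq fun p => rfl
  have h2 := hasSum_prod_of_fintype (G := fun j (p : (Expo k × Equiv.Perm (Fin k)) × ℤ) =>
      genTerm k a (fun i => z (j.succAbove i)) p.1 *
        ((-1) ^ p.2 * ((∏ i, (z (j.succAbove i))⁻¹) * z j ^ k) ^ p.2 * q ^ tri p.2)) h1
  have h3 := ha.recNum_eq_zero hq hq0 hz
  rw [recNum] at h3
  rw [h3] at h2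
  let e : (Expo k × ℤ) × (Fin (k + 1) × Equiv.Perm (Fin k)) ≃
      Fin (k + 1) × ((Expo k × Equiv.Perm (Fin k)) × ℤ) :=
    { toFun := fun p => (p.2.1, ((p.1.1, p.2.2), p.1.2))
      invFun := fun p => ((p.2.1.1, p.2.2), (p.1, p.2.1.2))
      left_inv := fun _ => rfl
      right_inv := fun _ => rfl }
  rw [← e.hasSum_iff] at h2
  rw [← ((Equiv.refl (Expo k × ℤ)).prodCongr (permSnocEquiv k)).hasSum_iff]
  refine h2.of_forall_eq fun p => ?_
  obtain ⟨⟨α, n⟩, j, σ⟩ := p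
  simp only [Function.comp_apply, e, Equiv.coe_fn_mk, Equiv.prodCongr_apply, Prod.map,
    Equiv.refl_apply, permSnocEquiv_apply, genTerm]
  rw [Fin.prod_univ_castSucc]
  simp only [permSnoc_castSucc, permSnoc_last, syzExp, Fin.snoc_castSucc, Fin.snoc_last]
  have h4 : ∏ i, z (j.succAbove (σ i)) ^ (α.1 i + 1 - n) =
      (∏ i, z (j.succAbove (σ i)) ^ (α.1 i + 1)) * (∏ i, (z (j.succAbove i))⁻¹) ^ n := by
    rw [← Equiv.prod_comp σ fun i => (z (j.succAbove i))⁻¹, ← Finset.prod_zpow,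
      ← Finset.prod_mul_distrib]
    refine Finset.prod_congr rfl fun i _ => ?_
    rw [sub_eq_add_neg, zpow_add₀ (hz _), inv_zpow', ]
  rw [h4, mul_zpow, ← zpow_natCast (z j), ← zpow_mul]
  ring

/-! ### The support of the coefficients -/

/-- The monomial with the given exponents as indices. -/
noncomputable def idxMon {n : ℕ} (v : Fin n → ℤ) : ℤ →₀ ℕ := ∑ j, Finsupp.single (v j) 1

theorem idxMon_apply {n : ℕ} (v : Fin n → ℤ) (x : ℤ) :
    idxMon v x = Fintype.card {j // v j = x} := by
  classical
  rw [idxMon, Finsupp.finsetSum_apply, Fintype.card_subtype, Finset.card_filter]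
  simp only [Finsupp.single_apply]

theorem isRearr_iff {n : ℕ} {v w : Fin n → ℤ} : IsRearr v w ↔ idxMon v = idxMon w := by
  constructor
  · rintro ⟨σ, rfl⟩
    exact Equiv.sum_comp σ fun j => Finsupp.single (w j) 1
  · intro h
    have h1 : ∀ x, Nonempty ({j // v j = x} ≃ {j // w j = x}) := fun x => by
      rw [← Fintype.card_eq, ← idxMon_apply, ← idxMon_apply, h]
    refine ⟨Equiv.ofFiberEquiv fun x => (h1 x).some, funext fun j => ?_⟩
    exact (Equiv.ofFiberEquiv_map (fun x => (h1 x).some) j).symm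

theorem idxMon_snoc {n : ℕ} (v : Fin n → ℤ) (x : ℤ) :
    idxMon (Fin.snoc v x : Fin (n + 1) → ℤ) = idxMon v + Finsupp.single x 1 := by
  simp [idxMon, Fin.sum_univ_castSucc]

/-- The energy of an exponent. -/
noncomputable def Expo.energy {k : ℕ} (α : Expo k) : ℤ := ∑ j, (α.1 j + 1) ^ 2

theorem two_mul_sum_expo {k : ℕ} (α : Expo k) : 2 * ∑ j, (α.1 j + 1) = k * (k + 1) := by
  have h := two_mul_tri k
  rw [sum_fun_add_one, α.2.2]
  change 2 * (tri k + k) = _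
  linarith

theorem sum_sq_syzExp {k : ℕ} (p : Expo k × ℤ) :
    ∑ i, syzExp p i ^ 2 = p.1.energy + 2 * k * (k + 1) * tri p.2 := by
  have h1 : ∑ j, (p.1.1 j + 1 - p.2) ^ 2 =
      p.1.energy - p.2 * (2 * ∑ j, (p.1.1 j + 1)) + k * p.2 ^ 2 := by
    rw [Expo.energy, Finset.mul_sum, Finset.mul_sum, ← Finset.sum_sub_distrib]
    have : (k : ℤ) * p.2 ^ 2 = ∑ _j : Fin k, p.2 ^ 2 := by simp
    rw [this, ← Finset.sum_add_distrib]
    exact Finset.sum_congr rfl fun j _ => by ring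
  have h2 := two_mul_tri p.2
  rw [Fin.sum_univ_castSucc]
  simp only [syzExp, Fin.snoc_castSucc, Fin.snoc_last]
  rw [h1, two_mul_sum_expo]
  linear_combination -(k : ℤ) * (k + 1) * h2

theorem energy_eq_of_isRearr {k : ℕ} {p : Expo k × ℤ} {γ : Fin (k + 1) → ℤ}
    (h : IsRearr (syzExp p) γ) :
    p.1.energy + 2 * k * (k + 1) * tri p.2 = ∑ i, γ i ^ 2 := by
  rw [← sum_sq_syzExp]
  exact h.sum_comp fun x => x ^ 2

theorem eq_of_isRearr_syzExp {k : ℕ} {α β : Expo k} {n : ℤ}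
    (h : IsRearr (syzExp (α, n)) (syzExp (β, n))) : α = β := by
  rw [isRearr_iff, syzExp, syzExp, idxMon_snoc, idxMon_snoc, add_left_inj, ← isRearr_iff] at h
  obtain ⟨σ, hσ⟩ := h
  refine Expo.eq_of_isRearr ⟨σ, funext fun i => ?_⟩
  have := congrFun hσ i
  simp only [Function.comp_apply] at this ⊢
  linarith

/-- If only one term contributes to the coefficient of a monomial in the relation, then that term
vanishes. -/
theorem IsSyzygetic.eq_zero {k : ℕ} {q : ℂ} {a : Expo k → ℂ} (ha : IsSyzygetic k q a) {α : Expo k}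
    (h : ∀ p : Expo k × ℤ, IsRearr (syzExp p) (syzExp (α, 0)) → a p.1 ≠ 0 → p.2 = 0) :
    a α = 0 := by
  classical
  refine (hasSum_ite_eq ((α, 0) : Expo k × ℤ) (a α)).unique
    ((ha (syzExp (α, 0))).of_forall_eq fun p => ?_)
  by_cases hp : p = (α, 0)
  · rw [if_pos hp, if_pos (hp ▸ ⟨1, rfl⟩), hp]
    simp [tri_zero]
  · rw [if_neg hp]
    split_ifs with hr
    · by_cases hap : a p.1 = 0
      · rw [hap, mul_zero]
      · have h0 := h p hr hap
        obtain ⟨β, n⟩ := p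
        simp only at h0
        subst h0
        exact absurd (by rw [eq_of_isRearr_syzExp hr]) hp
    · rfl

/-- The exponent `(0, 1, …, k - 1)`. -/
def Expo.rho (k : ℕ) : Expo k :=
  ⟨fun i => i, fun a b h => Int.ofNat_le.2 h, by
    have h : ∀ n : ℕ, ∑ i ∈ Finset.range n, (i : ℤ) = tri n := by
      intro n
      induction n with
      | zero => simp [tri_zero]
      | succ n ih => rw [Finset.sum_range_succ, ih, Nat.cast_add, Nat.cast_one, tri_succ]
    rw [Fin.sum_univ_eq_sum_range fun i => (i : ℤ)]
    exact h k⟩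

/-- If `α` has minimal energy, then the cancelling term in the relation comes from an exponent that
is obtained by increasing all the entries by one and replacing `k` by `0`. -/
theorem IsSyzygetic.exists_next {k : ℕ} {q : ℂ} {a : Expo k → ℂ} (hk : 0 < k)
    (ha : IsSyzygetic k q a) {α : Expo k} (hα : a α ≠ 0)
    (hmin : ∀ β, a β ≠ 0 → α.energy ≤ β.energy) :
    ∃ β, a β ≠ 0 ∧ (∀ δ, a δ ≠ 0 → β.energy ≤ δ.energy) ∧
      IsRearr (syzExp (β, 1)) (syzExp (α, 0)) := by
  by_contra! hno
  refine hα (ha.eq_zero fun p hp hap => ?_)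
  have he := energy_eq_of_isRearr hp
  rw [sum_sq_syzExp] at he
  have hm := hmin _ hap
  simp only [tri_zero, mul_zero, add_zero] at he
  by_contra hp0
  have hk' : (0 : ℤ) < 2 * k * (k + 1) := by positivity
  rcases eq_or_ne p.2 1 with h1 | h1
  · obtain ⟨β, n⟩ := p
    simp only at h1
    subst h1
    simp only [tri_one, mul_zero, add_zero] at he
    exact hno β hap (fun δ hδ => he ▸ hmin δ hδ) hp
  · have := mul_pos hk' (tri_pos hp0 h1)
    omega

theorem IsSyzygetic.exists_apply_eq {k : ℕ} {q : ℂ} {a : Expo k → ℂ} (hk : 0 < k)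
    (ha : IsSyzygetic k q a) (m : ℕ) (hm : m < k) {α : Expo k} (hα : a α ≠ 0)
    (hmin : ∀ β, a β ≠ 0 → α.energy ≤ β.energy) : ∃ j, α.1 j = k - 1 - m := by
  induction m generalizing α with
  | zero =>
    obtain ⟨β, -, -, hr⟩ := ha.exists_next hk hα hmin
    obtain ⟨j, hj⟩ := hr.exists_apply_eq (Fin.last k)
    revert hj
    refine Fin.lastCases (fun hj => ?_) (fun j hj => ⟨j, ?_⟩) j
    · simp [syzExp] at hj
      omega
    · simp [syzExp] at hj
      push_cast
      omega
  | succ m ih =>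
    obtain ⟨β, hβ, hβmin, hr⟩ := ha.exists_next hk hα hmin
    obtain ⟨i, hi⟩ := ih (by omega) hβ hβmin
    obtain ⟨j, hj⟩ := hr.exists_apply_eq i.castSucc
    revert hj
    refine Fin.lastCases (fun hj => ?_) (fun j hj => ⟨j, ?_⟩) j
    · simp [syzExp] at hj
      omega
    · simp [syzExp] at hj
      push_cast
      omega

theorem Expo.eq_rho {k : ℕ} {α : Expo k} (h : ∀ m : ℕ, m < k → ∃ j, α.1 j = k - 1 - m) :
    α = Expo.rho k := by
  have h' : ∀ i : Fin k, ∃ j, α.1 j = i := by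
    intro i
    obtain ⟨j, hj⟩ := h (k - 1 - i) (by omega)
    exact ⟨j, by omega⟩
  choose f hf using h'
  have hfi : Function.Injective f := fun i j hij => by
    have := (hf i).symm.trans ((congrArg α.1 hij).trans (hf j))
    exact Fin.ext (by exact_mod_cast this)
  refine (Expo.eq_of_isRearr ⟨Equiv.ofBijective f (Finite.injective_iff_bijective.1 hfi),
    funext fun i => ?_⟩).symm
  simp [hf, Expo.rho]

theorem Expo.energy_nonneg {k : ℕ} (α : Expo k) : 0 ≤ α.energy :=
  Finset.sum_nonneg fun _ _ => sq_nonneg _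

/-- A nonzero solution of the relation has its unique term of minimal energy at
`(0, 1, …, k - 1)`. -/
theorem IsSyzygetic.rho_ne_zero {k : ℕ} {q : ℂ} {a : Expo k → ℂ} (hk : 0 < k)
    (ha : IsSyzygetic k q a) {α : Expo k} (hα : a α ≠ 0) :
    a (Expo.rho k) ≠ 0 ∧ (α ≠ Expo.rho k → (Expo.rho k).energy < α.energy) := by
  have hmin : ∀ δ : Expo k, a δ ≠ 0 → (∀ β, a β ≠ 0 → δ.energy ≤ β.energy) → δ = Expo.rho k :=
    fun δ hδ hm => Expo.eq_rho fun m hmk => ha.exists_apply_eq hk m hmk hδ hm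
  obtain ⟨δ, hδ, hδm⟩ : ∃ δ, a δ ≠ 0 ∧ ∀ β, a β ≠ 0 → δ.energy ≤ β.energy := by
    have hne : {α | a α ≠ 0}.Nonempty := ⟨α, hα⟩
    refine ⟨Function.argminOn (fun β : Expo k => β.energy.toNat) {α | a α ≠ 0} hne,
      Function.argminOn_mem _ _ hne, fun β hβ => ?_⟩
    have := Function.argminOn_le (fun β : Expo k => β.energy.toNat) {α | a α ≠ 0} hβ
    have h1 := Expo.energy_nonneg β
    have h2 := Expo.energy_nonneg
      (Function.argminOn (fun β : Expo k => β.energy.toNat) {α | a α ≠ 0} hne)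
    omega
  obtain rfl := hmin δ hδ hδm
  refine ⟨hδ, fun hne => lt_of_le_of_ne (hδm α hα) fun he => hne (hmin α hα fun β hβ => ?_)⟩
  rw [← he]
  exact hδm β hβ

/-- Every monomial of `y_0` has an index that is at least `k - 1`. -/
theorem IsSyzygetic.exists_le {k : ℕ} {q : ℂ} {a : Expo k → ℂ} (hk : 0 < k)
    (ha : IsSyzygetic k q a) {α : Expo k} (hα : a α ≠ 0) : ∃ j, (k : ℤ) - 1 ≤ α.1 j := by
  induction hn : α.energy.toNat using Nat.strong_induction_on generalizing α with
  | _ n ih =>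
    by_contra! hlt
    have hbd : ∀ i, syzExp (α, 0) i ≤ k - 1 := by
      intro i
      refine Fin.lastCases ?_ (fun i => ?_) i
      · simp [syzExp]
        omega
      · have := hlt i
        simp [syzExp]
        omega
    refine hα (ha.eq_zero fun p hp hap => ?_)
    have hbd' : ∀ i, syzExp p i ≤ k - 1 := by
      intro i
      obtain ⟨j, hj⟩ := hp.exists_apply_eq i
      exact hj ▸ hbd j
    have h1 := hbd' (Fin.last k)
    simp only [syzExp, Fin.snoc_last] at h1
    have h2 : p.2 ≤ 0 := by
      by_contra! h
      nlinarith
    by_contra h0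
    have he := energy_eq_of_isRearr hp
    rw [sum_sq_syzExp] at he
    simp only [tri_zero, mul_zero, add_zero] at he
    have h3 : (0 : ℤ) < 2 * k * (k + 1) * tri p.2 :=
      mul_pos (by positivity) (tri_pos h0 (by omega))
    have h4 := Expo.energy_nonneg p.1
    obtain ⟨j, hj⟩ := ih _ (by omega) hap rfl
    have h5 := hbd' j.castSucc
    simp only [syzExp, Fin.snoc_castSucc] at h5
    omega

/-! ### Dependence on `q` -/

/-- In one relation only exponents with congruent energies meet, and every nonzero solution has the
exponent `(0, 1, …, k - 1)` in its support; hence all energies in the support are congruent. -/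
theorem IsSyzygetic.dvd_energy_sub {k : ℕ} {q : ℂ} {a : Expo k → ℂ} (hk : 0 < k)
    (ha : IsSyzygetic k q a) {α : Expo k} (hα : a α ≠ 0) :
    (2 * k * (k + 1) : ℤ) ∣ α.energy - (Expo.rho k).energy := by
  classical
  set D : ℤ := 2 * k * (k + 1) with hD
  -- the energies in a relation are congruent, so the exponents in the other classes form a
  -- solution without a term at `(0, 1, …, k - 1)`
  have hb : IsSyzygetic k q fun α => if D ∣ α.energy - (Expo.rho k).energy then 0 else a α := by
    intro γ
    have hdvd : ∀ p : Expo k × ℤ, IsRearr (syzExp p) γ → (D ∣ p.1.energy - (Expo.rho k).energy ↔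
        D ∣ ∑ i, γ i ^ 2 - (Expo.rho k).energy) := by
      intro p hp
      rw [← energy_eq_of_isRearr hp, add_sub_right_comm]
      exact (dvd_add_left (Dvd.intro _ rfl)).symm
    by_cases hγ : D ∣ ∑ i, γ i ^ 2 - (Expo.rho k).energy
    · refine hasSum_zero.of_forall_eq fun p => ?_
      by_cases hp : IsRearr (syzExp p) γ
      · simp only [if_pos hp, if_pos ((hdvd p hp).2 hγ), mul_zero]
      · rw [if_neg hp]
    · refine (ha γ).of_forall_eq fun p => ?_
      by_cases hp : IsRearr (syzExp p) γ
      · simp only [if_pos hp, if_neg fun h => hγ ((hdvd p hp).1 h)]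
      · rw [if_neg hp, if_neg hp]
  by_contra h
  refine (hb.rho_ne_zero hk (α := α) ?_).1 ?_
  · simpa [h] using hα
  · simp

/-- Replacing `q` by `s q` multiplies a coefficient of a solution by a power of `s` that depends on
the energy of its exponent. -/
theorem IsSyzygetic.scale {k : ℕ} {q s : ℂ} {a : Expo k → ℂ} (hk : 0 < k) (hs : s ≠ 0)
    (ha : IsSyzygetic k q a) : IsSyzygetic k (s * q) fun α =>
      a α * s ^ ((α.energy - (Expo.rho k).energy) / (2 * k * (k + 1) : ℤ)) := by
  classical
  intro γ
  have hD : (2 * k * (k + 1) : ℤ) ≠ 0 := by positivity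
  have h := (ha γ).mul_right (s ^ ((∑ i, γ i ^ 2 - (Expo.rho k).energy) / (2 * k * (k + 1) : ℤ)))
  rw [zero_mul] at h
  refine h.of_forall_eq fun p => ?_
  split_ifs with hp
  · rw [← energy_eq_of_isRearr hp, add_sub_right_comm, Int.add_mul_ediv_left _ _ hD, zpow_add₀ hs,
      mul_zpow]
    ring
  · rw [zero_mul]

/-- Any two solutions of the relation are proportional. -/
theorem IsSyzygetic.mul_eq_mul {k : ℕ} {q : ℂ} {a b : Expo k → ℂ} (hk : 0 < k)
    (ha : IsSyzygetic k q a) (hb : IsSyzygetic k q b) (α : Expo k) :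
    a (Expo.rho k) * b α = b (Expo.rho k) * a α := by
  classical
  have hc : IsSyzygetic k q fun α => a (Expo.rho k) * b α - b (Expo.rho k) * a α := by
    intro γ
    have h := ((hb γ).mul_left (a (Expo.rho k))).sub ((ha γ).mul_left (b (Expo.rho k)))
    rw [mul_zero, mul_zero, sub_zero] at h
    refine h.of_forall_eq fun p => ?_
    split_ifs <;> ring
  by_contra h
  refine (hc.rho_ne_zero hk (sub_ne_zero.2 h)).1 ?_
  ring

theorem HasThetaGeneratingFunction.rho_ne_zero {k : ℕ} {q : ℂ} (hk : 0 < k) (hq : ‖q‖ < 1)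
    (hq0 : q ≠ 0) {a : Expo k → ℂ} (ha : HasThetaGeneratingFunction k q a) :
    a (Expo.rho k) ≠ 0 := by
  obtain ⟨α, hα⟩ : ∃ α, a α ≠ 0 := by
    by_contra! h
    exact one_ne_zero ((ha.hasSum_one hq).unique (hasSum_zero.of_forall_eq fun α => (h α).symm))
  exact ((ha.isSyzygetic hq hq0).rho_ne_zero hk hα).1

/-- The power of `q` in the coefficient `a_α(q)`. For every `α` with a nonzero coefficient the
difference of the energies is a nonnegative multiple of `2k(k + 1)`, so that nothing is rounded or
truncated. -/
noncomputable def Expo.level {k : ℕ} (α : Expo k) : ℕ :=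
  ((α.energy - (Expo.rho k).energy) / (2 * k * (k + 1) : ℤ)).toNat

theorem Expo.level_rho (k : ℕ) : (Expo.rho k).level = 0 := by
  simp [Expo.level]

/-- Up to a common factor the coefficients `a_α(q)` are constant multiples of powers of `q`. The
common factor is determined by `∑_α a_α(q) = 1`. -/
theorem exists_coeff_eq {k : ℕ} (hk : 0 < k) : ∃ c : Expo k → ℂ, c (Expo.rho k) ≠ 0 ∧
    (∀ α, c α ≠ 0 → α ≠ Expo.rho k → α.level ≠ 0) ∧
    ∀ q : ℂ, ‖q‖ < 1 → q ≠ 0 → ∀ a : Expo k → ℂ, HasThetaGeneratingFunction k q a →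
      ∃ s : ℂ, s ≠ 0 ∧ HasSum (fun α => c α * q ^ α.level) s ∧
        ∀ α, a α = c α * q ^ α.level / s := by
  have h2 : ‖(2⁻¹ : ℂ)‖ < 1 := by norm_num
  obtain ⟨b, hb⟩ := exists_hasThetaGeneratingFunction_of_ne_zero k h2 (by norm_num)
  have hbs := hb.isSyzygetic h2 (by norm_num)
  have hb0 := hb.rho_ne_zero hk h2 (by norm_num)
  have hD : (0 : ℤ) < 2 * k * (k + 1) := by positivity
  refine ⟨fun α => b α * 2 ^ α.level, mul_ne_zero hb0 (by simp), fun α hα hαρ => ?_,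
    fun q hq hq0 a ha => ?_⟩
  · have hbα := left_ne_zero_of_mul hα
    have h1 := (hbs.rho_ne_zero hk hbα).2 hαρ
    obtain ⟨m, hm⟩ := hbs.dvd_energy_sub hk hbα
    rw [Expo.level, hm, Int.mul_ediv_cancel_left _ hD.ne']
    have : 0 < m := by
      by_contra! h
      nlinarith
    omega
  · have hsc := hbs.scale hk (s := 2 * q) (mul_ne_zero two_ne_zero hq0)
    rw [show 2 * q * 2⁻¹ = q by ring] at hsc
    have hc : ∀ α, b α * (2 * q) ^ ((α.energy - (Expo.rho k).energy) / (2 * k * (k + 1) : ℤ)) =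
        b α * 2 ^ α.level * q ^ α.level := by
      intro α
      by_cases hbα : b α = 0
      · rw [hbα]
        ring
      · have h1 : 0 ≤ (α.energy - (Expo.rho k).energy) / (2 * k * (k + 1) : ℤ) := by
          refine Int.ediv_nonneg ?_ hD.le
          by_cases h : α = Expo.rho k
          · rw [h, sub_self]
          · exact sub_nonneg.2 ((hbs.rho_ne_zero hk hbα).2 h).le
        rw [mul_assoc (b α), ← mul_pow, Expo.level, ← zpow_natCast, Int.toNat_of_nonneg h1]
    simp only [hc] at hsc
    have hprop := (ha.isSyzygetic hq hq0).mul_eq_mul hk hsc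
    simp only [Expo.level_rho, pow_zero, mul_one] at hprop ⊢
    have ha0 := ha.rho_ne_zero hk hq hq0
    refine ⟨b (Expo.rho k) / a (Expo.rho k), div_ne_zero hb0 ha0, ?_, fun α => ?_⟩
    · have := (ha.hasSum_one hq).mul_left (b (Expo.rho k) / a (Expo.rho k))
      rw [mul_one] at this
      refine this.of_forall_eq fun α => ?_
      rw [div_mul_eq_mul_div, ← hprop α]
      field_simp
    · rw [eq_div_iff (div_ne_zero hb0 ha0), mul_div_assoc', div_eq_iff ha0, mul_comm (a α),
        ← hprop α]
      ring

theorem eventually_norm_lt {r : ℝ} (hr : 0 < r) : ∀ᶠ q : ℂ in 𝓝 0, ‖q‖ < r := by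
  filter_upwards [Metric.ball_mem_nhds 0 hr] with q hq
  simpa using hq

theorem tendsto_thetaG_zero {z : ℂ} (hz : z ≠ 0) :
    Tendsto (fun q => thetaG q z) (𝓝 0) (𝓝 (thetaG 0 z)) := by
  refine tendsto_tsum_of_dominated_convergence
    (bound := fun n : ℤ => (1 / 2 : ℝ) ^ tri n * ‖z‖ ^ n)
    (summable_tri (by norm_num) (by norm_num) (norm_pos_iff.2 hz)) (fun n => ?_) ?_
  · refine Tendsto.mul tendsto_const_nhds ?_
    exact (continuousAt_zpow₀ (0 : ℂ) _ (Or.inr (tri_nonneg n))).tendsto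
  · filter_upwards [eventually_norm_lt (by norm_num : (0 : ℝ) < 1 / 2)] with q hq n
    rw [norm_mul, norm_mul, norm_zpow, norm_zpow, norm_zpow, norm_neg, norm_one, one_zpow, one_mul,
      mul_comm]
    refine mul_le_mul_of_nonneg_right ?_ (zpow_nonneg (norm_nonneg z) n)
    obtain ⟨m, hm⟩ := Int.eq_ofNat_of_zero_le (tri_nonneg n)
    change ‖q‖ ^ tri n ≤ _
    rw [hm, zpow_natCast, zpow_natCast]
    exact pow_le_pow_left₀ (norm_nonneg q) hq.le m

/-- The coefficients at `q = 0`: only `x_i x_{i+1} ⋯ x_{i+k-1}` occurs in `y_i`. -/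
noncomputable def coeffZero (k : ℕ) : Expo k → ℂ :=
  open Classical in fun α => if α = Expo.rho k then 1 else 0

theorem summable_genTerm_coeffZero (k : ℕ) (z : Fin k → ℂ) :
    Summable (genTerm k (coeffZero k) z) := by
  refine summable_of_hasFiniteSupport ((Set.Finite.prod (Set.finite_singleton (Expo.rho k))
    (Set.toFinite Set.univ)).subset fun p hp => ?_)
  simp only [Set.mem_prod, Set.mem_singleton_iff, Set.mem_univ, and_true]
  by_contra h
  exact hp (by simp [genTerm, coeffZero, h])

theorem tendsto_thetaF_zero {k : ℕ} {z : Fin k → ℂ} (hz : ∀ i, z i ≠ 0) (hD : DenomNeZero k 0 z) :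
    Tendsto (fun q => thetaF k k q z) (𝓝 0) (𝓝 (thetaF k k 0 z)) := by
  refine Tendsto.mul tendsto_const_nhds (tendsto_finsetSum _ fun σ _ =>
    tendsto_finsetProd _ fun j _ => ?_)
  refine Tendsto.div (tendsto_thetaG_zero (mul_ne_zero ?_ (pow_ne_zero _ (hz _))))
    (tendsto_thetaG_zero ?_) ?_
  · exact Finset.prod_ne_zero_iff.2 fun i _ => inv_ne_zero (hz _)
  · exact Finset.prod_ne_zero_iff.2 fun i _ => inv_ne_zero (hz _)
  · have := hD ((Finset.Iic j).map σ.toEmbedding) (Finset.Nonempty.map ⟨j, by simp⟩)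
    rwa [Finset.prod_map] at this

theorem eventually_denomNeZero {k : ℕ} {z : Fin k → ℂ} (hz : ∀ i, z i ≠ 0)
    (hD : DenomNeZero k 0 z) : ∀ᶠ q in 𝓝 (0 : ℂ), DenomNeZero k q z := by
  have : ∀ S : Finset (Fin k), ∀ᶠ q in 𝓝 (0 : ℂ), S.Nonempty →
      thetaG q (∏ i ∈ S, (z i)⁻¹) ≠ 0 := by
    intro S
    by_cases hS : S.Nonempty
    · filter_upwards [(tendsto_thetaG_zero (Finset.prod_ne_zero_iff.2 fun i (_ : i ∈ S) =>
        inv_ne_zero (hz i))).eventually_ne (hD S hS)] with q hq _ using hq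
    · exact Eventually.of_forall fun q h => absurd h hS
  filter_upwards [eventually_all.2 this] with q hq S hS using hq S hS

/-- A series `∑ c_p q^{e_p}` that converges absolutely for some positive `q` is
continuous at `q = 0`. -/
theorem tendsto_tsum_mul_pow_zero {κ : Type*} {c : κ → ℂ} {e : κ → ℕ} {r : ℝ} (hr0 : 0 < r)
    (hr : Summable fun p => ‖c p‖ * r ^ e p) :
    Tendsto (fun q : ℂ => ∑' p, c p * q ^ e p) (𝓝 0) (𝓝 (∑' p, c p * 0 ^ e p)) := by
  refine tendsto_tsum_of_dominated_convergence hr (fun p => ?_) ?_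
  · exact Tendsto.mul tendsto_const_nhds ((continuous_pow (e p)).tendsto 0)
  · filter_upwards [eventually_norm_lt hr0] with q hq p
    rw [norm_mul, norm_pow]
    exact mul_le_mul_of_nonneg_left (pow_le_pow_left₀ (norm_nonneg q) hq.le _) (norm_nonneg _)

/-- At `q = 0` the generating function is the monomial symmetric function of `(1, …, k)`; this is
the limit of the expansions for `q ≠ 0`. -/
theorem hasThetaGeneratingFunction_coeffZero {k : ℕ} (hk : 0 < k) :
    HasThetaGeneratingFunction k 0 (coeffZero k) := by
  refine fun z hz => ⟨summable_genTerm_coeffZero k z, fun hD => ?_⟩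
  obtain ⟨c, hc0, hc, H⟩ := exists_coeff_eq hk
  have h2 : ‖(2⁻¹ : ℂ)‖ < 1 := by norm_num
  obtain ⟨b, hb⟩ := exists_hasThetaGeneratingFunction_of_ne_zero k h2 (by norm_num)
  obtain ⟨s, hs0, hs, hbs⟩ := H _ h2 (by norm_num) b hb
  have hn2 : ‖(2⁻¹ : ℂ)‖ = 2⁻¹ := by norm_num
  have hcs : Summable fun α => ‖c α‖ * (2⁻¹ : ℝ) ^ α.level :=
    hs.summable.norm.congr fun α => by rw [norm_mul, norm_pow, hn2]
  set C : Expo k × Equiv.Perm (Fin k) → ℂ := fun p =>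
    c p.1 * ∏ j, z (p.2 j) ^ (p.1.1 j + 1) with hC
  have hCs : Summable fun p => ‖C p‖ * (2⁻¹ : ℝ) ^ p.1.level := by
    refine (((hb z hz).1.mul_left s).norm).congr fun p => ?_
    rw [genTerm, hbs, ← hn2, ← norm_pow, ← norm_mul, hC]
    congr 1
    field_simp
  have hzero : ∀ α, c α * 0 ^ α.level = c (Expo.rho k) * coeffZero k α := by
    intro α
    by_cases h : α = Expo.rho k
    · simp [h, coeffZero, Expo.level_rho]
    · by_cases hcα : c α = 0
      · simp [coeffZero, h, hcα]
      · simp [coeffZero, h, hc α hcα h]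
  have t1 := tendsto_tsum_mul_pow_zero (e := fun p : Expo k × Equiv.Perm (Fin k) => p.1.level)
    (by norm_num) hCs
  have t2 := tendsto_tsum_mul_pow_zero (by norm_num) hcs
  have e2 : ∑' α : Expo k, c α * (0 : ℂ) ^ α.level = c (Expo.rho k) := by
    simp only [hzero, coeffZero, mul_ite, mul_one, mul_zero, tsum_ite_eq]
  have e1 : ∑' p : Expo k × Equiv.Perm (Fin k), C p * (0 : ℂ) ^ p.1.level =
      c (Expo.rho k) * ∑' p, genTerm k (coeffZero k) z p := by
    rw [← tsum_mul_left]
    refine tsum_congr fun p => ?_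
    rw [hC, genTerm, ← mul_assoc, ← hzero]
    ring
  rw [e2] at t2
  rw [e1] at t1
  have t3 := (t1.div t2 hc0).mono_left (nhdsWithin_le_nhds (s := {0}ᶜ))
  have t4 := (tendsto_thetaF_zero hz hD).mono_left (nhdsWithin_le_nhds (s := {0}ᶜ))
  rw [mul_div_cancel_left₀ _ hc0] at t3
  refine tendsto_nhds_unique t3 (t4.congr' ?_)
  filter_upwards [self_mem_nhdsWithin, nhdsWithin_le_nhds (eventually_norm_lt one_pos),
    nhdsWithin_le_nhds (eventually_denomNeZero hz hD)] with q hq0 hq1 hqD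
  obtain ⟨a, ha⟩ := exists_hasThetaGeneratingFunction_of_ne_zero k hq1 hq0
  obtain ⟨s, hs0, hs, has⟩ := H q hq1 hq0 a ha
  rw [← (ha z hz).2 hqD]
  simp only [Pi.div_apply]
  rw [hs.tsum_eq, ← tsum_div_const]
  refine tsum_congr fun p => ?_
  rw [genTerm, has, hC]
  ring

/-- At `q = 0` only the terms with `n = 0, 1` occur in the relation, and they cancel. -/
theorem isSyzygetic_coeffZero (k : ℕ) : IsSyzygetic k 0 (coeffZero k) := by
  classical
  intro γ
  have hr : IsRearr (syzExp (Expo.rho k, 0)) (syzExp (Expo.rho k, 1)) := by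
    rw [isRearr_iff, syzExp, syzExp, idxMon_snoc, idxMon_snoc]
    have h1 : idxMon (fun i : Fin (k + 1) => (i : ℤ)) =
        idxMon (fun i : Fin k => (i : ℤ)) + Finsupp.single (k : ℤ) 1 := by
      rw [idxMon, Fin.sum_univ_castSucc]
      simp [idxMon]
    have h2 : idxMon (fun i : Fin (k + 1) => (i : ℤ)) =
        idxMon (fun i : Fin k => (i : ℤ) + 1) + Finsupp.single (0 : ℤ) 1 := by
      rw [idxMon, Fin.sum_univ_succ, add_comm]
      simp [idxMon]
    simpa [Expo.rho] using h2.symm.trans h1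
  have hiff : IsRearr (syzExp (Expo.rho k, 0)) γ ↔ IsRearr (syzExp (Expo.rho k, 1)) γ := by
    rw [isRearr_iff] at hr
    rw [isRearr_iff, isRearr_iff, hr]
  have hne : ((Expo.rho k, 0) : Expo k × ℤ) ≠ (Expo.rho k, 1) := by simp
  have := hasSum_sum_of_ne_finset_zero (L := SummationFilter.unconditional _)
    (s := {((Expo.rho k, 0) : Expo k × ℤ), (Expo.rho k, 1)})
    (f := fun p : Expo k × ℤ => if IsRearr (syzExp p) γ then
      (-1 : ℂ) ^ p.2 * 0 ^ tri p.2 * coeffZero k p.1 else 0) ?_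
  · rw [Finset.sum_pair hne] at this
    convert this using 1
    simp only [hiff]
    split_ifs <;> simp [tri_zero, tri_one]
  · rintro ⟨α, n⟩ hp
    split_ifs
    · by_cases hα : α = Expo.rho k
      · subst hα
        have h0 : n ≠ 0 := by
          rintro rfl
          simp at hp
        have h1 : n ≠ 1 := by
          rintro rfl
          simp at hp
        simp only
        rw [zero_zpow _ (tri_pos h0 h1).ne']
        ring
      · simp [coeffZero, hα]
    · rfl

theorem HasThetaGeneratingFunction.eq_coeffZero {k : ℕ} (hk : 0 < k) {a : Expo k → ℂ}
    (ha : HasThetaGeneratingFunction k 0 a) : a = coeffZero k :=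
  ha.unique (by simp) (hasThetaGeneratingFunction_coeffZero hk)

theorem HasThetaGeneratingFunction.isSyzygetic' {k : ℕ} (hk : 0 < k) {q : ℂ} (hq : ‖q‖ < 1)
    {a : Expo k → ℂ} (ha : HasThetaGeneratingFunction k q a) :
    IsSyzygetic k q a ∧ a (Expo.rho k) ≠ 0 := by
  rcases eq_or_ne q 0 with rfl | hq0
  · rw [ha.eq_coeffZero hk]
    exact ⟨isSyzygetic_coeffZero k, by simp [coeffZero]⟩
  · exact ⟨ha.isSyzygetic hq hq0, ha.rho_ne_zero hk hq hq0⟩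

theorem exists_hasThetaGeneratingFunction {k : ℕ} (hk : 0 < k) {q : ℂ} (hq : ‖q‖ < 1) :
    ∃ a : Expo k → ℂ, HasThetaGeneratingFunction k q a := by
  rcases eq_or_ne q 0 with rfl | hq0
  · exact ⟨_, hasThetaGeneratingFunction_coeffZero hk⟩
  · exact exists_hasThetaGeneratingFunction_of_ne_zero k hq hq0

/-- The coefficients are quotients of two power series in `q`; the denominator has no zero. -/
theorem differentiableOn_coeff {k : ℕ} (hk : 0 < k) {a : ℂ → Expo k → ℂ}
    (ha : ∀ q : ℂ, ‖q‖ < 1 → HasThetaGeneratingFunction k q (a q)) (α : Expo k) :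
    DifferentiableOn ℂ (fun q => a q α) (Metric.ball 0 1) := by
  obtain ⟨c, hc0, hc, H⟩ := exists_coeff_eq hk
  have hsum : ∀ r : ℝ, 0 < r → r < 1 → Summable fun α => ‖c α‖ * r ^ α.level := by
    intro r hr0 hr1
    have hn : ‖(r : ℂ)‖ = r := by simp [abs_of_pos hr0]
    obtain ⟨b, hb⟩ := exists_hasThetaGeneratingFunction hk (hn.trans_lt hr1)
    obtain ⟨s, -, hs, -⟩ := H r (hn.trans_lt hr1) (by simp [hr0.ne']) b hb
    exact hs.summable.norm.congr fun α => by rw [norm_mul, norm_pow, hn]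
  have hzero : ∀ α, c α * 0 ^ α.level = c (Expo.rho k) * coeffZero k α := by
    intro α
    by_cases h : α = Expo.rho k
    · simp [h, coeffZero, Expo.level_rho]
    · by_cases hcα : c α = 0
      · simp [coeffZero, h, hcα]
      · simp [coeffZero, h, hc α hcα h]
  set Φ : ℂ → ℂ := fun q => ∑' α : Expo k, c α * q ^ α.level with hΦ
  have hform : ∀ q ∈ Metric.ball (0 : ℂ) 1, Φ q ≠ 0 ∧ a q α = c α * q ^ α.level / Φ q := by
    intro q hq
    have hq : ‖q‖ < 1 := by simpa using hq
    rcases eq_or_ne q 0 with rfl | hq0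
    · have hΦ0 : Φ 0 = c (Expo.rho k) := by
        simp only [hΦ, hzero, coeffZero, mul_ite, mul_one, mul_zero, tsum_ite_eq]
      rw [hΦ0, hzero, (ha 0 hq).eq_coeffZero hk, mul_div_cancel_left₀ _ hc0]
      exact ⟨hc0, rfl⟩
    · obtain ⟨s, hs0, hs, has⟩ := H q hq hq0 (a q) (ha q hq)
      rw [show Φ q = s from hs.tsum_eq]
      exact ⟨hs0, has α⟩
  have hΦd : DifferentiableOn ℂ Φ (Metric.ball 0 1) := by
    intro q hq
    have hq : ‖q‖ < 1 := by simpa using hq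
    obtain ⟨r, hr1, hr2⟩ := exists_between hq
    have hr0 : 0 < r := (norm_nonneg q).trans_lt hr1
    have h1 : DifferentiableOn ℂ Φ (Metric.ball 0 r) := by
      refine Complex.differentiableOn_tsum_of_summable_norm (hsum r hr0 hr2) (fun α => ?_)
        Metric.isOpen_ball fun α w hw => ?_
      · exact (((differentiable_id.pow α.level).const_mul (c α))).differentiableOn
      · have hw : ‖w‖ < r := by simpa using hw
        rw [norm_mul, norm_pow]
        exact mul_le_mul_of_nonneg_left (pow_le_pow_left₀ (norm_nonneg w) hw.le _) (norm_nonneg _)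
    exact (h1.differentiableAt
      (Metric.isOpen_ball.mem_nhds (by simpa using hr1))).differentiableWithinAt
  refine DifferentiableOn.congr (f := fun q => c α * q ^ α.level / Φ q) ?_ fun q hq =>
    (hform q hq).2
  exact DifferentiableOn.div (((differentiable_id.pow α.level).const_mul (c α))).differentiableOn
    hΦd fun q hq => (hform q hq).1

/-! ### Relations between the multiples of the generators -/

theorem shiftMon_eq_idxMon {k : ℕ} (α : Expo k) (i : ℤ) :
    shiftMon α i = idxMon fun j => i + α.1 j := rfl

theorem isRearr_add_const {n : ℕ} {v w : Fin n → ℤ} (c : ℤ) :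
    IsRearr (fun j => c + v j) (fun j => c + w j) ↔ IsRearr v w := by
  refine exists_congr fun σ => ⟨fun h => funext fun j => ?_, fun h => funext fun j => ?_⟩
  · simpa using congrFun h j
  · simpa using congrFun h j

theorem shiftMon_injective {k : ℕ} (i : ℤ) : Function.Injective fun α : Expo k => shiftMon α i := by
  intro α β h
  have h1 : IsRearr (fun j => i + α.1 j) fun j => i + β.1 j := isRearr_iff.2 h
  rw [isRearr_add_const, ← isRearr_add_const 1] at h1
  refine Expo.eq_of_isRearr ?_
  simpa only [add_comm] using h1

/-- The coefficient of `x^m` in `x^d y_i`. -/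
noncomputable def genCoeff (k : ℕ) (a : Expo k → ℂ) (d : ℤ →₀ ℕ) (i : ℤ) (m : ℤ →₀ ℕ) : ℂ :=
  ∑ᶠ α : Expo k, if d + shiftMon α i = m then a α else 0

theorem genCoeff_apply {k : ℕ} (a : Expo k → ℂ) (d : ℤ →₀ ℕ) (i : ℤ) (α : Expo k) :
    genCoeff k a d i (d + shiftMon α i) = a α := by
  rw [genCoeff, finsum_eq_single _ α, if_pos rfl]
  intro β hβ
  rw [if_neg]
  exact fun h => hβ (shiftMon_injective i (add_left_cancel h))

theorem exists_of_genCoeff_ne_zero {k : ℕ} {a : Expo k → ℂ} {d : ℤ →₀ ℕ} {i : ℤ} {m : ℤ →₀ ℕ}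
    (h : genCoeff k a d i m ≠ 0) : ∃ α, d + shiftMon α i = m ∧ a α ≠ 0 := by
  by_contra! hno
  refine h ?_
  rw [genCoeff, finsum_eq_zero_of_forall_eq_zero]
  intro α
  split_ifs with hα
  · exact hno α hα
  · rfl

theorem finite_genCoeff_support {k : ℕ} (a : Expo k → ℂ) (d : ℤ →₀ ℕ) (i : ℤ) (m : ℤ →₀ ℕ) :
    (Function.support fun α : Expo k => if d + shiftMon α i = m then a α else 0).Finite := by
  refine Set.Subsingleton.finite fun α hα β hβ => ?_
  have h1 : d + shiftMon α i = m := by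
    by_contra h
    exact hα (if_neg h)
  have h2 : d + shiftMon β i = m := by
    by_contra h
    exact hβ (if_neg h)
  exact shiftMon_injective i (add_left_cancel (h1.trans h2.symm))

theorem single_add_shiftMon {k : ℕ} (p : Expo k × ℤ) (i : ℤ) :
    Finsupp.single (k * p.2 + i - 1) 1 + shiftMon p.1 (i - p.2) =
      idxMon fun j => i - 1 + syzExp p j := by
  rw [idxMon, Fin.sum_univ_castSucc, add_comm, shiftMon]
  simp only [syzExp, Fin.snoc_castSucc, Fin.snoc_last]
  congr 1
  · refine Finset.sum_congr rfl fun j _ => ?_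
    congr 1
    ring
  · congr 1
    ring

theorem finite_syzygy_support {k : ℕ} (hk : 0 < k) (a : Expo k → ℂ) (d : ℤ →₀ ℕ) (i : ℤ)
    (m : ℤ →₀ ℕ) :
    {n : ℤ | genCoeff k a (d + Finsupp.single (k * n + i - 1) 1) (i - n) m ≠ 0}.Finite := by
  refine (m.support.finite_toSet.preimage
    (f := fun n : ℤ => k * n + i - 1) ?_).subset fun n hn => ?_
  · intro n _ n' _ h
    have hk' : (k : ℤ) ≠ 0 := by exact_mod_cast hk.ne'
    simp only at h
    exact mul_left_cancel₀ hk' (by linarith)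
  · obtain ⟨α, h, -⟩ := exists_of_genCoeff_ne_zero hn
    rw [Set.mem_preimage, Finset.mem_coe, Finsupp.mem_support_iff, ← h]
    simp

/-- The relation `∑_n (-1)^n q^{n(n-1)/2} x_{kn+i-1} y_{i-n} = 0`. -/
theorem IsSyzygetic.finsum_eq_zero {k : ℕ} {q : ℂ} {a : Expo k → ℂ} (hk : 0 < k)
    (ha : IsSyzygetic k q a) (d : ℤ →₀ ℕ) (i : ℤ) (m : ℤ →₀ ℕ) :
    ∑ᶠ n : ℤ, (-1) ^ n * q ^ tri n *
      genCoeff k a (d + Finsupp.single (k * n + i - 1) 1) (i - n) m = 0 := by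
  classical
  set f : ℤ × Expo k → ℂ := fun p =>
    if d + Finsupp.single (k * p.1 + i - 1) 1 + shiftMon p.2 (i - p.1) = m then
      (-1) ^ p.1 * q ^ tri p.1 * a p.2 else 0 with hf
  have hfin : (Function.support f).Finite := by
    refine Set.Finite.of_finite_image (f := Prod.fst)
      ((finite_syzygy_support hk a d i m).subset ?_) ?_
    · rintro _ ⟨⟨n, α⟩, hp, rfl⟩
      have hp' : f (n, α) ≠ 0 := hp
      simp only [hf, ne_eq, ite_eq_right_iff, not_forall] at hp'
      obtain ⟨h1, h2⟩ := hp'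
      simp only [Set.mem_ofPred_eq]
      rw [← h1, genCoeff_apply]
      exact right_ne_zero_of_mul h2
    · rintro ⟨n, α⟩ hp ⟨n', β⟩ hp' h
      simp only at h
      subst h
      have h1 : f (n, α) ≠ 0 := hp
      have h2 : f (n, β) ≠ 0 := hp'
      simp only [hf, ne_eq, ite_eq_right_iff, not_forall] at h1 h2
      rw [shiftMon_injective (i - n) (add_left_cancel (h1.1.trans h2.1.symm))]
  have h1 : ∀ n : ℤ, (-1) ^ n * q ^ tri n *
      genCoeff k a (d + Finsupp.single (k * n + i - 1) 1) (i - n) m = ∑ᶠ α, f (n, α) := by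
    intro n
    rw [genCoeff, mul_finsum' _ _ (finite_genCoeff_support _ _ _ _)]
    refine finsum_congr fun α => ?_
    simp only [hf, mul_ite, mul_zero]
  simp only [h1]
  rw [← finsum_curry f hfin]
  by_cases hex : ∃ p0 : Expo k × ℤ,
      d + Finsupp.single (k * p0.2 + i - 1) 1 + shiftMon p0.1 (i - p0.2) = m
  · obtain ⟨p0, hp0⟩ := hex
    have h2 := ha (syzExp p0)
    rw [← (Equiv.prodComm ℤ (Expo k)).hasSum_iff] at h2
    have h3 : HasSum f 0 := by
      refine h2.of_forall_eq fun p => ?_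
      have hiff : IsRearr (syzExp (Equiv.prodComm ℤ (Expo k) p)) (syzExp p0) ↔
          d + Finsupp.single (k * p.1 + i - 1) 1 + shiftMon p.2 (i - p.1) = m := by
        rw [← hp0, add_assoc, add_assoc, add_right_inj, single_add_shiftMon,
          ← isRearr_add_const (i - 1), isRearr_iff, ← single_add_shiftMon]
        rfl
      simp only [Function.comp_apply, hf, hiff]
      rfl
    rw [← h3.tsum_eq, tsum_eq_finsum hfin]
  · push Not at hex
    refine finsum_eq_zero_of_forall_eq_zero fun p => ?_
    exact if_neg (hex (p.2, p.1))

theorem finite_shiftMon_le {k : ℕ} (i : ℤ) (m : ℤ →₀ ℕ) : {α : Expo k | shiftMon α i ≤ m}.Finite :=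
  (Set.finite_Iic m).preimage ((shiftMon_injective i).injOn)

theorem finite_koszul_support {k : ℕ} (a : Expo k → ℂ) (d : ℤ →₀ ℕ) (i j : ℤ) (m : ℤ →₀ ℕ) :
    {α : Expo k | genCoeff k a (d + shiftMon α j) i m ≠ 0}.Finite := by
  refine (finite_shiftMon_le j m).subset fun α hα => ?_
  obtain ⟨β, h, -⟩ := exists_of_genCoeff_ne_zero hα
  rw [Set.mem_ofPred_eq, ← h, add_assoc]
  exact (le_add_right le_rfl).trans (le_add_left le_rfl)

/-- The relation `y_j y_i = y_i y_j`. -/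
theorem finsum_koszul {k : ℕ} (a : Expo k → ℂ) (d : ℤ →₀ ℕ) (i j : ℤ) (m : ℤ →₀ ℕ) :
    ∑ᶠ α, a α * genCoeff k a (d + shiftMon α j) i m =
      ∑ᶠ α, a α * genCoeff k a (d + shiftMon α i) j m := by
  classical
  have key : ∀ i j : ℤ, ∑ᶠ α, a α * genCoeff k a (d + shiftMon α j) i m =
      ∑ᶠ p : Expo k × Expo k,
        if d + shiftMon p.1 j + shiftMon p.2 i = m then a p.1 * a p.2 else 0 := by
    intro i j
    rw [finsum_curry]
    · refine finsum_congr fun α => ?_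
      rw [genCoeff, mul_finsum' _ _ (finite_genCoeff_support _ _ _ _)]
      refine finsum_congr fun β => ?_
      simp only [mul_ite, mul_zero]
    · refine ((finite_shiftMon_le j m).prod (finite_shiftMon_le i m)).subset fun p hp => ?_
      have h : d + shiftMon p.1 j + shiftMon p.2 i = m := by
        by_contra h
        exact hp (if_neg h)
      refine ⟨?_, ?_⟩
      · rw [Set.mem_ofPred_eq, ← h, add_assoc]
        exact (le_add_right le_rfl).trans (le_add_left le_rfl)
      · rw [Set.mem_ofPred_eq, ← h]
        exact le_add_left le_rfl
  rw [key, key, ← finsum_comp_equiv (Equiv.prodComm (Expo k) (Expo k))]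
  refine finsum_congr fun p => ?_
  have hiff : d + shiftMon p.2 j + shiftMon p.1 i = m ↔
      d + shiftMon p.1 i + shiftMon p.2 j = m := by
    rw [add_right_comm]
  change (if d + shiftMon p.2 j + shiftMon p.1 i = m then a p.2 * a p.1 else 0) = _
  rw [mul_comm]
  exact if_congr hiff rfl rfl

/-- The energy `∑ m_j j²` of a monomial. -/
noncomputable def monEnergy (m : ℤ →₀ ℕ) : ℤ := m.sum fun j c => (c : ℤ) * j ^ 2

theorem monEnergy_add (m m' : ℤ →₀ ℕ) : monEnergy (m + m') = monEnergy m + monEnergy m' := by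
  unfold monEnergy
  rw [Finsupp.sum_add_index' (by simp) (by intros; push_cast; ring)]

theorem monEnergy_single (j : ℤ) : monEnergy (Finsupp.single j 1) = j ^ 2 := by
  simp [monEnergy]

theorem monEnergy_shiftMon {k : ℕ} (α : Expo k) (i : ℤ) :
    monEnergy (shiftMon α i) = α.energy + (i - 1) * (k * (k + 1)) + k * (i - 1) ^ 2 := by
  classical
  have h : ∀ s : Finset (Fin k), monEnergy (∑ j ∈ s, Finsupp.single (i + α.1 j) 1) =
      ∑ j ∈ s, (i + α.1 j) ^ 2 := by
    intro s
    induction s using Finset.induction_on with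
    | empty => simp [monEnergy]
    | insert a s ha ih =>
      rw [Finset.sum_insert ha, Finset.sum_insert ha, monEnergy_add, ih, monEnergy_single]
  have h2 : (k : ℤ) * (i - 1) ^ 2 = ∑ _j : Fin k, (i - 1) ^ 2 := by simp
  rw [shiftMon, h, ← two_mul_sum_expo α, Expo.energy, h2, Finset.mul_sum, Finset.mul_sum,
    ← Finset.sum_add_distrib, ← Finset.sum_add_distrib]
  exact Finset.sum_congr rfl fun j _ => by ring

/-- The monomial `x_i x_{i+1} ⋯ x_{i+k-1}`. -/
noncomputable def runMon (k : ℕ) (i : ℤ) : ℤ →₀ ℕ := shiftMon (Expo.rho k) i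

theorem runMon_apply (k : ℕ) (i t : ℤ) : runMon k i t = if i ≤ t ∧ t < i + k then 1 else 0 := by
  classical
  rw [runMon, shiftMon_eq_idxMon, idxMon_apply]
  split_ifs with h
  · rw [Fintype.card_eq_one_iff]
    refine ⟨⟨⟨(t - i).toNat, by omega⟩, ?_⟩, fun j => Subtype.ext (Fin.ext ?_)⟩
    · simp only [Expo.rho]
      omega
    · have := j.2
      simp only [Expo.rho] at this ⊢
      omega
  · rw [Fintype.card_eq_zero_iff]
    refine ⟨fun j => h ?_⟩
    have := j.2
    simp only [Expo.rho] at this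
    omega

theorem runMon_le_iff {k : ℕ} {i : ℤ} {m : ℤ →₀ ℕ} :
    runMon k i ≤ m ↔ ∀ t, i ≤ t → t < i + k → 0 < m t := by
  rw [Finsupp.le_def]
  constructor
  · intro h t h1 h2
    have := h t
    rw [runMon_apply, if_pos ⟨h1, h2⟩] at this
    omega
  · intro h t
    rw [runMon_apply]
    split_ifs with ht
    · exact h t ht.1 ht.2
    · exact Nat.zero_le _

/-- The first index of the leftmost factor of the form `x_i x_{i+1} ⋯ x_{i+k-1}` of a monomial. -/
noncomputable def leadStart (k : ℕ) (m : ℤ →₀ ℕ) : ℤ := sInf {i | runMon k i ≤ m}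

theorem bddBelow_runMon_le {k : ℕ} (hk : 0 < k) (m : ℤ →₀ ℕ) :
    BddBelow {i | runMon k i ≤ m} := by
  refine (m.support.finite_toSet.subset fun i hi => ?_).bddBelow
  rw [Finset.mem_coe, Finsupp.mem_support_iff]
  exact (runMon_le_iff.1 hi i le_rfl (by omega)).ne'

theorem runMon_leadStart_le {k : ℕ} (hk : 0 < k) {m : ℤ →₀ ℕ} (h : ∃ i, runMon k i ≤ m) :
    runMon k (leadStart k m) ≤ m :=
  Int.csInf_mem h (bddBelow_runMon_le hk m)

theorem leadStart_le {k : ℕ} (hk : 0 < k) {m : ℤ →₀ ℕ} {i : ℤ} (h : runMon k i ≤ m) :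
    leadStart k m ≤ i :=
  csInf_le (bddBelow_runMon_le hk m) h

/-! ### The truncated ideals -/

/-- The monomials of bidegree `(n, l)` in the variables `x_j` with `j ≤ N`. -/
def monSet (N n : ℤ) (l : ℕ) : Set (ℤ →₀ ℕ) := {m | bideg m = (n, l) ∧ ∀ j, N < j → m j = 0}

theorem finite_monSet (N n : ℤ) (l : ℕ) : (monSet N n l).Finite := by
  classical
  refine (Set.finite_Iic (Finsupp.indicator (Finset.Icc (n - l * N + N) N) fun _ _ => l)).subset
    fun m hm => ?_
  obtain ⟨hdeg, hN⟩ := hm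
  have hn : ∑ i ∈ m.support, (m i : ℤ) * i = n := congrArg Prod.fst hdeg
  have hl : ∑ i ∈ m.support, m i = l := congrArg Prod.snd hdeg
  have hle : ∀ i ∈ m.support, i ≤ N := fun i hi => by
    by_contra! h
    exact Finsupp.mem_support_iff.1 hi (hN i h)
  rw [Set.mem_Iic, Finsupp.le_def]
  intro j
  by_cases hj : j ∈ m.support
  · have hmj : 0 < m j := Nat.pos_of_ne_zero (Finsupp.mem_support_iff.1 hj)
    have h1 : ∑ i ∈ m.support, (m i : ℤ) * (i - N) = n - l * N := by
      rw [← hn, ← hl, Nat.cast_sum, Finset.sum_mul, ← Finset.sum_sub_distrib]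
      exact Finset.sum_congr rfl fun i _ => by ring
    have h2 : ∑ i ∈ m.support, (m i : ℤ) * (i - N) ≤ (m j : ℤ) * (j - N) := by
      rw [← Finset.add_sum_erase _ _ hj]
      refine add_le_of_nonpos_right (Finset.sum_nonpos fun i hi => ?_)
      have := hle i (Finset.mem_of_mem_erase hi)
      exact mul_nonpos_of_nonneg_of_nonpos (by positivity) (by linarith)
    have h3 := hle j hj
    have h4 : n - l * N + N ≤ j := by nlinarith
    rw [Finsupp.indicator_of_mem (Finset.mem_Icc.2 ⟨h4, h3⟩)]
    rw [← hl]
    exact Finset.single_le_sum (f := fun i => m i) (fun _ _ => Nat.zero_le _) hj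
  · rw [Finsupp.notMem_support_iff.1 hj]
    exact Nat.zero_le _

instance instFiniteMonSet (N n : ℤ) (l : ℕ) : Finite (monSet N n l) :=
  (finite_monSet N n l).to_subtype

/-- The coefficients of `x^d y_i` at the monomials in `monSet N n l`. -/
noncomputable def genVec {k : ℕ} (a : Expo k → ℂ) (N n : ℤ) (l : ℕ) (d : ℤ →₀ ℕ) (i : ℤ) :
    monSet N n l → ℂ := fun m => genCoeff k a d i m

/-- A subspace of a finite-dimensional space of functions is closed under pointwise finite sums. -/
theorem mem_of_finsum {S κ : Type*} [Finite S] (U : Submodule ℂ (S → ℂ)) {u : κ → S → ℂ}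
    (hu : ∀ p, u p ∈ U) (hfin : ∀ m, (Function.support fun p => u p m).Finite) :
    (fun m => ∑ᶠ p, u p m) ∈ U := by
  have hT : (⋃ m, Function.support fun p => u p m).Finite := Set.finite_iUnion hfin
  have : (fun m => ∑ᶠ p, u p m) = ∑ p ∈ hT.toFinset, u p := by
    funext m
    rw [Finset.sum_apply]
    refine finsum_eq_sum_of_support_subset _ fun p hp => ?_
    rw [Set.Finite.coe_toFinset]
    exact Set.mem_iUnion.2 ⟨m, hp⟩
  rw [this]
  exact Submodule.sum_mem _ fun p _ => hu p

section

variable {k : ℕ} {q : ℂ} {a : Expo k → ℂ} {N n : ℤ} {l : ℕ}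

/-- Modulo the variables `x_j`, `j > N`, the product `x^d y_i` vanishes if its leading monomial
does. -/
theorem genVec_eq_zero (hk : 0 < k) (ha : IsSyzygetic k q a) {d : ℤ →₀ ℕ} {i : ℤ}
    (h : d + runMon k i ∉ monSet N n l) : genVec a N n l d i = 0 := by
  funext m
  by_contra hne
  obtain ⟨α, hα, hα0⟩ := exists_of_genCoeff_ne_zero hne
  obtain ⟨hdeg, hN⟩ := m.2
  rw [← hα] at hdeg hN
  refine h ⟨?_, fun t ht => ?_⟩
  · rw [← hdeg, bideg_add, bideg_add, runMon, bideg_shiftMon, bideg_shiftMon]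
  · have h1 := hN t ht
    rw [Finsupp.add_apply, Nat.add_eq_zero_iff] at h1
    rw [Finsupp.add_apply, h1.1, zero_add, runMon_apply, if_neg]
    rintro ⟨h2, h3⟩
    obtain ⟨j, hj⟩ := ha.exists_le hk hα0
    have h4 := hN (i + α.1 j) (by omega)
    rw [Finsupp.add_apply, Nat.add_eq_zero_iff, shiftMon_eq_idxMon, idxMon_apply] at h4
    exact (Fintype.card_pos_iff.2 ⟨⟨j, rfl⟩⟩).ne' h4.2

theorem monEnergy_runMon_lt (hk : 0 < k) (ha : IsSyzygetic k q a) {α : Expo k} (hα : a α ≠ 0)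
    (hαρ : α ≠ Expo.rho k) (i : ℤ) : monEnergy (runMon k i) < monEnergy (shiftMon α i) := by
  rw [runMon, monEnergy_shiftMon, monEnergy_shiftMon]
  have := (ha.rho_ne_zero hk hα).2 hαρ
  linarith

/-- The multiple of a generator with leading monomial `μ`. -/
noncomputable def leadVec {k : ℕ} (a : Expo k → ℂ) (N n : ℤ) (l : ℕ) (μ : ℤ →₀ ℕ) :
    monSet N n l → ℂ :=
  genVec a N n l (μ - runMon k (leadStart k μ)) (leadStart k μ)

/-- The monomials that are divisible by some `x_i x_{i+1} ⋯ x_{i+k-1}`. -/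
def leadSet (k : ℕ) (N n : ℤ) (l : ℕ) : Set (ℤ →₀ ℕ) :=
  {μ | μ ∈ monSet N n l ∧ ∃ i, runMon k i ≤ μ}

instance instFiniteLeadSet (k : ℕ) (N n : ℤ) (l : ℕ) : Finite (leadSet k N n l) :=
  ((finite_monSet N n l).subset fun _ h => h.1).to_subtype

theorem leadVec_of_start {d : ℤ →₀ ℕ} {i : ℤ} (h : leadStart k (d + runMon k i) = i) :
    leadVec a N n l (d + runMon k i) = genVec a N n l d i := by
  rw [leadVec, h, add_tsub_cancel_right]

/-- The vectors with different leading monomials span. A multiple `x^d y_i` in which the factor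
`x_i ⋯ x_{i+k-1}` of the leading monomial is not the leftmost one is rewritten with the help of
the relations: if the leftmost factor overlaps this one, then `x_{i-1}` divides `x^d` and the
relation starting with `x_{i-1} y_i - x_{i+k-1} y_{i-1}` applies, otherwise the relation
`y_i y_j = y_j y_i` does. The other terms have leading monomials of higher energy. -/
theorem genVec_mem_span (hk : 0 < k) (ha : IsSyzygetic k q a) (h0 : a (Expo.rho k) ≠ 0)
    (d : ℤ →₀ ℕ) (i : ℤ) :
    genVec a N n l d i ∈ Submodule.span ℂ
      (Set.range fun μ : leadSet k N n l => leadVec a N n l μ.1) := by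
  set U := Submodule.span ℂ (Set.range fun μ : leadSet k N n l => leadVec a N n l μ.1) with hU
  obtain ⟨M, hM⟩ : ∃ M : ℤ, ∀ μ ∈ monSet N n l, monEnergy μ ≤ M := by
    obtain ⟨M, hM⟩ := ((finite_monSet N n l).image monEnergy).bddAbove
    exact ⟨M, fun μ hμ => hM ⟨μ, hμ, rfl⟩⟩
  have key : ∀ s : ℕ, ∀ d i, M < monEnergy (d + runMon k i) + s → genVec a N n l d i ∈ U := by
    intro s
    induction s with
    | zero =>
      intro d i h
      rw [genVec_eq_zero hk ha fun hm => ?_]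
      · exact U.zero_mem
      · have := hM _ hm
        omega
    | succ s ih =>
      intro d i hs
      induction hr : (i - leadStart k (d + runMon k i)).toNat using Nat.strong_induction_on
        generalizing d i with
      | _ r ihr =>
        by_cases hmem : d + runMon k i ∈ monSet N n l
        swap
        · rw [genVec_eq_zero hk ha hmem]
          exact U.zero_mem
        have hex : ∃ j, runMon k j ≤ d + runMon k i := ⟨i, le_add_left le_rfl⟩
        set μ := d + runMon k i with hμ
        set j := leadStart k μ with hj
        have hji : j ≤ i := leadStart_le hk (le_add_left le_rfl)
        have hjμ : runMon k j ≤ μ := runMon_leadStart_le hk hex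
        rcases hji.eq_or_lt with hji | hji
        · refine Submodule.subset_span ⟨⟨μ, hmem, hex⟩, ?_⟩
          exact leadVec_of_start hji
        by_cases hov : i < j + k
        · -- the two factors overlap
          have hd : 0 < d (i - 1) := by
            have h1 := runMon_le_iff.1 hjμ (i - 1) (by omega) (by omega)
            rw [hμ, Finsupp.add_apply, runMon_apply, if_neg (by omega)] at h1
            exact h1
          obtain ⟨d', rfl⟩ : ∃ d', d = d' + Finsupp.single (i - 1) 1 := by
            refine ⟨d - Finsupp.single (i - 1) 1, (tsub_add_cancel_of_le ?_).symm⟩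
            rw [Finsupp.single_le_iff]
            exact hd
          have hrun : ∀ m : ℤ, monEnergy (d' + Finsupp.single (k * m + i - 1) 1 +
              runMon k (i - m)) = monEnergy μ + k * (k + 1) * (2 * tri m) := by
            intro m
            simp only [hμ, monEnergy_add, runMon, monEnergy_shiftMon, monEnergy_single,
              two_mul_tri]
            ring
          set u : ℤ → monSet N n l → ℂ := fun m =>
            if m = 0 then 0 else (-((-1) ^ m * q ^ tri m)) •
              genVec a N n l (d' + Finsupp.single (k * m + i - 1) 1) (i - m) with hu
          have hfs : ∀ m : monSet N n l, (Function.support fun t => (-1 : ℂ) ^ t * q ^ tri t *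
              genCoeff k a (d' + Finsupp.single (k * t + i - 1) 1) (i - t) m).Finite := fun m =>
            (finite_syzygy_support hk a d' i m).subset fun t ht => right_ne_zero_of_mul ht
          have hufin : ∀ m, (Function.support fun t => u t m).Finite := by
            intro m
            refine (hfs m).subset fun t ht => ?_
            intro h
            refine ht ?_
            simp only [hu]
            split_ifs with ht0
            · rfl
            · rw [neg_smul, Pi.neg_apply, Pi.smul_apply, smul_eq_mul]
              exact neg_eq_zero.2 h
          have hsum : genVec a N n l (d' + Finsupp.single (i - 1) 1) i =
              fun m => ∑ᶠ t, u t m := by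
            funext m
            have h1 := ha.finsum_eq_zero hk d' i m
            have h2 : ∀ t, (-1 : ℂ) ^ t * q ^ tri t *
                genCoeff k a (d' + Finsupp.single (k * t + i - 1) 1) (i - t) m =
                (if t = 0 then genVec a N n l (d' + Finsupp.single (i - 1) 1) i m else 0) -
                  u t m := by
              intro t
              simp only [hu]
              split_ifs with ht0
              · subst ht0
                simp [genVec, tri_zero]
              · rw [neg_smul, Pi.neg_apply, Pi.smul_apply, smul_eq_mul, genVec]
                ring
            rw [finsum_congr h2, finsum_sub_distrib ((Set.finite_singleton 0).subset fun t ht => by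
              by_contra h
              exact ht (if_neg h)) (hufin m), finsum_eq_single _ 0 fun t ht => if_neg ht,
              if_pos rfl] at h1
            exact sub_eq_zero.1 h1
          rw [hsum]
          refine mem_of_finsum U (fun t => ?_) hufin
          simp only [hu]
          split_ifs with ht0
          · exact U.zero_mem
          refine U.smul_mem _ ?_
          by_cases ht1 : t = 1
          · subst ht1
            have hμ' : d' + Finsupp.single (k * 1 + i - 1) 1 + runMon k (i - 1) = μ := by
              rw [hμ, add_assoc, add_assoc]
              congr 1
              ext x
              simp only [Finsupp.add_apply, runMon_apply, Finsupp.single_apply]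
              split_ifs <;> omega
            refine ihr _ ?_ _ _ (by rw [hμ']; exact hs) rfl
            rw [hμ', ← hr]
            omega
          · refine ih _ _ ?_
            rw [hrun]
            have := tri_pos ht0 ht1
            have hk' : (1 : ℤ) ≤ k := by exact_mod_cast hk
            have hkk : (1 : ℤ) ≤ k * (k + 1) := by nlinarith
            push_cast at hs
            nlinarith
        · -- the two factors are disjoint
          have hd : runMon k j ≤ d := by
            rw [runMon_le_iff] at hjμ ⊢
            intro t h1 h2
            have h3 := hjμ t h1 h2
            rw [hμ, Finsupp.add_apply, runMon_apply, if_neg (by omega)] at h3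
            exact h3
          obtain ⟨d', hd'⟩ : ∃ d', d = d' + runMon k j :=
            ⟨d - runMon k j, (tsub_add_cancel_of_le hd).symm⟩
          rw [hd'] at hμ
          set u : Expo k → monSet N n l → ℂ := fun α =>
            a α • genVec a N n l (d' + shiftMon α i) j with hu
          set w : Expo k → monSet N n l → ℂ := fun α => open Classical in
            if α = Expo.rho k then 0 else a α • genVec a N n l (d' + shiftMon α j) i with hw
          have hufin : ∀ m, (Function.support fun t => u t m).Finite := fun m =>
            (finite_koszul_support a d' j i m).subset fun t ht => right_ne_zero_of_mul ht
          have hwfin : ∀ m, (Function.support fun t => w t m).Finite := by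
            refine fun m => (finite_koszul_support a d' i j m).subset fun t ht => ?_
            intro h
            refine ht ?_
            simp only [hw]
            split_ifs
            · rfl
            · rw [Pi.smul_apply, genVec, h, smul_zero]
          have hsum : genVec a N n l (d' + runMon k j) i = (a (Expo.rho k))⁻¹ •
              ((fun m => ∑ᶠ t, u t m) - fun m => ∑ᶠ t, w t m) := by
            rw [eq_inv_smul_iff₀ h0, eq_sub_iff_add_eq]
            funext m
            have h2 : ∀ α, a α * genCoeff k a (d' + shiftMon α j) i m =
                (open Classical in if α = Expo.rho k then
                  a (Expo.rho k) * genVec a N n l (d' + runMon k j) i m else 0) + w α m := by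
              intro α
              simp only [hw]
              split_ifs with hα
              · rw [hα, Pi.zero_apply, add_zero]
                rfl
              · rw [zero_add]
                rfl
            have h1 := finsum_koszul a d' i j m
            rw [finsum_congr h2, finsum_add_distrib ((Set.finite_singleton (Expo.rho k)).subset
              fun t ht => by
                by_contra h
                exact ht (if_neg h)) (hwfin m),
              finsum_eq_single _ (Expo.rho k) fun t ht => if_neg ht, if_pos rfl] at h1
            exact h1
          rw [hd', hsum]
          have hμ' : d' + shiftMon (Expo.rho k) i + runMon k j = μ := by
            rw [hμ, add_right_comm]
            rfl
          refine U.smul_mem _ (U.sub_mem (mem_of_finsum U (fun α => ?_) hufin)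
            (mem_of_finsum U (fun α => ?_) hwfin))
          · simp only [hu]
            by_cases hα0 : a α = 0
            · rw [hα0, zero_smul]
              exact U.zero_mem
            refine U.smul_mem _ ?_
            by_cases hα : α = Expo.rho k
            · subst hα
              refine ihr _ ?_ _ _ (by rw [hμ']; exact hs) rfl
              rw [hμ', ← hr]
              omega
            · refine ih _ _ ?_
              have h1 := monEnergy_runMon_lt hk ha hα0 hα i
              rw [hμ] at hs
              simp only [monEnergy_add] at hs ⊢
              push_cast at hs
              omega
          · simp only [hw]
            split_ifs with hα
            · exact U.zero_mem
            by_cases hα0 : a α = 0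
            · rw [hα0, zero_smul]
              exact U.zero_mem
            refine U.smul_mem _ (ih _ _ ?_)
            have h1 := monEnergy_runMon_lt hk ha hα0 hα j
            rw [hμ] at hs
            simp only [monEnergy_add] at hs ⊢
            push_cast at hs
            omega
  obtain ⟨s, hs⟩ : ∃ s : ℕ, M < monEnergy (d + runMon k i) + s :=
    ⟨(M - monEnergy (d + runMon k i) + 1).toNat, by omega⟩
  exact key s d i hs

/-- The vectors with different leading monomials are independent, since the other monomials in
`x^d y_i` have higher energy than the leading one. -/
theorem linearIndependent_leadVec (hk : 0 < k) (ha : IsSyzygetic k q a)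
    (h0 : a (Expo.rho k) ≠ 0) :
    LinearIndependent ℂ fun μ : leadSet k N n l => leadVec a N n l μ.1 := by
  classical
  have hlead : ∀ μ : leadSet k N n l,
      μ.1 - runMon k (leadStart k μ.1) + runMon k (leadStart k μ.1) = μ.1 := fun μ =>
    tsub_add_cancel_of_le (runMon_leadStart_le hk μ.2.2)
  rw [linearIndependent_iff']
  intro s g hg
  by_contra! hne
  obtain ⟨μ, hμs, hμ⟩ := hne
  obtain ⟨ν, hν, hmin⟩ := Finset.exists_min_image (s.filter fun μ => g μ ≠ 0)
    (fun μ => monEnergy μ.1) ⟨μ, Finset.mem_filter.2 ⟨hμs, hμ⟩⟩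
  obtain ⟨hνs, hgν⟩ := Finset.mem_filter.1 hν
  have h1 := congrFun hg ⟨ν.1, ν.2.1⟩
  rw [Finset.sum_apply, Finset.sum_eq_single ν] at h1
  · rw [Pi.smul_apply, smul_eq_mul, Pi.zero_apply, leadVec, genVec] at h1
    refine (mul_ne_zero hgν ?_) h1
    have h2 := genCoeff_apply a (ν.1 - runMon k (leadStart k ν.1)) (leadStart k ν.1) (Expo.rho k)
    have h3 := hlead ν
    rw [runMon] at h2 h3
    rw [h3] at h2
    rw [runMon, h2]
    exact h0
  · intro κ hκ hκν
    by_cases hgκ : g κ = 0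
    · rw [hgκ, zero_smul, Pi.zero_apply]
    rw [Pi.smul_apply, smul_eq_mul, mul_eq_zero]
    right
    by_contra h
    obtain ⟨α, hα, hα0⟩ := exists_of_genCoeff_ne_zero h
    simp only at hα
    by_cases hαρ : α = Expo.rho k
    · subst hαρ
      exact hκν (Subtype.ext ((hlead κ).symm.trans hα))
    · have h2 := monEnergy_runMon_lt hk ha hα0 hαρ (leadStart k κ.1)
      have h3 := hmin κ (Finset.mem_filter.2 ⟨hκ, hgκ⟩)
      have h4 := congrArg monEnergy (hlead κ)
      rw [monEnergy_add] at h4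
      rw [← hα, monEnergy_add] at h3
      omega
  · exact fun h => absurd hνs h

theorem finrank_span_genVec (hk : 0 < k) (ha : IsSyzygetic k q a) (h0 : a (Expo.rho k) ≠ 0) :
    Module.finrank ℂ (Submodule.span ℂ
      (Set.range fun p : (ℤ →₀ ℕ) × ℤ => genVec a N n l p.1 p.2)) =
      Nat.card (leadSet k N n l) := by
  have : Submodule.span ℂ (Set.range fun p : (ℤ →₀ ℕ) × ℤ => genVec a N n l p.1 p.2) =
      Submodule.span ℂ (Set.range fun μ : leadSet k N n l => leadVec a N n l μ.1) := by
    refine le_antisymm (Submodule.span_le.2 ?_) (Submodule.span_le.2 ?_)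
    · rintro _ ⟨p, rfl⟩
      exact genVec_mem_span hk ha h0 p.1 p.2
    · rintro _ ⟨μ, rfl⟩
      exact Submodule.subset_span ⟨(_, _), rfl⟩
  have := Fintype.ofFinite (leadSet k N n l)
  rw [‹Submodule.span ℂ _ = _›, finrank_span_eq_card (linearIndependent_leadVec hk ha h0),
    Nat.card_eq_fintype_card]

end

/-! ### The dimensions of the quotients -/

theorem coeffA_smul (m : ℤ →₀ ℕ) (c : ℂ) (F : algA) : coeffA m (c • F) = c * coeffA m F := by
  simp [coeffA]

theorem coeffA_ext {F G : algA} (h : ∀ m, coeffA m F = coeffA m G) : F = G :=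
  Subtype.ext (MvPowerSeries.ext h)

theorem coeffA_sub (m : ℤ →₀ ℕ) (F G : algA) : coeffA m (F - G) = coeffA m F - coeffA m G := by
  simp [coeffA]

/-- The element of `A` with the given coefficients. -/
noncomputable def algA.ofCoeff (f : (ℤ →₀ ℕ) → ℂ) (h : (bideg '' {m | f m ≠ 0}).Finite) : algA :=
  ⟨f, h⟩

theorem coeffA_ofCoeff (f : (ℤ →₀ ℕ) → ℂ) (h : (bideg '' {m | f m ≠ 0}).Finite) (m : ℤ →₀ ℕ) :
    coeffA m (algA.ofCoeff f h) = f m := rfl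

/-- The monomial `x^d`. -/
noncomputable def monA (d : ℤ →₀ ℕ) : algA :=
  algA.ofCoeff (fun m => open Classical in if m = d then 1 else 0)
    ((Set.finite_singleton (bideg d)).subset (by
      rintro _ ⟨m, hm, rfl⟩
      by_contra h
      exact hm (if_neg fun h' => h (by rw [h', Set.mem_singleton_iff]))))

theorem coe_monA (d : ℤ →₀ ℕ) : (monA d : MvPowerSeries ℤ ℂ) = MvPowerSeries.monomial d 1 := by
  classical
  ext m
  rw [MvPowerSeries.coeff_monomial]
  change (if m = d then (1 : ℂ) else 0) = _
  congr

theorem varA_eq_monA (j : ℤ) : varA j = monA (Finsupp.single j 1) :=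
  Subtype.ext (coe_monA _).symm

theorem monA_add (d e : ℤ →₀ ℕ) : monA (d + e) = monA d * monA e := by
  refine Subtype.ext ?_
  rw [Subalgebra.coe_mul, coe_monA, coe_monA, coe_monA, MvPowerSeries.monomial_mul_monomial,
    one_mul]

theorem monA_zero : monA 0 = 1 := by
  refine Subtype.ext ?_
  rw [coe_monA]
  rfl

theorem coeffA_mul_monA (m d : ℤ →₀ ℕ) (F : algA) :
    coeffA m (F * monA d) = open Classical in if d ≤ m then coeffA (m - d) F else 0 := by
  classical
  rw [coeffA, Subalgebra.coe_mul, coe_monA, MvPowerSeries.coeff_mul_monomial]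
  simp only [mul_one]
  congr

/-- The elements of `C_N` are those without monomials in the variables `x_j`, `j ≤ N`. -/
theorem mem_cutoff_iff {N : ℤ} {F : algA} :
    F ∈ cutoff N ↔ ∀ m : ℤ →₀ ℕ, (∀ j, N < j → m j = 0) → coeffA m F = 0 := by
  classical
  constructor
  · rintro ⟨p, hp⟩ m hm
    rw [(hp m).2]
    refine finsum_eq_zero_of_forall_eq_zero fun j => ?_
    simp only
    rw [varA_eq_monA, coeffA_mul_monA, if_neg]
    intro h
    rw [Finsupp.single_le_iff, hm j j.2] at h
    omega
  · intro h
    -- each monomial is divided by its variable of highest index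
    have hfin : ∀ j : ℤ, (bideg '' {m : ℤ →₀ ℕ | (if ∀ t, j < t → m t = 0 then
        coeffA (m + Finsupp.single j 1) F else 0) ≠ 0}).Finite := by
      intro j
      refine (F.2.image fun p => (p.1 - j, p.2 - 1)).subset ?_
      rintro _ ⟨m, hm, rfl⟩
      rw [Set.mem_ofPred_eq, ne_eq, ite_eq_right_iff, not_forall] at hm
      refine ⟨bideg (m + Finsupp.single j 1), ⟨_, hm.choose_spec, rfl⟩, ?_⟩
      rw [bideg_add]
      simp [bideg, monWeight]
    have hcoeff : ∀ (j : {j : ℤ // N < j}) (m : ℤ →₀ ℕ), coeffA m (algA.ofCoeff _ (hfin j) *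
        varA j) = if 0 < m j ∧ ∀ t, (j : ℤ) < t → m t = 0 then coeffA m F else 0 := by
      intro j m
      rw [varA_eq_monA, coeffA_mul_monA, coeffA_ofCoeff]
      by_cases h1 : 1 ≤ m j
      · have h2 : (∀ t, (j : ℤ) < t → (m - Finsupp.single (j : ℤ) 1 : ℤ →₀ ℕ) t = 0) ↔
            ∀ t, (j : ℤ) < t → m t = 0 := by
          refine forall₂_congr fun t ht => ?_
          rw [Finsupp.tsub_apply, Finsupp.single_apply, if_neg ht.ne, tsub_zero]
        rw [if_pos (Finsupp.single_le_iff.2 h1), tsub_add_cancel_of_le (Finsupp.single_le_iff.2 h1)]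
        exact if_congr (h2.trans (and_iff_right h1).symm) rfl rfl
      · rw [if_neg fun h => h1 (Finsupp.single_le_iff.1 h), if_neg fun h => h1 h.1]
    refine ⟨fun j => algA.ofCoeff _ (hfin j), fun m => ?_⟩
    simp only [hcoeff]
    have huniq : ∀ i j : {j : ℤ // N < j}, (0 < m i ∧ ∀ t, (i : ℤ) < t → m t = 0) →
        (0 < m j ∧ ∀ t, (j : ℤ) < t → m t = 0) → i = j := by
      intro i j hi hj
      by_contra hne
      rcases lt_or_gt_of_ne fun h => hne (Subtype.ext h) with h | h
      · exact hj.1.ne' (hi.2 j h)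
      · exact hi.1.ne' (hj.2 i h)
    refine ⟨Set.Subsingleton.finite fun i hi j hj => huniq i j ?_ ?_, ?_⟩
    · by_contra h
      exact hi (if_neg h)
    · by_contra h
      exact hj (if_neg h)
    · by_cases hm : ∀ j, N < j → m j = 0
      · rw [h m hm, finsum_eq_zero_of_forall_eq_zero]
        intro j
        split_ifs <;> rfl
      · push Not at hm
        obtain ⟨t, ht, hmt⟩ := hm
        have hts : t ∈ m.support := Finsupp.mem_support_iff.2 hmt
        set J := m.support.max' ⟨t, hts⟩ with hJ
        have hJm : m J ≠ 0 := Finsupp.mem_support_iff.1 (Finset.max'_mem _ _)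
        have hJN : N < J := ht.trans_le (Finset.le_max' _ _ hts)
        have hJmax : ∀ s, J < s → m s = 0 := by
          intro s hs
          by_contra h
          exact absurd (Finset.le_max' _ _ (Finsupp.mem_support_iff.2 h)) (not_le.2 hs)
        rw [finsum_eq_single _ ⟨J, hJN⟩, if_pos ⟨Nat.pos_of_ne_zero hJm, hJmax⟩]
        intro j hj
        exact if_neg fun h => hj (huniq j ⟨J, hJN⟩ h ⟨Nat.pos_of_ne_zero hJm, hJmax⟩)

/-- The coefficients of an element of `A` at the monomials in `monSet N n l`. -/
noncomputable def restrA (N n : ℤ) (l : ℕ) : algA →ₗ[ℂ] (monSet N n l → ℂ) where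
  toFun F m := coeffA m F
  map_add' F G := funext fun m => coeffA_add m F G
  map_smul' c F := funext fun m => coeffA_smul m c F

theorem restrA_apply {N n : ℤ} {l : ℕ} (F : algA) (m : monSet N n l) :
    restrA N n l F m = coeffA m F := rfl

theorem exists_restrA_eq (N n : ℤ) (l : ℕ) (v : monSet N n l → ℂ) :
    ∃ F ∈ compA n l, restrA N n l F = v := by
  classical
  have hfin :
      (bideg '' {m : ℤ →₀ ℕ | (if h : m ∈ monSet N n l then v ⟨m, h⟩ else 0) ≠ 0}).Finite := by
    refine (Set.finite_singleton (n, l)).subset ?_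
    rintro _ ⟨m, hm, rfl⟩
    rw [Set.mem_ofPred_eq, ne_eq, dite_eq_right_iff, not_forall] at hm
    exact hm.choose.1
  refine ⟨algA.ofCoeff _ hfin, fun m hm => ?_, funext fun m => ?_⟩
  · rw [coeffA_ofCoeff, ne_eq, dite_eq_right_iff, not_forall] at hm
    exact hm.choose.1
  · rw [restrA_apply, coeffA_ofCoeff, dif_pos m.2]

theorem rank_map_eq_of_ker {V X Y : Type} [AddCommGroup V] [AddCommGroup X] [AddCommGroup Y]
    [Module ℂ V] [Module ℂ X] [Module ℂ Y] (P : Submodule ℂ V) (f : V →ₗ[ℂ] X) (g : V →ₗ[ℂ] Y)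
    (h : ∀ v ∈ P, f v = 0 ↔ g v = 0) (hg : ∀ y, ∃ v ∈ P, g v = y) :
    Module.rank ℂ (P.map f) = Module.rank ℂ Y := by
  have hker : LinearMap.ker (f.domRestrict P) = LinearMap.ker (g.domRestrict P) := by
    ext v
    exact h v v.2
  have hsurj : Function.Surjective (g.domRestrict P) := by
    intro y
    obtain ⟨v, hv, rfl⟩ := hg y
    exact ⟨⟨v, hv⟩, rfl⟩
  rw [← LinearMap.range_domRestrict]
  exact LinearEquiv.rank_eq ((f.domRestrict P).quotKerEquivRange.symm.trans
    ((Submodule.quotEquivOfEq _ _ hker).trans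
      ((g.domRestrict P).quotKerEquivOfSurjective hsurj)))

/-- If the coefficients at `monSet N n l` of the elements of a homogeneous ideal `J` form the space
`U`, then the dimension of the component of the quotient is the codimension of `U`. -/
theorem dimCut_eq_rank_quotient {N n : ℤ} {l : ℕ} {J : Ideal algA}
    (U : Submodule ℂ (monSet N n l → ℂ)) (h1 : ∀ F ∈ J, restrA N n l F ∈ U)
    (h2 : ∀ v ∈ U, ∃ F ∈ J, F ∈ compA n l ∧ restrA N n l F = v) :
    dimCut N J n l = Module.rank ℂ ((monSet N n l → ℂ) ⧸ U) := by
  refine rank_map_eq_of_ker (compA n l) (Ideal.Quotient.mkₐ ℂ (J ⊔ cutoff N)).toLinearMap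
    (U.mkQ ∘ₗ restrA N n l) (fun F hF => ?_) fun v => ?_
  · have e1 : (Ideal.Quotient.mkₐ ℂ (J ⊔ cutoff N)).toLinearMap F = 0 ↔ F ∈ J ⊔ cutoff N :=
      Ideal.Quotient.eq_zero_iff_mem
    have e2 : (U.mkQ ∘ₗ restrA N n l) F = 0 ↔ restrA N n l F ∈ U :=
      Submodule.Quotient.mk_eq_zero U
    rw [e1, e2]
    constructor
    · intro hF
      obtain ⟨G, hG, H, hH, hGH⟩ := Submodule.mem_sup.1 hF
      have hH0 : restrA N n l H = 0 := funext fun m => mem_cutoff_iff.1 hH m m.2.2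
      rw [← hGH, map_add, hH0, add_zero]
      exact h1 G hG
    · intro hFU
      obtain ⟨G, hG, hGc, hGF⟩ := h2 _ hFU
      refine Submodule.mem_sup.2 ⟨G, hG, F - G, mem_cutoff_iff.2 fun m hm => ?_, add_sub_cancel _ _⟩
      by_contra hne
      have hdeg : bideg m = (n, l) := (Submodule.sub_mem _ hF hGc) m hne
      refine hne ?_
      have := congrFun hGF ⟨m, hdeg, hm⟩
      rw [restrA_apply, restrA_apply] at this
      rw [coeffA_sub, this, sub_self]
  · obtain ⟨v, rfl⟩ := Submodule.mkQ_surjective U v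
    obtain ⟨F, hF, rfl⟩ := exists_restrA_eq N n l v
    exact ⟨F, hF, rfl⟩

theorem coeffA_deformedGen {k : ℕ} (a : Expo k → ℂ) (i : ℤ) (m : ℤ →₀ ℕ) :
    coeffA m (deformedGen k a i) = ∑ᶠ α : Expo k, if shiftMon α i = m then a α else 0 := rfl

theorem coeffA_deformedGen_mul_monA {k : ℕ} (a : Expo k → ℂ) (d : ℤ →₀ ℕ) (i : ℤ) (m : ℤ →₀ ℕ) :
    coeffA m (deformedGen k a i * monA d) = genCoeff k a d i m := by
  classical
  rw [coeffA_mul_monA, genCoeff]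
  split_ifs with h
  · rw [coeffA_deformedGen]
    refine finsum_congr fun α => if_congr ?_ rfl rfl
    rw [add_comm, eq_tsub_iff_add_eq_of_le h]
  · refine (finsum_eq_zero_of_forall_eq_zero fun α => if_neg ?_).symm
    rintro rfl
    exact h (le_add_right le_rfl)

theorem bideg_of_genCoeff_ne_zero {k : ℕ} {a : Expo k → ℂ} {d : ℤ →₀ ℕ} {i : ℤ} {m : ℤ →₀ ℕ}
    (h : genCoeff k a d i m ≠ 0) : bideg m = bideg (d + runMon k i) := by
  obtain ⟨α, rfl, -⟩ := exists_of_genCoeff_ne_zero h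
  rw [bideg_add, bideg_add, runMon, bideg_shiftMon, bideg_shiftMon]

theorem mul_mem_formalIdeal {ι : Type*} (y : ι → algA) (F : algA) (i : ι) :
    y i * F ∈ formalIdeal y := by
  classical
  refine ⟨Pi.single i F, fun m => ⟨?_, ?_⟩⟩
  · refine (Set.finite_singleton i).subset fun j hj => ?_
    by_contra h
    refine hj ?_
    simp only
    rw [Pi.single_eq_of_ne h, zero_mul, coeffA_zero]
  · rw [finsum_eq_single _ i]
    · simp only
      rw [Pi.single_eq_same, mul_comm]
    · intro j hj
      simp only
      rw [Pi.single_eq_of_ne hj, zero_mul, coeffA_zero]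

/-- The coefficients of an element of the ideal are combinations of those of the products of the
generators with monomials. -/
theorem restrA_mem_span {k : ℕ} (a : Expo k → ℂ) (N n : ℤ) (l : ℕ) {F : algA}
    (hF : F ∈ formalIdeal (deformedGen k a)) :
    restrA N n l F ∈ Submodule.span ℂ
      (Set.range fun p : (ℤ →₀ ℕ) × ℤ => genVec a N n l p.1 p.2) := by
  classical
  obtain ⟨p, hp⟩ := hF
  have h1 : restrA N n l F = fun m => ∑ᶠ i, restrA N n l (p i * deformedGen k a i) m :=
    funext fun m => (hp m).2
  rw [h1]
  refine mem_of_finsum _ (fun i => ?_) fun m => (hp m).1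
  have hsupp : ∀ m : ℤ →₀ ℕ, (Function.support fun d : ℤ →₀ ℕ =>
      coeffA d (p i) * genCoeff k a d i m) ⊆ Finset.Iic m := by
    intro m d hd
    obtain ⟨α, rfl, -⟩ := exists_of_genCoeff_ne_zero (right_ne_zero_of_mul hd)
    simp
  have h2 : restrA N n l (p i * deformedGen k a i) =
      fun m => ∑ᶠ d : ℤ →₀ ℕ, (coeffA d (p i) • genVec a N n l d i) m := by
    funext m
    simp only [Pi.smul_apply, smul_eq_mul, genVec]
    rw [finsum_eq_sum_of_support_subset _ (hsupp m), restrA_apply, coeffA_mul]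
    refine Finset.sum_nbij' (fun e => e.1) (fun d => (d, m.1 - d)) ?_ ?_ ?_ ?_ ?_
    · rintro e he
      rw [Finset.mem_Iic, ← Finset.HasAntidiagonal.mem_antidiagonal.1 he]
      exact le_add_right le_rfl
    · intro d hd
      exact Finset.HasAntidiagonal.mem_antidiagonal.2 (add_tsub_cancel_of_le (Finset.mem_Iic.1 hd))
    · rintro e he
      refine Prod.ext rfl ?_
      simp only
      rw [← Finset.HasAntidiagonal.mem_antidiagonal.1 he, add_tsub_cancel_left]
    · intro d _
      rfl
    · intro e he
      rw [← coeffA_deformedGen_mul_monA, coeffA_mul_monA,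
        ← Finset.HasAntidiagonal.mem_antidiagonal.1 he, if_pos (le_add_right le_rfl),
        add_tsub_cancel_left]
  rw [h2]
  refine mem_of_finsum _ (fun d => Submodule.smul_mem _ _ (Submodule.subset_span ⟨(d, i), rfl⟩))
    fun m => (Finset.finite_toSet (Finset.Iic m.1)).subset (hsupp m)

theorem exists_mem_formalIdeal {k : ℕ} (a : Expo k → ℂ) (N n : ℤ) (l : ℕ)
    {v : monSet N n l → ℂ} (hv : v ∈ Submodule.span ℂ
      (Set.range fun p : (ℤ →₀ ℕ) × ℤ => genVec a N n l p.1 p.2)) :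
    ∃ F ∈ formalIdeal (deformedGen k a), F ∈ compA n l ∧ restrA N n l F = v := by
  induction hv using Submodule.span_induction with
  | mem v hv =>
    obtain ⟨⟨d, i⟩, rfl⟩ := hv
    have h1 : restrA N n l (deformedGen k a i * monA d) = genVec a N n l d i :=
      funext fun m => coeffA_deformedGen_mul_monA a d i m
    by_cases hd : bideg (d + runMon k i) = (n, l)
    · refine ⟨_, mul_mem_formalIdeal _ (monA d) i, fun m hm => ?_, h1⟩
      rw [coeffA_deformedGen_mul_monA] at hm
      rw [bideg_of_genCoeff_ne_zero hm, hd]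
    · refine ⟨0, Submodule.zero_mem _, Submodule.zero_mem _, ?_⟩
      rw [map_zero]
      funext m
      by_contra hne
      exact hd ((bideg_of_genCoeff_ne_zero (Ne.symm hne)).symm.trans m.2.1)
  | zero => exact ⟨0, Submodule.zero_mem _, Submodule.zero_mem _, map_zero _⟩
  | add v w _ _ ihv ihw =>
    obtain ⟨F, hF, hFc, rfl⟩ := ihv
    obtain ⟨G, hG, hGc, rfl⟩ := ihw
    exact ⟨F + G, Submodule.add_mem _ hF hG, Submodule.add_mem _ hFc hGc, map_add _ _ _⟩
  | smul c v _ ih =>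
    obtain ⟨F, hF, hFc, rfl⟩ := ih
    refine ⟨c • F, ?_, Submodule.smul_mem _ _ hFc, map_smul _ _ _⟩
    rw [Algebra.smul_def]
    exact Ideal.mul_mem_left _ _ hF

/-- The dimensions do not depend on the coefficients: they count the monomials that are not
divisible by any `x_i x_{i+1} ⋯ x_{i+k-1}`. -/
theorem dimCut_deformedGen {k : ℕ} (hk : 0 < k) {q : ℂ} {a : Expo k → ℂ} (ha : IsSyzygetic k q a)
    (h0 : a (Expo.rho k) ≠ 0) (N n : ℤ) (l : ℕ) :
    dimCut N (formalIdeal (deformedGen k a)) n l =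
      ((Nat.card (monSet N n l) - Nat.card (leadSet k N n l) : ℕ) : Cardinal) := by
  have := Fintype.ofFinite (monSet N n l)
  rw [dimCut_eq_rank_quotient _ (fun F hF => restrA_mem_span a N n l hF)
    (fun v hv => exists_mem_formalIdeal a N n l hv), ← Module.finrank_eq_rank]
  congr 1
  have h1 := Submodule.finrank_quotient_add_finrank (Submodule.span ℂ
    (Set.range fun p : (ℤ →₀ ℕ) × ℤ => genVec a N n l p.1 p.2))
  rw [finrank_span_genVec hk ha h0, Module.finrank_fintype_fun_eq_card,
    ← Nat.card_eq_fintype_card] at h1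
  omega

theorem prod_varA_eq_monA {ι : Type*} (s : Finset ι) (v : ι → ℤ) :
    ∏ j ∈ s, varA (v j) = monA (∑ j ∈ s, Finsupp.single (v j) 1) := by
  classical
  induction s using Finset.induction_on with
  | empty => simp [monA_zero]
  | insert a s ha ih => rw [Finset.prod_insert ha, Finset.sum_insert ha, ih, monA_add, varA_eq_monA]

theorem deformedGen_coeffZero (k : ℕ) (i : ℤ) :
    deformedGen k (coeffZero k) i = ∏ j : Fin k, varA (i + (j : ℤ)) := by
  classical
  rw [prod_varA_eq_monA]
  refine coeffA_ext fun m => ?_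
  rw [coeffA_deformedGen, finsum_eq_single _ (Expo.rho k)]
  · change _ = if m = _ then (1 : ℂ) else 0
    rw [coeffZero, if_pos rfl]
    exact if_congr eq_comm rfl rfl
  · intro α hα
    simp [coeffZero, hα]

theorem theorem5p2 (k : ℕ) (hk : 2 ≤ k) :
    (∀ q : ℂ, ‖q‖ < 1 → ∃ a : Expo k → ℂ, HasThetaGeneratingFunction k q a) ∧
    ∀ a : ℂ → Expo k → ℂ, (∀ q : ℂ, ‖q‖ < 1 → HasThetaGeneratingFunction k q (a q)) →
      IsFlatDeformation (fun q i => deformedGen k (a q) i)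
        (fun i : ℤ => ∏ j : Fin k, varA (i + (j : ℤ))) := by
  have hk0 : 0 < k := by omega
  refine ⟨fun q hq => exists_hasThetaGeneratingFunction hk0 hq, fun a ha => ?_⟩
  have ha0 : a 0 = coeffZero k := (ha 0 (by simp)).eq_coeffZero hk0
  refine ⟨fun i => ⟨(k : ℤ) * i + (k : ℤ) * (k - 1) / 2, k, fun q _ m hm => ?_⟩, fun i m => ?_,
    fun i => ?_, fun q hq N n l => ?_⟩
  · rw [coeffA_deformedGen] at hm
    obtain ⟨α, hα⟩ : ∃ α : Expo k, shiftMon α i = m := by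
      by_contra! h
      exact hm (finsum_eq_zero_of_forall_eq_zero fun α => if_neg (h α))
    rw [← hα, bideg_shiftMon]
  · by_cases h : ∃ α : Expo k, shiftMon α i = m
    · obtain ⟨α, rfl⟩ := h
      refine (differentiableOn_coeff hk0 ha α).congr fun q _ => ?_
      have := genCoeff_apply (a q) 0 i α
      simpa [genCoeff, coeffA_deformedGen] using this
    · push Not at h
      refine (differentiableOn_const (0 : ℂ)).congr fun q _ => ?_
      exact finsum_eq_zero_of_forall_eq_zero fun α => if_neg (h α)
  · simp only [ha0, deformedGen_coeffZero]
  · have h1 : (fun i : ℤ => ∏ j : Fin k, varA (i + (j : ℤ))) = deformedGen k (coeffZero k) :=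
      funext fun i => (deformedGen_coeffZero k i).symm
    obtain ⟨hs, h0⟩ := (ha q hq).isSyzygetic' hk0 hq
    rw [h1, dimCut_deformedGen hk0 (isSyzygetic_coeffZero k) (by simp [coeffZero])]
    exact dimCut_deformedGen hk0 hs h0 N n l
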